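/- \textbf{Conventions.} $\log$ is to base $2$. Machines are deterministic (multi-tape/multi-stack) Turing machines that have random access to an advice string $w$: they write an index in binary and obtain the indexed bit of $w$ (or the information that the index is out of range) in one step. For $\beta:\mathbb N\to\{0,1\}^*$: - $\mathrm{EXP}$ is the class of languages $A\subseteq\{0,1\}^*$ decided (without advice) in time $2^{p(|x|)}$ for some polynomial $p$. - $A\in\mathrm P/\beta$ if there are a machine $M$ and a polynomial $p$ such that for every $x$, $M$ on input $x$ with advice $\beta(|x|)$ halts within $p(|x|)$ steps (independently of the length of the advice) and accepts if and only if $x\in A$. We write $\mathrm P/\alpha(0^{\ell(n)})$ for $\mathrm P/\beta$ with $\beta(n)=\alpha(0^{\ell(n)})$. - $A\in\mathrm{BPP}/\beta$ if there are a machine $M$ and polynomials $p,q$ such that for every $x$, $M$ on input $x$ with advice $\beta(|x|)$ and a string $r\in\{0,1\}^{q(|x|)}$ of random bits (read sequentially) halts within $p(|x|)$ steps for every $r$, and for uniformly random $r$ it gives the right answer to "$x\in A$?" with probability at least $2/3$. $\mathrm{BPP}/O(n\log n)$ is the union of $\mathrm{BPP}/\beta$ over all $\beta$ with $|\beta(n)|=O(n\log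 n)$ as $n\to\infty$. - For $f:\mathbb N\to\mathbb N$, a function $g:\{0\}^*\to\{0,1\}^*$ is in $\mathrm{EXP}/f$ if there are $\beta$ with $|\beta(n)|\le f(n)$ for all $n$, a machine $M$ and a polynomial $p$ such that for every $n$, $M$ on input $0^n$ with advice $\beta(n)$ halts within $2^{p(n)}$ steps with output $g(0^n)$. A function $h:\{0\}^*\to\{0,1\}^*$ is in $\mathrm{i.o.}\text{-}\mathrm{EXP}/f$ if there is $g\in\mathrm{EXP}/f$ with $h(0^n)=g(0^n)$ for infinitely many $n$. The bound $f(n)=n-c\log\log n$ is understood as $\lfloor n-c\log\log n\rfloor$, replaced by $0$ where this is negative; at the values $n\le 1$, where $\log\log n$ is undefined, $\log\log n$ is read as $0$. \textbf{Theorem.} Let $\alpha:\{0\}^*\to\{0,1\}^*$ be length preserving, i.e. $|\alpha(0^n)|=n$ for all $n$, and let $c>0$ be a real constant. Suppose that $\alpha\notin\mathrm{i.o.}\text{-}\mathrm{EXP}/(n-c\log\log n)$. Then for every $A\in\mathrm{EXP}$: if $A\in\mathrm P/\alpha(0^{2^{n^d}})$ for some integer $d>0$, then $A\in\mathrm{BPP}/O(n\log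 n)$. -/

import Mathlib

/-!
Complexity classes with advice, over a concrete machine model with a step count.

A machine is a multi-stack Turing machine (finite control, finitely many stacks of bits; a two-sided
work tape is a pair of stacks, as in Mathlib's `Turing.TM2`), which in addition has random access to
an advice string: it writes an index in binary on a stack and obtains the indexed bit in one step.
-/

namespace Advice

/-- Instructions of a machine with stacks indexed by `K` and control states `Q`. Each takes one
step. -/
inductive Instr (K Q : Type) : Type
  /-- Push the bit `b` on the stack `k` and go to the state `next`. -/
  | push (k : K) (b : Bool) (next : Q) : Instr K Q
  /-- Remove the top of the stack `k` and branch on it (`none` if the stack is empty). -/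
  | pop (k : K) (next : Option Bool → Q) : Instr K Q
  /-- Branch on the advice bit whose index is written in binary on the stack `k`, the least
  significant bit being on top (`none` if the index is not smaller than the advice length). -/
  | query (k : K) (next : Option Bool → Q) : Instr K Q
  /-- Halt, accepting if `b = true` and rejecting if `b = false`. -/
  | halt (b : Bool) : Instr K Q

/-- A deterministic multi-stack machine with random access to an advice string. -/
structure Machine : Type 1 where
  /-- The index set of the stacks. -/
  K : Type
  /-- The set of control states. -/
  Q : Type
  [decK : DecidableEq K]
  [finK : Fintype K]
  [finQ : Fintype Q]
  /-- The stack that holds the input at the start. -/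
  inp : K
  /-- The stack that holds the random bits at the start (for probabilistic computations). -/
  rnd : K
  /-- The stack that holds the output at the end (for computations of functions). -/
  out : K
  /-- The initial state. -/
  start : Q
  /-- The program. -/
  code : Q → Instr K Q

attribute [instance] Machine.decK Machine.finK Machine.finQ

namespace Machine

/-- A configuration: the control state and the contents of the stacks (top first). -/
structure Cfg (M : Machine) : Type where
  state : M.Q
  stk : M.K → List Bool

/-- The initial configuration on the input `x` and the random bits `r`
(a machine with `rnd = inp` just has no random bits). -/
def init (M : Machine) (x r : List Bool) : M.Cfg where
  state := M.start
  stk := fun k => if k = M.inp then x else if k = M.rnd then r else []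

/-- One step of computation with the advice string `w`; halting configurations do not change. -/
def step (M : Machine) (w : List Bool) (c : M.Cfg) : M.Cfg :=
  match M.code c.state with
  | .push k b next => ⟨next, Function.update c.stk k (b :: c.stk k)⟩
  | .pop k next => ⟨next (c.stk k).head?, Function.update c.stk k (c.stk k).tail⟩
  | .query k next => ⟨next w[Nat.ofDigits 2 ((c.stk k).map Bool.toNat)]?, c.stk⟩
  | .halt _ => c

/-- The configuration after `t` steps on the input `x`, advice `w` and random bits `r`. -/
def run (M : Machine) (x w r : List Bool) (t : ℕ) : M.Cfg :=
  (M.step w)^[t] (M.init x r)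

/-- On the input `x`, advice `w` and random bits `r` the machine halts after at most `t` steps,
accepting if `b = true` and rejecting if `b = false`. -/
def HaltsWith (M : Machine) (x w r : List Bool) (t : ℕ) (b : Bool) : Prop :=
  M.code (M.run x w r t).state = .halt b

/-- On the input `x` and advice `w` the machine halts after at most `t` steps with output `y`. -/
def Outputs (M : Machine) (x w : List Bool) (t : ℕ) (y : List Bool) : Prop :=
  (∃ b, M.HaltsWith x w [] t b) ∧ (M.run x w [] t).stk M.out = y

end Machine

/-- `EXP`: the languages decided in time `2 ^ p(|x|)`, `p` a polynomial (without advice). -/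
def EXP : Set (Language Bool) :=
  {A | ∃ (M : Machine) (p : Polynomial ℕ), ∀ x : List Bool,
    ∃ b, M.HaltsWith x [] [] (2 ^ p.eval x.length) b ∧ (b = true ↔ x ∈ A)}

/-- `P/α` for an advice function `α`: the machine gets `α(|x|)` along with `x`, and its running time
is polynomial in `|x|` alone. -/
def PAdvice (α : ℕ → List Bool) : Set (Language Bool) :=
  {A | ∃ (M : Machine) (p : Polynomial ℕ), ∀ x : List Bool,
    ∃ b, M.HaltsWith x (α x.length) [] (p.eval x.length) b ∧ (b = true ↔ x ∈ A)}

/-- `BPP/α` for an advice function `α`: the running time is polynomial in `|x|` for all outcomes of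
the `q(|x|)` fair coin tosses, and on each `x` the answer is right with probability at least
`2/3`. -/
def BPPAdvice (α : ℕ → List Bool) : Set (Language Bool) :=
  {A | ∃ (M : Machine) (p q : Polynomial ℕ), ∀ x : List Bool,
    (∀ r : Fin (q.eval x.length) → Bool,
      ∃ b, M.HaltsWith x (α x.length) (List.ofFn r) (p.eval x.length) b) ∧
    (2 / 3 : ℝ) ≤
      (Nat.card {r : Fin (q.eval x.length) → Bool //
        ∃ b, M.HaltsWith x (α x.length) (List.ofFn r) (p.eval x.length) b ∧
          (b = true ↔ x ∈ A)} : ℝ) / 2 ^ q.eval x.length}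

/-- `BPP/O(g)`: the union of `BPP/β` over the advice functions `β` with `|β(n)| = O(g(n))`. -/
def BPPAdviceBigO (g : ℕ → ℝ) : Set (Language Bool) :=
  {A | ∃ β : ℕ → List Bool,
    Asymptotics.IsBigO Filter.atTop (fun n => ((β n).length : ℝ)) g ∧ A ∈ BPPAdvice β}

/-- `EXP/f` for functions from `{0}*` to `{0,1}*`, where `0ⁿ` is identified with `n`: the functions
`0ⁿ ↦ g n` computed in time `2 ^ p(n)`, `p` a polynomial, with an advice string of length at most
`f n` on the input `0ⁿ`. -/
def UnaryFunEXPAdvice (f : ℕ → ℕ) : Set (ℕ → List Bool) :=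
  {g | ∃ β : ℕ → List Bool, (∀ n, (β n).length ≤ f n) ∧
    ∃ (M : Machine) (p : Polynomial ℕ), ∀ n,
      M.Outputs (List.replicate n false) (β n) (2 ^ p.eval n) (g n)}

/-- `i.o.-C` for a class `C` of functions from `{0}*` to `{0,1}*`: the functions that agree with a
member of `C` on `0ⁿ` for infinitely many `n`. -/
def InfinitelyOften (C : Set (ℕ → List Bool)) : Set (ℕ → List Bool) :=
  {h | ∃ g ∈ C, {n | h n = g n}.Infinite}

end Advice

namespace Advice

/-! Put `N = 2 ^ n ^ d`, and call a string of length `N` good if the polynomial-time machine `M` for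
`A`, given this string as advice, is right on all inputs of length `n`. The string `α N` is good.

Good strings are dense. Since `A` is in `EXP`, goodness can be decided in time `2 ^ poly(N)`, and so
can the enumeration of all `2 ^ N` strings. Let `f(N) = ⌊N - c log log N⌋`. If for infinitely many
`n` there were at most `2 ^ f(N)` good strings, then `α N` could be recovered from its position
among them, which takes `f(N)` bits of advice, against the hardness of `α`
(`finite_setOf_card_good_le`). As `log log N = d log n`, the proportion of good strings is at least
`(n + 2) ^ (-E)` for a constant `E` (`exists_pow_mul_card_good`).

A few tests make random advice reliable. As long as some input is answered correctly by less than
3/4 of the strings that pass the tests collected so far, that input becomes a further test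
(`exists_list_of_forall`). Every test shrinks the set of survivors by the factor 3/4, but good
strings always survive, so `O(log n)` tests are enough; with their answers they occupy `O(n log n)`
bits, and these are the new advice. On input `x`, the probabilistic machine draws a random string,
runs `M` with it on the tests, starts again if one of them fails, and otherwise returns the answer
of `M` on `x`. A draw passes with probability at least `(n + 2) ^ (-E)`, and a passing draw is right
on `x` with probability at least 3/4, so polynomially many draws give success probability 2/3
(`le_expect_trials`, `two_thirds_le`).

A random string of length `N` is too long to write down. Its bits are tossed only when they are
queried, and are remembered in a dictionary; `Realizes` expresses that this yields the same
distribution.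

The remaining work is to realise both algorithms on actual machines with explicit time bounds:
`exists_machine_trials` for the probabilistic one and `exists_machine_reconstruct` for the recovery
of `α N`. They are assembled from program fragments by a calculus of weakest preconditions that also
counts steps. -/

/-- The contents of stacks indexed by `K`. -/
abbrev Store (K : Type) := K → List Bool

/-! ### Programs with exits: step-counted runs, composition, iteration. -/

section Instr

variable {K Q Q' : Type}

/-- Renaming the target states of an instruction. -/
def Instr.map (f : Q → Q') : Instr K Q → Instr K Q'
  | .push k b q => .push k b (f q)
  | .pop k next => .pop k fun o => f (next o)
  | .query k next => .query k fun o => f (next o)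
  | .halt b => .halt b

/-- The effect of an instruction other than `halt`. -/
def Instr.exec [DecidableEq K] (w : List Bool) : Instr K Q → Store K → Option (Q × Store K)
  | .push k b next, s => some (next, Function.update s k (b :: s k))
  | .pop k next, s => some (next (s k).head?, Function.update s k (s k).tail)
  | .query k next, s => some (next w[Nat.ofDigits 2 ((s k).map Bool.toNat)]?, s)
  | .halt _, _ => none

theorem Instr.exec_map [DecidableEq K] (w : List Bool) (f : Q → Q') (i : Instr K Q)
    (s : Store K) : (i.map f).exec w s = (i.exec w s).map (Prod.map f id) := by
  cases i <;> rfl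

end Instr

/-- A machine fragment with stacks indexed by `K` and with exits indexed by `E`. -/
structure Frag (K E : Type) : Type 1 where
  /-- The set of control states. -/
  Q : Type
  [finQ : Fintype Q]
  /-- The initial state. -/
  start : Q
  /-- The program. -/
  code : Q → Instr K (Q ⊕ E)

attribute [instance] Frag.finQ

section Reach

variable {K E E' S Q : Type} [DecidableEq K]

/-- The program reaches the exit `e` with the store `s'` in `t` steps. -/
inductive Reach (w : List Bool) (code : Q → Instr K (Q ⊕ E)) :
    Q ⊕ E → Store K → ℕ → E → Store K → Prop
  | exit (e : E) (s : Store K) : Reach w code (.inr e) s 0 e s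
  | step {q : Q} {s : Store K} {p : Q ⊕ E} {s' : Store K} {t : ℕ} {e : E} {s'' : Store K} :
      (code q).exec w s = some (p, s') → Reach w code p s' t e s'' →
      Reach w code (.inl q) s (t + 1) e s''

variable {w : List Bool} {code : Q → Instr K (Q ⊕ E)}

theorem reach_inl_iff {q : Q} {s : Store K} {t : ℕ} {e : E} {s'' : Store K} :
    Reach w code (.inl q) s t e s'' ↔ ∃ p s' t', t = t' + 1 ∧
      (code q).exec w s = some (p, s') ∧ Reach w code p s' t' e s'' := by
  constructor
  · intro h
    cases h with
    | step h1 h2 => exact ⟨_, _, _, rfl, h1, h2⟩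
  · rintro ⟨p, s', t', rfl, h1, h2⟩
    exact .step h1 h2

theorem reach_inr_iff {e : E} {s : Store K} {t : ℕ} {e' : E} {s'' : Store K} :
    Reach w code (.inr e) s t e' s'' ↔ t = 0 ∧ e = e' ∧ s = s'' := by
  constructor
  · intro h
    cases h
    exact ⟨rfl, rfl, rfl⟩
  · rintro ⟨rfl, rfl, rfl⟩
    exact .exit _ _

variable {R : E → Type} {code' : ∀ e, R e → Instr K (R e ⊕ E')} {start : ∀ e, R e}

/-- The program of a sequential composition. -/
def bindCode (code : Q → Instr K (Q ⊕ E)) (start : ∀ e, R e)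
    (code' : ∀ e, R e → Instr K (R e ⊕ E')) :
    Q ⊕ (Σ e, R e) → Instr K ((Q ⊕ Σ e, R e) ⊕ E')
  | .inl q => (code q).map (Sum.elim (fun q => .inl (.inl q)) fun e => .inl (.inr ⟨e, start e⟩))
  | .inr ⟨e, q⟩ => (code' e q).map (Sum.map (fun q => .inr ⟨e, q⟩) id)

/-- Control never returns from the second program to the first, so its runs correspond step by step
to those of the second program alone. -/
theorem reach_bindCode_inr {e : E} {p : R e ⊕ E'} {s : Store K} {t : ℕ} {e' : E'}
    {s' : Store K} :
    Reach w (bindCode code start code') (Sum.map (fun q => .inr ⟨e, q⟩) id p) s t e' s' ↔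
      Reach w (code' e) p s t e' s' := by
  induction t generalizing p s with
  | zero =>
    rcases p with q | q
    · simp [reach_inl_iff]
    · simp [reach_inr_iff]
  | succ t ih =>
    rcases p with q | q
    · simp only [Sum.map_inl, reach_inl_iff, Nat.add_right_cancel_iff, bindCode, Instr.exec_map]
      rcases h : (code' e q).exec w s with _ | ⟨p, s1⟩
      · simp
      · constructor
        · rintro ⟨p', s2, t', rfl, h2, h3⟩
          simp only [Option.map_some, Option.some.injEq, Prod.map_apply, Prod.mk.injEq, id] at h2
          obtain ⟨rfl, rfl⟩ := h2
          exact ⟨_, _, _, rfl, rfl, ih.1 h3⟩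
        · rintro ⟨p', s2, t', rfl, h2, h3⟩
          simp only [Option.some.injEq, Prod.mk.injEq] at h2
          obtain ⟨rfl, rfl⟩ := h2
          exact ⟨_, _, _, rfl, rfl, ih.2 h3⟩
    · simp [reach_inr_iff]

/-- An instruction leading to the exit `e` of the first program is redirected straight to `start e`.
The transition costs no step, and running times simply add. -/
theorem reach_bindCode_inl {p : Q ⊕ E} {s : Store K} {t : ℕ} {e' : E'} {s' : Store K} :
    Reach w (bindCode code start code')
        (Sum.elim (fun q => .inl (.inl q)) (fun e => .inl (.inr ⟨e, start e⟩)) p) s t e' s' ↔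
      ∃ t1 e s1 t2, t = t1 + t2 ∧ Reach w code p s t1 e s1 ∧
        Reach w (code' e) (.inl (start e)) s1 t2 e' s' := by
  have base : ∀ {e s t}, Reach w (bindCode code start code') (.inl (.inr ⟨e, start e⟩)) s t e' s' ↔
      ∃ t1 e_1 s1 t2, t = t1 + t2 ∧ Reach w code (.inr e) s t1 e_1 s1 ∧
        Reach w (code' e_1) (.inl (start e_1)) s1 t2 e' s' := by
    intro e s t
    have := reach_bindCode_inr (w := w) (code := code) (start := start) (code' := code') (e := e)
      (p := .inl (start e)) (s := s) (t := t) (e' := e') (s' := s')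
    rw [Sum.map_inl] at this
    rw [this]
    constructor
    · intro h
      exact ⟨0, e, s, t, by omega, .exit _ _, h⟩
    · rintro ⟨t1, e1, s1, t2, rfl, h1, h2⟩
      obtain ⟨rfl, rfl, rfl⟩ := reach_inr_iff.1 h1
      rwa [Nat.zero_add]
  induction t generalizing p s with
  | zero =>
    rcases p with q | e
    · simp only [Sum.elim_inl, reach_inl_iff]
      constructor
      · rintro ⟨_, _, _, h, _⟩
        omega
      · rintro ⟨_, _, _, _, h, _, _, _, _, h', _⟩
        omega
    · exact base
  | succ t ih =>
    rcases p with q | e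
    · simp only [Sum.elim_inl, reach_inl_iff (q := Sum.inl q), bindCode, Instr.exec_map]
      rcases h : (code q).exec w s with _ | ⟨p, s1⟩
      · simp [reach_inl_iff (code := code), h]
      · constructor
        · rintro ⟨p', s2, t', ht, h2, h3⟩
          obtain rfl : t = t' := by omega
          simp only [Option.map_some, Option.some.injEq, Prod.map_apply, Prod.mk.injEq, id] at h2
          obtain ⟨rfl, rfl⟩ := h2
          obtain ⟨t1, e, s2, t2, rfl, h4, h5⟩ := ih.1 h3
          exact ⟨t1 + 1, e, s2, t2, by omega, .step h h4, h5⟩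
        · rintro ⟨t1, e, s2, t2, ht, h4, h5⟩
          rw [reach_inl_iff] at h4
          obtain ⟨p', s3, t', rfl, h6, h7⟩ := h4
          rw [h] at h6
          simp only [Option.some.injEq, Prod.mk.injEq] at h6
          obtain ⟨rfl, rfl⟩ := h6
          exact ⟨_, _, _, rfl, rfl, ih.2 ⟨t', e, s2, t2, by omega, h7, h5⟩⟩
    · exact base

variable {T : S → Type} {body : ∀ a, T a → Instr K (T a ⊕ (S ⊕ E))} {begin : ∀ a, T a}

/-- The program of an iteration. -/
def iterCode (begin : ∀ a, T a) (body : ∀ a, T a → Instr K (T a ⊕ (S ⊕ E))) :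
    (Σ a, T a) → Instr K ((Σ a, T a) ⊕ E)
  | ⟨a, q⟩ => (body a q).map
      (Sum.elim (fun q => .inl ⟨a, q⟩) (Sum.map (fun a' => ⟨a', begin a'⟩) id))

/-- Peels off one round: its exit `x` is `.inl a'` if another round follows with loop state `a'`,
and `.inr e` if the loop is left. Termination of a particular loop is shown later by induction on
its data. -/
theorem reach_iterCode {a : S} {p : T a ⊕ (S ⊕ E)} {s : Store K} {t : ℕ} {e' : E}
    {s' : Store K} :
    Reach w (iterCode begin body) (Sum.elim (fun q => .inl ⟨a, q⟩)
        (Sum.map (fun a' => ⟨a', begin a'⟩) id) p) s t e' s' ↔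
      ∃ t1 x s1 t2, t = t1 + t2 ∧ Reach w (body a) p s t1 x s1 ∧
        Sum.elim (fun a' => Reach w (iterCode begin body) (.inl ⟨a', begin a'⟩) s1 t2 e' s')
          (fun e => e = e' ∧ s1 = s' ∧ t2 = 0) x := by
  have base : ∀ {x s t}, Reach w (iterCode begin body)
        (Sum.map (fun a' => ⟨a', begin a'⟩) id x) s t e' s' ↔
      ∃ t1 x_1 s1 t2, t = t1 + t2 ∧ Reach w (body a) (.inr x) s t1 x_1 s1 ∧
        Sum.elim (fun a' => Reach w (iterCode begin body) (.inl ⟨a', begin a'⟩) s1 t2 e' s')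
          (fun e => e = e' ∧ s1 = s' ∧ t2 = 0) x_1 := by
    intro x s t
    rcases x with a' | e
    · constructor
      · intro h
        exact ⟨0, .inl a', s, t, by omega, .exit _ _, h⟩
      · rintro ⟨t1, x, s1, t2, rfl, h1, h2⟩
        obtain ⟨rfl, rfl, rfl⟩ := reach_inr_iff.1 h1
        rw [Nat.zero_add]
        exact h2
    · simp only [Sum.map_inr, reach_inr_iff, id]
      constructor
      · rintro ⟨rfl, rfl, rfl⟩
        exact ⟨0, .inr e, s, 0, rfl, ⟨rfl, rfl, rfl⟩, rfl, rfl, rfl⟩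
      · rintro ⟨t1, x, s1, t2, rfl, ⟨rfl, rfl, rfl⟩, h2, h3, h4⟩
        exact ⟨by omega, h2, h3⟩
  induction t generalizing p s with
  | zero =>
    rcases p with q | x
    · simp only [Sum.elim_inl, reach_inl_iff]
      constructor
      · rintro ⟨_, _, _, h, _⟩
        omega
      · rintro ⟨_, _, _, _, h, ⟨_, _, _, h', _⟩, _⟩
        omega
    · exact base
  | succ t ih =>
    rcases p with q | x
    · rw [Sum.elim_inl, reach_inl_iff]
      simp only [iterCode, Instr.exec_map]
      rcases h : (body a q).exec w s with _ | ⟨p, s1⟩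
      · simp [reach_inl_iff (code := body a), h]
      · constructor
        · rintro ⟨p', s2, t', ht, h2, h3⟩
          obtain rfl : t = t' := by omega
          simp only [Option.map_some, Option.some.injEq, Prod.map_apply, Prod.mk.injEq, id] at h2
          obtain ⟨rfl, rfl⟩ := h2
          obtain ⟨t1, e, s2, t2, rfl, h4, h5⟩ := ih.1 h3
          exact ⟨t1 + 1, e, s2, t2, by omega, .step h h4, h5⟩
        · rintro ⟨t1, e, s2, t2, ht, h4, h5⟩
          rw [reach_inl_iff] at h4
          obtain ⟨p', s3, t', rfl, h6, h7⟩ := h4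
          rw [h] at h6
          simp only [Option.some.injEq, Prod.mk.injEq] at h6
          obtain ⟨rfl, rfl⟩ := h6
          exact ⟨_, _, _, rfl, rfl, ih.2 ⟨t', e, s2, t2, by omega, h7, h5⟩⟩
    · exact base

end Reach

/-! ### Fragments and their weakest preconditions. -/

namespace Frag

variable {K E E' S : Type}

/-- Does nothing. -/
def ret [Inhabited K] (e : E) : Frag K E where
  Q := Unit
  start := ()
  -- Every state has to execute an instruction. A query whose answer is ignored leaves all stacks
  -- alone, so it is a no-op of one step.
  code _ := .query default fun _ => .inr e

/-- Pushes a bit. -/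
def push (k : K) (b : Bool) : Frag K Unit where
  Q := Unit
  start := ()
  code _ := .push k b (.inr ())

/-- Pops a bit. -/
def pop (k : K) : Frag K (Option Bool) where
  Q := Unit
  start := ()
  code _ := .pop k .inr

/-- Queries the advice. -/
def query (k : K) : Frag K (Option Bool) where
  Q := Unit
  start := ()
  code _ := .query k .inr

/-- Sequential composition; the second fragment may depend on the exit of the first one. -/
def bind [Fintype E] (f : Frag K E) (g : E → Frag K E') : Frag K E' where
  Q := f.Q ⊕ Σ e, (g e).Q
  start := .inl f.start
  code := bindCode f.code (fun e => (g e).start) fun e => (g e).code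

/-- Iteration, with a finite state. -/
def iter [Fintype S] (body : S → Frag K (S ⊕ E)) (a : S) : Frag K E where
  Q := Σ a, (body a).Q
  start := ⟨a, (body a).start⟩
  code := iterCode (fun a => (body a).start) fun a => (body a).code

/-- Weakest precondition: started on the store `s`, the fragment reaches after `t` steps an exit
`e` with a store `s'` for which `P e s' t` holds. -/
def wp [DecidableEq K] (w : List Bool) (f : Frag K E) (s : Store K)
    (P : E → Store K → ℕ → Prop) : Prop :=
  ∃ t e s', Reach w f.code (.inl f.start) s t e s' ∧ P e s' t

variable [DecidableEq K] {w : List Bool}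

theorem wp_mono {f : Frag K E} {s : Store K} {P P' : E → Store K → ℕ → Prop}
    (h : wp w f s P) (h' : ∀ e s' t, P e s' t → P' e s' t) : wp w f s P' := by
  obtain ⟨t, e, s', h1, h2⟩ := h
  exact ⟨t, e, s', h1, h' _ _ _ h2⟩

theorem wp_of_exec {f : Frag K E} {s : Store K} {P : E → Store K → ℕ → Prop} {e : E}
    {s' : Store K} (h : (f.code f.start).exec w s = some (.inr e, s')) :
    wp w f s P ↔ P e s' 1 := by
  constructor
  · rintro ⟨t, e', s'', h1, h2⟩
    obtain ⟨p, s3, t', rfl, h3, h4⟩ := reach_inl_iff.1 h1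
    rw [h] at h3
    simp only [Option.some.injEq, Prod.mk.injEq] at h3
    obtain ⟨rfl, rfl⟩ := h3
    obtain ⟨rfl, rfl, rfl⟩ := reach_inr_iff.1 h4
    exact h2
  · intro h1
    exact ⟨1, e, s', .step h (.exit _ _), h1⟩

@[simp]
theorem wp_ret [Inhabited K] {e : E} {s : Store K} {P : E → Store K → ℕ → Prop} :
    wp w (ret e) s P ↔ P e s 1 :=
  wp_of_exec rfl

@[simp]
theorem wp_push {k : K} {b : Bool} {s : Store K} {P : Unit → Store K → ℕ → Prop} :
    wp w (push k b) s P ↔ P () (Function.update s k (b :: s k)) 1 :=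
  wp_of_exec rfl

@[simp]
theorem wp_pop {k : K} {s : Store K} {P : Option Bool → Store K → ℕ → Prop} :
    wp w (pop k) s P ↔ P (s k).head? (Function.update s k (s k).tail) 1 :=
  wp_of_exec rfl

@[simp]
theorem wp_query {k : K} {s : Store K} {P : Option Bool → Store K → ℕ → Prop} :
    wp w (query k) s P ↔ P w[Nat.ofDigits 2 ((s k).map Bool.toNat)]? s 1 :=
  wp_of_exec rfl

@[simp]
theorem wp_bind [Fintype E] {f : Frag K E} {g : E → Frag K E'} {s : Store K}
    {P : E' → Store K → ℕ → Prop} :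
    wp w (bind f g) s P ↔
      wp w f s fun e s' t => wp w (g e) s' fun e' s'' t' => P e' s'' (t + t') := by
  have key := fun t e' s' => reach_bindCode_inl (w := w) (code := f.code)
    (start := fun e => (g e).start) (code' := fun e => (g e).code) (p := .inl f.start) (s := s)
    (t := t) (e' := e') (s' := s')
  constructor
  · rintro ⟨t, e, s', h, h3⟩
    obtain ⟨t1, e1, s1, t2, rfl, h1, h2⟩ := (key _ _ _).1 h
    exact ⟨t1, e1, s1, h1, t2, e, s', h2, h3⟩
  · rintro ⟨t1, e1, s1, h1, t2, e, s', h2, h3⟩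
    exact ⟨_, e, s', (key _ _ _).2 ⟨t1, e1, s1, t2, rfl, h1, h2⟩, h3⟩

/-- Unfolds a single round, so the specification of a loop follows by induction on the stack that
controls it. -/
theorem wp_iter [Fintype S] {body : S → Frag K (S ⊕ E)} {a : S} {s : Store K}
    {P : E → Store K → ℕ → Prop} :
    wp w (iter body a) s P ↔ wp w (body a) s fun x s' t =>
      Sum.elim (fun a' => wp w (iter body a') s' fun e s'' t' => P e s'' (t + t'))
        (fun e => P e s' t) x := by
  have key := fun t e' s' => reach_iterCode (w := w) (begin := fun a => (body a).start)
    (body := fun a => (body a).code) (p := .inl (body a).start) (s := s) (t := t) (e' := e')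
    (s' := s')
  constructor
  · rintro ⟨t, e, s', h, h3⟩
    obtain ⟨t1, x, s1, t2, rfl, h1, h2⟩ := (key _ _ _).1 h
    refine ⟨t1, x, s1, h1, ?_⟩
    rcases x with a' | e'
    · exact ⟨t2, e, s', h2, h3⟩
    · obtain ⟨rfl, rfl, rfl⟩ := h2
      exact h3
  · rintro ⟨t1, x, s1, h1, h⟩
    rcases x with a' | e'
    · obtain ⟨t2, e, s', h2, h3⟩ := h
      exact ⟨_, e, s', (key _ _ _).2 ⟨t1, .inl a', s1, t2, rfl, h1, h2⟩, h3⟩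
    · exact ⟨t1, e', s1, (key _ _ _).2 ⟨t1, .inr e', s1, 0, rfl, h1, rfl, rfl, rfl⟩, h⟩

end Frag

/-- The machine that runs a fragment and accepts or rejects according to the exit. -/
def Frag.toMachine {K : Type} [DecidableEq K] [Fintype K] (f : Frag K Bool) (inp rnd out : K) :
    Machine where
  K := K
  Q := f.Q ⊕ Bool
  inp := inp
  rnd := rnd
  out := out
  start := .inl f.start
  code
    | .inl q => f.code q
    | .inr b => .halt b

namespace Machine

theorem step_eq_of_exec (M : Machine) (w : List Bool) {c : M.Cfg} {q : M.Q} {s : M.K → List Bool}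
    (h : (M.code c.state).exec w c.stk = some (q, s)) : M.step w c = ⟨q, s⟩ := by
  unfold step
  unfold Instr.exec at h
  split at h <;> simp_all only [Option.some.injEq, Prod.mk.injEq, reduceCtorEq]
  obtain ⟨rfl, rfl⟩ := h
  rfl

theorem step_of_halt (M : Machine) (w : List Bool) {c : M.Cfg} {b : Bool}
    (h : M.code c.state = .halt b) : M.step w c = c := by
  simp [step, h]

theorem iterate_step_of_halt (M : Machine) (w : List Bool) {c : M.Cfg} {b : Bool}
    (h : M.code c.state = .halt b) (t : ℕ) : (M.step w)^[t] c = c :=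
  Function.iterate_fixed (M.step_of_halt w h) t

theorem iterate_step_of_reach {K : Type} [DecidableEq K] [Fintype K] (f : Frag K Bool)
    (inp rnd out : K) (w : List Bool) {p : f.Q ⊕ Bool} {s : Store K} {t : ℕ} {e : Bool}
    {s' : Store K} (h : Reach w f.code p s t e s') :
    ((f.toMachine inp rnd out).step w)^[t] ⟨p, s⟩ = ⟨.inr e, s'⟩ := by
  induction h with
  | exit => rfl
  | @step q s p s' t e s'' h1 h2 ih =>
    rw [Function.iterate_succ_apply]
    have : (f.toMachine inp rnd out).step w ⟨.inl q, s⟩ = ⟨p, s'⟩ :=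
      step_eq_of_exec (M := f.toMachine inp rnd out) w (c := ⟨.inl q, s⟩) h1
    rw [this, ih]

/-- Passes from fragments to machines. A halted configuration stays fixed, so an upper bound `T` on
the running time may serve as the number of steps. -/
theorem run_toMachine {K : Type} [DecidableEq K] [Fintype K] (f : Frag K Bool)
    (inp rnd out : K) (w x r : List Bool) {P : Bool → Store K → Prop} {T : ℕ}
    (h : Frag.wp w f (fun k => if k = inp then x else if k = rnd then r else [])
      fun b s t => P b s ∧ t ≤ T) :
    ∃ b, (f.toMachine inp rnd out).HaltsWith x w r T b ∧
      P b ((f.toMachine inp rnd out).run x w r T).stk := by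
  obtain ⟨t, e, s', h1, h2, h3⟩ := h
  have h4 := iterate_step_of_reach f inp rnd out w h1
  have h5 : (f.toMachine inp rnd out).run x w r T = ⟨.inr e, s'⟩ := by
    obtain ⟨u, rfl⟩ := Nat.exists_eq_add_of_le' h3
    unfold run
    rw [Function.iterate_add_apply]
    refine (congrArg _ h4).trans ?_
    exact iterate_step_of_halt (f.toMachine inp rnd out) w (b := e) rfl u
  refine ⟨e, ?_, ?_⟩
  · unfold HaltsWith
    rw [h5]
    rfl
  · rw [h5]
    exact h2

end Machine

end Advice

/-! ### Binary counters and elementary stack routines. -/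

namespace Advice

open Function (update)

/-- The number with the given binary digits, least significant digit first. -/
def val (l : List Bool) : ℕ := Nat.ofDigits 2 (l.map Bool.toNat)

@[simp]
theorem val_nil : val [] = 0 := rfl

@[simp]
theorem val_cons (b : Bool) (l : List Bool) : val (b :: l) = b.toNat + 2 * val l := by
  simp [val, Nat.ofDigits_cons]

theorem val_lt (l : List Bool) : val l < 2 ^ l.length := by
  induction l with
  | nil => simp
  | cons b l ih =>
    have := Bool.toNat_le b
    simp only [val_cons, List.length_cons, pow_succ]
    omega

theorem val_injective {l l' : List Bool} (h : l.length = l'.length) (hv : val l = val l') :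
    l = l' := by
  induction l generalizing l' with
  | nil => simpa [eq_comm] using h
  | cons b l ih =>
    rcases l' with _ | ⟨b', l'⟩
    · simp at h
    · simp only [val_cons] at hv
      have h1 : b = b' := by
        cases b <;> cases b' <;> simp at hv ⊢ <;> omega
      subst h1
      rw [ih (by simpa using h) (by omega)]

/-- Binary increment, least significant bit first, with the information about an overflow, when a
digit is appended if `grow = true`. -/
def incr (grow : Bool) : List Bool → Bool × List Bool
  | [] => (true, if grow then [true] else [])
  | true :: l => ((incr grow l).1, false :: (incr grow l).2)
  | false :: l => (false, true :: l)

theorem val_incr_true (l : List Bool) : val (incr true l).2 = val l + 1 := by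
  induction l with
  | nil => rfl
  | cons b l ih =>
    cases b
    · simp [incr, add_comm]
    · simp [incr, ih]
      ring

theorem length_incr_true_le (l : List Bool) : (incr true l).2.length ≤ l.length + 1 := by
  induction l with
  | nil => simp [incr]
  | cons b l ih => cases b <;> simp [incr, ih]

theorem length_incr_false (l : List Bool) : (incr false l).2.length = l.length := by
  induction l with
  | nil => rfl
  | cons b l ih => cases b <;> simp [incr, ih]

theorem val_incr_false (l : List Bool) :
    val (incr false l).2 + (incr false l).1.toNat * 2 ^ l.length = val l + 1 := by
  induction l with
  | nil => rfl
  | cons b l ih =>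
    cases b
    · simp [incr, add_comm]
    · simp only [incr, val_cons, Bool.toNat_false, Bool.toNat_true, List.length_cons]
      linarith [pow_succ 2 l.length, ih, mul_left_comm (incr false l).1.toNat 2 (2 ^ l.length),
        pow_succ 2 l.length ▸ mul_left_comm (incr false l).1.toNat (2 ^ l.length) 2]

namespace Frag

variable {K : Type} [Inhabited K]

/-- Empties a stack. -/
def clear (a : K) : Frag K Unit :=
  iter (fun _ : Unit => (pop a).bind fun o => match o with
    | none => ret (.inr ())
    | some _ => ret (.inl ())) ()

/-- Moves the stack `a` to the stack `b` bit by bit. -/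
def move (a b : K) : Frag K Unit :=
  iter (fun _ : Unit => (pop a).bind fun o => match o with
    | none => ret (.inr ())
    | some x => (push b x).bind fun _ => ret (.inl ())) ()

/-- Moves the stack `a` to the stacks `b` and `c` bit by bit. -/
def fork (a b c : K) : Frag K Unit :=
  iter (fun _ : Unit => (pop a).bind fun o => match o with
    | none => ret (.inr ())
    | some x => (push b x).bind fun _ => (push c x).bind fun _ => ret (.inl ())) ()

/-- Puts a copy of the stack `a` on top of the stack `c`; the stack `b` is auxiliary. -/
def copy (a b c : K) : Frag K Unit :=
  (move a b).bind fun _ => fork b a c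

/-- Multiplies the stack `c` (in unary) by the stack `a`; `b` and `d` are auxiliary. -/
def mul (a b c d : K) : Frag K Unit :=
  (move c d).bind fun _ => iter (fun _ : Unit => (pop d).bind fun o => match o with
    | none => ret (.inr ())
    | some _ => (copy a b c).bind fun _ => ret (.inl ())) ()

/-- Multiplies the stack `c` (in unary) by a power of the stack `a`; `b` and `d` are auxiliary. -/
def mulPow (a b c d : K) : ℕ → Frag K Unit
  | 0 => ret ()
  | e + 1 => (mul a b c d).bind fun _ => mulPow a b c d e

/-- Binary increment of the stack `a` (least significant bit on top); `b` is auxiliary. The exit is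
`true` in case of an overflow, when a new digit is appended if `grow = true`. -/
def inc (a b : K) (grow : Bool) : Frag K Bool :=
  (iter (fun _ : Unit => (pop a).bind fun o => match o with
    | none => if grow then (push a true).bind fun _ => ret (.inr true) else ret (.inr true)
    | some true => (push b false).bind fun _ => ret (.inl ())
    | some false => (push a true).bind fun _ => ret (.inr false)) ()).bind fun o =>
  (move b a).bind fun _ => ret o

/-- Puts the reversed advice on top of the stack `c`; `a` and `b` are auxiliary. -/
def readAdvice (a b c : K) : Frag K Unit :=
  iter (fun _ : Unit => (query a).bind fun o => match o with
    | none => (clear a).bind fun _ => ret (.inr ())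
    | some x => (push c x).bind fun _ => (inc a b true).bind fun _ => ret (.inl ())) ()

variable [DecidableEq K] {w : List Bool}

/-- The pattern of all specifications below: the postcondition is an arbitrary `P`, demanded for
every running time up to a bound. Exact step counts are thereby hidden, and specifications can be
chained in the order of execution. -/
theorem wp_clear {a : K} {s : Store K} {P : Unit → Store K → ℕ → Prop}
    (h : ∀ t ≤ 2 * (s a).length + 2, P () (update s a []) t) : wp w (clear a) s P := by
  obtain ⟨l, hl⟩ : ∃ l, s a = l := ⟨_, rfl⟩
  induction l generalizing s P with
  | nil =>
    rw [clear, wp_iter]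
    simp only [wp_bind, wp_pop, hl, List.head?_nil, wp_ret, Sum.elim_inr, List.tail_nil]
    exact h _ (by simp)
  | cons x l ih =>
    rw [clear, wp_iter]
    simp only [wp_bind, wp_pop, hl, List.head?_cons, wp_ret, Sum.elim_inl, List.tail_cons]
    refine ih ?_ (by simp)
    intro t ht
    simp only [Function.update_self, Function.update_idem, hl, List.length_cons] at *
    exact h _ (by omega)

theorem wp_move {a b : K} (hab : a ≠ b) {s : Store K} {P : Unit → Store K → ℕ → Prop}
    (h : ∀ t ≤ 3 * (s a).length + 2, P () (update (update s a []) b ((s a).reverse ++ s b)) t) :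
    wp w (move a b) s P := by
  obtain ⟨l, hl⟩ : ∃ l, s a = l := ⟨_, rfl⟩
  induction l generalizing s P with
  | nil =>
    rw [move, wp_iter]
    simp only [wp_bind, wp_pop, hl, List.head?_nil, wp_ret, Sum.elim_inr, List.tail_nil]
    have := h 2 (by simp)
    simp only [hl, List.reverse_nil, List.nil_append] at this
    convert this using 1
    ext1 k
    simp only [Function.update_apply]
    split_ifs <;> simp_all
  | cons x l ih =>
    rw [move, wp_iter]
    simp only [wp_bind, wp_pop, hl, List.head?_cons, wp_ret, Sum.elim_inl, List.tail_cons, wp_push]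
    refine ih ?_ (by simp [hab])
    intro t ht
    have := h (1 + (1 + 1) + t) (by simp [hab] at ht; simp [hl]; omega)
    convert this using 1
    ext1 k
    simp only [Function.update_apply]
    split_ifs <;> simp_all

theorem wp_fork {a b c : K} (hab : a ≠ b) (hac : a ≠ c) (hbc : b ≠ c) {s : Store K}
    {P : Unit → Store K → ℕ → Prop}
    (h : ∀ t ≤ 4 * (s a).length + 2, P () (update (update (update s a []) b
      ((s a).reverse ++ s b)) c ((s a).reverse ++ s c)) t) :
    wp w (fork a b c) s P := by
  obtain ⟨l, hl⟩ : ∃ l, s a = l := ⟨_, rfl⟩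
  induction l generalizing s P with
  | nil =>
    rw [fork, wp_iter]
    simp only [wp_bind, wp_pop, hl, List.head?_nil, wp_ret, Sum.elim_inr, List.tail_nil]
    have := h 2 (by simp)
    simp only [hl, List.reverse_nil, List.nil_append] at this
    convert this using 1
    ext1 k
    simp only [Function.update_apply]
    split_ifs <;> simp_all
  | cons x l ih =>
    rw [fork, wp_iter]
    simp only [wp_bind, wp_pop, hl, List.head?_cons, wp_ret, Sum.elim_inl, List.tail_cons, wp_push]
    refine ih ?_ (by simp [hab, hac])
    intro t ht
    have := h (1 + (1 + (1 + 1)) + t) (by simp [hab, hac] at ht; simp [hl]; omega)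
    convert this using 1
    ext1 k
    simp only [Function.update_apply]
    split_ifs <;> simp_all

theorem wp_copy {a b c : K} (hab : a ≠ b) (hac : a ≠ c) (hbc : b ≠ c) {s : Store K}
    (hb : s b = []) {P : Unit → Store K → ℕ → Prop}
    (h : ∀ t ≤ 7 * (s a).length + 4, P () (update s c (s a ++ s c)) t) :
    wp w (copy a b c) s P := by
  rw [copy, wp_bind]
  refine wp_move hab fun t ht => ?_
  refine wp_fork hab.symm hbc hac fun t' ht' => ?_
  have := h (t + t') (by simp [hb] at ht'; omega)
  convert this using 1
  ext1 k
  simp only [Function.update_apply]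
  split_ifs <;> simp_all

theorem wp_mul {a b c d : K} (hab : a ≠ b) (hac : a ≠ c) (had : a ≠ d) (hbc : b ≠ c)
    (hbd : b ≠ d) (hcd : c ≠ d) {s : Store K} {m n : ℕ} (ha : s a = List.replicate m false)
    (hb : s b = []) (hc : s c = List.replicate n false) (hd : s d = [])
    {P : Unit → Store K → ℕ → Prop}
    (h : ∀ t ≤ 9 * (m + 1) * (n + 1), P () (update s c (List.replicate (n * m) false)) t) :
    wp w (mul a b c d) s P := by
  -- Invariant: `d` counts the `i` remaining rounds, and `c` holds the `j` symbols produced so far.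
  have loop : ∀ (i j : ℕ) (s : Store K) (P : Unit → Store K → ℕ → Prop),
      s a = List.replicate m false → s b = [] → s c = List.replicate j false →
      s d = List.replicate i false →
      (∀ t ≤ (7 * m + 6) * i + 2,
        P () (update (update s d []) c (List.replicate (i * m + j) false)) t) →
      wp w (iter (fun _ : Unit => (pop d).bind fun o => match o with
        | none => ret (.inr ())
        | some _ => (copy a b c).bind fun _ => ret (.inl ())) ()) s P := by
    intro i
    induction i with
    | zero =>
      intro j s P ha hb hc hd h
      rw [wp_iter]
      simp only [wp_bind, wp_pop, hd, List.replicate_zero, List.head?_nil, wp_ret, Sum.elim_inr,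
        List.tail_nil]
      have := h 2 (by simp)
      convert this using 1
      ext1 k
      simp only [Function.update_apply]
      split_ifs <;> simp_all
    | succ i ih =>
      intro j s P ha hb hc hd h
      rw [wp_iter]
      simp only [wp_bind, wp_pop, hd, List.replicate_succ, List.head?_cons, wp_ret, Sum.elim_inl,
        List.tail_cons]
      refine wp_copy hab hac hbc (by simp [hbd, hb]) fun t ht => ?_
      refine ih (m + j) _ _ (by simp [hac, had, ha]) (by simp [hbc, hbd, hb])
        (by simp [had, hcd, ha, hc]) (by simp [hcd.symm]) fun t' ht' => ?_
      simp only [Function.update_of_ne had, ha, List.length_replicate] at ht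
      have := h (1 + (t + 1) + t') (by linarith)
      convert this using 1
      ext1 k
      simp only [Function.update_apply, add_mul, one_mul, add_assoc]
      split_ifs <;> simp_all
  rw [mul, wp_bind]
  refine wp_move hcd fun t ht => ?_
  refine loop n 0 _ _ (by simp [*]) (by simp [*]) (by simp [*]) (by simp [*]) fun t' ht' => ?_
  simp only [hc, List.length_replicate] at ht
  have := h (t + t') (by nlinarith)
  convert this using 1
  ext1 k
  simp only [Function.update_apply]
  split_ifs <;> simp_all

theorem wp_mulPow {a b c d : K} (hab : a ≠ b) (hac : a ≠ c) (had : a ≠ d) (hbc : b ≠ c)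
    (hbd : b ≠ d) (hcd : c ≠ d) {e : ℕ} {s : Store K} {m n : ℕ}
    (ha : s a = List.replicate m false) (hb : s b = []) (hc : s c = List.replicate n false)
    (hd : s d = []) {P : Unit → Store K → ℕ → Prop}
    (h : ∀ t ≤ 10 * (e + 1) * (n + 1) * (m + 1) ^ (e + 1),
      P () (update s c (List.replicate (n * m ^ e) false)) t) :
    wp w (mulPow a b c d e) s P := by
  induction e generalizing s n P with
  | zero =>
    rw [mulPow, wp_ret]
    have := h 1 (by simp only [zero_add, pow_one, mul_one]; nlinarith)
    convert this using 1
    simp [← hc]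
  | succ e ih =>
    rw [mulPow, wp_bind]
    refine wp_mul hab hac had hbc hbd hcd ha hb hc hd fun t ht => ?_
    refine ih (n := n * m) (by simp [*]) (by simp [*]) (by simp [*]) (by simp [hcd.symm, *])
      fun t' ht' => ?_
    have h1 : 0 < (m + 1) ^ (e + 1) := by positivity
    -- The form of the time bound is made for the recursion: replacing `n` by `n * m` costs at most
    -- one factor `m + 1`, which the exponent `e + 1` provides.
    have h2 : (n * m + 1) * (m + 1) ^ (e + 1) ≤ (n + 1) * (m + 1) * (m + 1) ^ (e + 1) :=
      Nat.mul_le_mul_right _ (by nlinarith)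
    have h3 : (m + 1) * (n + 1) * 1 ≤ (m + 1) * (n + 1) * (m + 1) ^ (e + 1) :=
      Nat.mul_le_mul_left _ h1
    have := h (t + t') (by
      calc t + t' ≤ 9 * (m + 1) * (n + 1) + 10 * (e + 1) * (n * m + 1) * (m + 1) ^ (e + 1) := by
            omega
        _ ≤ 10 * ((m + 1) * (n + 1) * (m + 1) ^ (e + 1)) +
            10 * (e + 1) * ((n + 1) * (m + 1) * (m + 1) ^ (e + 1)) := by
          have := Nat.mul_le_mul_left (10 * (e + 1)) h2
          nlinarith
        _ = 10 * (e + 1 + 1) * (n + 1) * (m + 1) ^ (e + 1 + 1) := by ring)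
    convert this using 1
    simp only [Function.update_idem, pow_succ']
    congr 2
    ring

theorem wp_inc {a b : K} (hab : a ≠ b) {grow : Bool} {s : Store K} (hb : s b = [])
    {P : Bool → Store K → ℕ → Prop}
    (h : ∀ t ≤ 6 * (s a).length + 6,
      P (incr grow (s a)).1 (update s a (incr grow (s a)).2) t) :
    wp w (inc a b grow) s P := by
  -- The carry may stop anywhere, so the way in which the digits are split between `a` (now `r`) and
  -- `b` (now `u`) is left open. The final `move` puts them together again.
  have loop : ∀ (l : List Bool) (s : Store K) (P : Bool → Store K → ℕ → Prop), s a = l →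
      (∀ t ≤ 3 * l.length + 3, ∀ r u, u.reverse ++ r = (s b).reverse ++ (incr grow l).2 →
        u.length ≤ (s b).length + l.length → P (incr grow l).1 (update (update s a r) b u) t) →
      wp w (iter (fun _ : Unit => (pop a).bind fun o => match o with
        | none => if grow then (push a true).bind fun _ => ret (.inr true) else ret (.inr true)
        | some true => (push b false).bind fun _ => ret (.inl ())
        | some false => (push a true).bind fun _ => ret (.inr false)) ()) s P := by
    intro l
    induction l with
    | nil =>
      intro s P ha h
      rw [wp_iter]
      simp only [wp_bind, wp_pop, ha, List.head?_nil, List.tail_nil]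
      cases grow
      · simp only [Bool.false_eq_true, if_false, wp_ret, Sum.elim_inr]
        have := h 2 (by simp) [] (s b) (by simp [incr]) (by simp)
        simp only [incr] at this
        convert this using 1
        ext1 k
        simp only [Function.update_apply]
        split_ifs <;> simp_all
      · simp only [if_true, wp_bind, wp_push, wp_ret, Sum.elim_inr]
        have := h 3 (by simp) [true] (s b) (by simp [incr]) (by simp)
        simp only [incr] at this
        convert this using 1
        ext1 k
        simp only [Function.update_apply]
        split_ifs <;> simp_all
    | cons x l ih =>
      intro s P ha h
      rw [wp_iter]
      simp only [wp_bind, wp_pop, ha, List.head?_cons, List.tail_cons]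
      cases x
      · simp only [wp_bind, wp_push, wp_ret, Sum.elim_inr, Function.update_self,
          Function.update_idem]
        have := h 3 (by simp) (true :: l) (s b) (by simp [incr]) (by simp)
        simp only [incr] at this
        convert this using 1
        ext1 k
        simp only [Function.update_apply]
        split_ifs <;> simp_all
      · simp only [wp_bind, wp_push, wp_ret, Sum.elim_inl]
        refine ih _ _ (by simp [hab]) ?_
        intro t ht r u h1 h2
        have := h (1 + (1 + 1) + t) (by simp; omega) r u
          (by rw [h1]; simp [incr, hab.symm]) (by simp [hab.symm] at h2; simp; omega)
        simp only [incr] at this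
        convert this using 1
        ext1 k
        simp only [Function.update_apply]
        split_ifs <;> simp_all
  rw [inc, wp_bind]
  refine loop _ _ _ rfl fun t ht r u h1 h2 => ?_
  rw [wp_bind]
  refine wp_move hab.symm fun t' ht' => ?_
  rw [wp_ret]
  simp only [Function.update_self, hb, List.length_nil] at ht' h1 h2
  have := h (t + (t' + 1)) (by omega)
  convert this using 1
  ext1 k
  simp only [Function.update_apply]
  split_ifs <;> simp_all

theorem wp_readAdvice {a b c : K} (hab : a ≠ b) (hac : a ≠ c) (hbc : b ≠ c) {s : Store K}
    (ha : s a = []) (hb : s b = []) {P : Unit → Store K → ℕ → Prop}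
    (h : ∀ t ≤ 10 * (w.length + 2) ^ 2, P () (update s c (w.reverse ++ s c)) t) :
    wp w (readAdvice a b c) s P := by
  -- The stack `a` is the index of the next bit and `l` is the unread rest. The bound on `(s
  -- a).length` is crude (the counter gains at most one digit per bit read), but it suffices for a
  -- quadratic running time. An out-of-range answer signals the end.
  have loop : ∀ (l : List Bool) (s : Store K) (P : Unit → Store K → ℕ → Prop),
      s b = [] → val (s a) + l.length = w.length → w.drop (val (s a)) = l →
      (s a).length + l.length ≤ w.length →
      (∀ t ≤ (6 * w.length + 9) * l.length + (2 * w.length + 4),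
        P () (update (update s a []) c (l.reverse ++ s c)) t) →
      wp w (readAdvice a b c) s P := by
    intro l
    induction l with
    | nil =>
      intro s P hb h1 h2 h3 h
      rw [readAdvice, wp_iter, wp_bind, wp_query]
      have h4 : w[val (s a)]? = none := by
        rw [List.getElem?_eq_none]
        simpa using h1.ge
      rw [← val, h4]
      simp only
      rw [wp_bind]
      refine wp_clear fun t ht => ?_
      simp only [wp_ret, Sum.elim_inr]
      have := h (1 + (t + 1)) (by simp at h3 ⊢; omega)
      convert this using 1
      ext1 k
      simp only [Function.update_apply]
      split_ifs <;> simp_all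
    | cons x l ih =>
      intro s P hb h1 h2 h3 h
      rw [readAdvice, wp_iter, wp_bind, wp_query]
      have h4 : w[val (s a)]? = some x := by
        have : (w.drop (val (s a)))[0]? = some x := by rw [h2]; rfl
        simpa using this
      rw [← val, h4]
      simp only
      rw [wp_bind, wp_push, wp_bind]
      refine wp_inc hab (by simp [hbc, hb]) fun t ht => ?_
      simp only [wp_ret, Sum.elim_inl, Function.update_of_ne hac] at *
      have h5 := length_incr_true_le (s a)
      refine ih _ _ (by simp [hbc, hab.symm, hb]) ?_ ?_ ?_ fun t' ht' => ?_
      · simp only [Function.update_self, val_incr_true]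
        simp at h1
        omega
      · simp only [Function.update_self, val_incr_true]
        rw [← List.drop_drop, h2]
        rfl
      · simp only [Function.update_self]
        simp at h3
        omega
      · have := h (1 + (1 + (t + 1)) + t') (by
          simp only [List.length_cons] at h3 ⊢
          nlinarith)
        convert this using 1
        ext1 k
        simp only [Function.update_apply]
        split_ifs <;> simp_all
  refine loop w s P hb (by simp [ha]) (by simp [ha]) (by simp [ha]) fun t ht => ?_
  have := h t (by nlinarith)
  convert this using 1
  ext1 k
  simp only [Function.update_apply]
  split_ifs <;> simp_all

end Frag
end Advice

/-! ### Coin tosses and advice strings sampled on the fly. -/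

namespace Advice

/-- Computations with fair coin tosses. -/
inductive Rnd (α : Type) : Type
  /-- Return a value. -/
  | ret (a : α) : Rnd α
  /-- Toss a coin. -/
  | flip (k : Bool → Rnd α) : Rnd α

namespace Rnd

variable {α β : Type}

/-- Sequential composition. -/
def bind : Rnd α → (α → Rnd β) → Rnd β
  | ret a, k => k a
  | flip f, k => flip fun b => (f b).bind k

/-- Running with given outcomes of the coin tosses; the result comes with the unused outcomes. -/
def run : Rnd α → List Bool → α × List Bool
  | ret a, r => (a, r)
  -- A missing outcome counts as `false`. A machine popping the empty stack of random bits does the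
  -- same, so the two agree on every list.
  | flip k, r => (k (r.head? == some true)).run r.tail

/-- The expectation of a function of the result. -/
noncomputable def expect : Rnd α → (α → ℝ) → ℝ
  | ret a, F => F a
  | flip k, F => ((k false).expect F + (k true).expect F) / 2

/-- There are at most `n` coin tosses. -/
def Bounded : Rnd α → ℕ → Prop
  | ret _, _ => True
  | flip k, n => 1 ≤ n ∧ ∀ b, (k b).Bounded (n - 1)

@[simp]
theorem run_ret (a : α) (r : List Bool) : (ret a).run r = (a, r) := rfl

@[simp]
theorem run_bind (t : Rnd α) (k : α → Rnd β) (r : List Bool) :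
    (t.bind k).run r = (k (t.run r).1).run (t.run r).2 := by
  induction t generalizing r with
  | ret a => rfl
  | flip f ih => exact ih _ _

theorem expect_bind (t : Rnd α) (k : α → Rnd β) (F : β → ℝ) :
    (t.bind k).expect F = t.expect fun a => (k a).expect F := by
  induction t with
  | ret a => rfl
  | flip f ih => simp only [bind, expect, ih]

theorem expect_mono (t : Rnd α) {F G : α → ℝ} (h : ∀ a, F a ≤ G a) : t.expect F ≤ t.expect G := by
  induction t with
  | ret a => exact h a
  | flip f ih =>
    simp only [expect]
    linarith [ih false, ih true]

theorem Bounded.mono {t : Rnd α} {m n : ℕ} (h : t.Bounded m) (hmn : m ≤ n) : t.Bounded n := by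
  induction t generalizing m n with
  | ret a => trivial
  | flip f ih => exact ⟨h.1.trans hmn, fun b => ih b (h.2 b) (by omega)⟩

theorem Bounded.bind {t : Rnd α} {k : α → Rnd β} {m n : ℕ} (h : t.Bounded m)
    (hk : ∀ a, (k a).Bounded n) : (t.bind k).Bounded (m + n) := by
  induction t generalizing m with
  | ret a => exact (hk a).mono (by omega)
  | flip f ih =>
    refine ⟨h.1.trans (by omega), fun b => (ih b (h.2 b)).mono ?_⟩
    have := h.1
    omega

/-- With at least as many random bits as tosses, each leaf of the decision tree is reached by the
right share of bit strings; unused bits only multiply the counts. -/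
theorem sum_run {t : Rnd α} {q : ℕ} (h : t.Bounded q) (F : α → ℝ) :
    ∑ r : Fin q → Bool, F (t.run (List.ofFn r)).1 = 2 ^ q * t.expect F := by
  induction q generalizing t with
  | zero =>
    cases t with
    | ret a => simp [expect]
    | flip f => exact absurd h.1 (by omega)
  | succ q ih =>
    cases t with
    | ret a => simp [expect]
    | flip f =>
      rw [← (Fin.consEquiv fun _ : Fin (q + 1) => Bool).sum_comp, Fintype.sum_prod_type]
      simp only [Fin.consEquiv, Equiv.coe_fn_mk, List.ofFn_succ, Fin.cons_zero, Fin.cons_succ, run,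
        List.head?_cons, List.tail_cons, Fintype.sum_bool]
      have h1 := ih (h.2 true)
      have h2 := ih (h.2 false)
      simp only [beq_self_eq_true, expect]
      have h3 : (some false == some true) = false := rfl
      rw [h3, h1, h2]
      ring

end Rnd

/-- A partial assignment to the bits with indices below `2 ^ L`. -/
abbrev Dict (L : ℕ) := List (Fin (2 ^ L) × Bool)

/-- An assignment is consistent with a partial assignment. -/
def Consistent {L : ℕ} (d : Dict L) (w : Fin (2 ^ L) → Bool) : Prop := ∀ p ∈ d, w p.1 = p.2

instance {L : ℕ} (d : Dict L) : DecidablePred (Consistent d) := fun w =>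
  inferInstanceAs (Decidable (∀ p ∈ d, w p.1 = p.2))

/-- The average over the assignments that are consistent with a partial one. -/
noncomputable def avg {L : ℕ} (d : Dict L) (g : (Fin (2 ^ L) → Bool) → ℝ) : ℝ :=
  (∑ w with Consistent d w, g w) / (Finset.univ.filter (Consistent d)).card

section avg

variable {L : ℕ} {d : Dict L}

theorem consistent_cons {i : Fin (2 ^ L)} {b : Bool} {w : Fin (2 ^ L) → Bool} :
    Consistent ((i, b) :: d) w ↔ Consistent d w ∧ w i = b := by
  simp [Consistent, and_comm]

theorem avg_congr {g g' : (Fin (2 ^ L) → Bool) → ℝ} (h : ∀ w, Consistent d w → g w = g' w) :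
    avg d g = avg d g' := by
  unfold avg
  rw [Finset.sum_congr rfl]
  simpa using h

/-- Only an inequality: a contradictory `d` has no consistent assignment, and its average is `0 / 0
= 0`. -/
theorem avg_const_le (d : Dict L) {c : ℝ} (hc : 0 ≤ c) : avg d (fun _ => c) ≤ c := by
  unfold avg
  rw [Finset.sum_const, nsmul_eq_mul]
  exact div_le_of_le_mul₀ (by positivity) hc (by rw [mul_comm])

/-- Flipping the bit `i`, on which `d` says nothing, is a bijection. -/
theorem card_consistent_cons {i : Fin (2 ^ L)} (hi : ∀ p ∈ d, p.1 ≠ i) (b : Bool) :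
    (Finset.univ.filter (Consistent ((i, b) :: d))).card =
      (Finset.univ.filter (Consistent ((i, !b) :: d))).card := by
  have key : ∀ (w : Fin (2 ^ L) → Bool) (x : Bool), Consistent d (Function.update w i x) ↔
      Consistent d w := by
    intro w x
    refine forall₂_congr fun p hp => ?_
    rw [Function.update_of_ne (hi p hp)]
  refine Finset.card_bij' (fun w _ => Function.update w i !b) (fun w _ => Function.update w i b)
    ?_ ?_ ?_ ?_
  · intro w hw
    simp only [Finset.mem_filter, Finset.mem_univ, true_and, consistent_cons, key] at hw ⊢
    simp [hw.1]
  · intro w hw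
    simp only [Finset.mem_filter, Finset.mem_univ, true_and, consistent_cons, key] at hw ⊢
    simp [hw.1]
  · intro w hw
    simp only [Finset.mem_filter, Finset.mem_univ, true_and, consistent_cons] at hw
    simp [← hw.2]
  · intro w hw
    simp only [Finset.mem_filter, Finset.mem_univ, true_and, consistent_cons] at hw
    simp [← hw.2]

/-- The two values of a fresh bit split the consistent assignments into equal halves. This is why
tossing the bit at the moment of its first query is as good as tossing it in advance. -/
theorem avg_cons {i : Fin (2 ^ L)} (hi : ∀ p ∈ d, p.1 ≠ i) (g : (Fin (2 ^ L) → Bool) → ℝ) :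
    (avg ((i, false) :: d) g + avg ((i, true) :: d) g) / 2 = avg d g := by
  have split : ∀ f : (Fin (2 ^ L) → Bool) → ℝ, ∑ w with Consistent d w, f w =
      ∑ w with Consistent ((i, false) :: d) w, f w +
        ∑ w with Consistent ((i, true) :: d) w, f w := by
    intro f
    rw [← Finset.sum_filter_add_sum_filter_not _ (fun w => w i = false)]
    congr 1
    · refine Finset.sum_congr ?_ fun _ _ => rfl
      ext w
      simp [consistent_cons]
    · refine Finset.sum_congr ?_ fun _ _ => rfl
      ext w
      simp [consistent_cons]
  have h1 := split g
  have h2 := split fun _ => 1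
  have h3 := card_consistent_cons hi false
  simp only [Bool.not_false] at h3
  simp only [Finset.sum_const, nsmul_eq_mul, mul_one, ← h3] at h2
  unfold avg
  rw [h1, h2, ← h3]
  set c := ((Finset.univ.filter (Consistent ((i, false) :: d))).card : ℝ)
  rcases eq_or_ne c 0 with h | h
  · simp [h]
  · field_simp
    ring

/-- The computation, which reveals an assignment bit by bit starting from `d`, has the same result
as the evaluation of `h` at a random assignment. -/
def Realizes {α : Type} (t : Rnd (α × Dict L)) (d : Dict L) (h : (Fin (2 ^ L) → Bool) → α) :
    Prop :=
  ∀ F : α → (Fin (2 ^ L) → Bool) → ℝ,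
    t.expect (fun p => avg p.2 (F p.1)) = avg d fun w => F (h w) w

variable {α β : Type}

theorem realizes_ret {a : α} {h : (Fin (2 ^ L) → Bool) → α} (ha : ∀ w, Consistent d w → h w = a) :
    Realizes (.ret (a, d)) d h := fun F =>
  avg_congr fun w hw => by rw [ha w hw]

theorem realizes_flip {i : Fin (2 ^ L)} (hi : ∀ p ∈ d, p.1 ≠ i)
    {h : (Fin (2 ^ L) → Bool) → α} {k : Bool → Rnd (α × Dict L)}
    (hk : ∀ b, Realizes (k b) ((i, b) :: d) h) : Realizes (.flip k) d h := fun F => by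
  rw [Rnd.expect, hk false F, hk true F, avg_cons hi]

/-- Here the form of `Realizes` pays off. Its test functions depend on the assignment as well as on
the result, averaged over what the final dictionary leaves open, so a later stage may use the same
assignment, conditioned on the bits already revealed. -/
theorem Realizes.bind {t : Rnd (α × Dict L)} {h : (Fin (2 ^ L) → Bool) → α}
    (ht : Realizes t d h) {k : α × Dict L → Rnd (β × Dict L)}
    {h' : α → (Fin (2 ^ L) → Bool) → β} (hk : ∀ p, Realizes (k p) p.2 (h' p.1)) :
    Realizes (t.bind k) d fun w => h' (h w) w := fun F => by
  rw [Rnd.expect_bind]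
  simp only [hk _ F]
  exact ht fun a w => F (h' a w) w

/-- An inequality is enough, because success probabilities are only bounded from below; it avoids
having to show that dictionaries remain consistent. -/
theorem Realizes.avg_le_expect {t : Rnd (α × Dict L)} {h : (Fin (2 ^ L) → Bool) → α}
    (ht : Realizes t [] h) {F : α → ℝ} (hF : ∀ a, 0 ≤ F a) :
    avg [] (fun w => F (h w)) ≤ t.expect fun p => F p.1 := by
  rw [← ht fun a _ => F a]
  exact Rnd.expect_mono _ fun p => avg_const_le _ (hF _)

end avg

/-- Query of the bit with index `i` of an assignment that is chosen on the fly. -/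
def lazyQuery (L i : ℕ) (d : Dict L) : Rnd (Option Bool × Dict L) :=
  if h : i < 2 ^ L then
    match d.lookup ⟨i, h⟩ with
    | some b => .ret (some b, d)
    | none => .flip fun b => .ret (some b, (⟨i, h⟩, b) :: d)
  else .ret (none, d)

/-- The result of at most `t` steps with a given advice. -/
def clocked (M : Machine) (w : List Bool) : ℕ → M.Cfg → Option Bool
  | 0, _ => none
  | t + 1, c =>
    match M.code c.state with
    | .halt b => some b
    | _ => clocked M w t (M.step w c)

/-- The result of at most `t` steps with an advice that is chosen on the fly. -/
def lazySim (M : Machine) (L : ℕ) : ℕ → M.Cfg → Dict L → Rnd (Option Bool × Dict L)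
  | 0, _, d => .ret (none, d)
  | t + 1, c, d =>
    match M.code c.state with
    | .halt b => .ret (some b, d)
    | .push k b next => lazySim M L t ⟨next, Function.update c.stk k (b :: c.stk k)⟩ d
    | .pop k next =>
      lazySim M L t ⟨next (c.stk k).head?, Function.update c.stk k (c.stk k).tail⟩ d
    | .query k next =>
      (lazyQuery L (val (c.stk k)) d).bind fun p => lazySim M L t ⟨next p.1, c.stk⟩ p.2

section lazySim

variable {L : ℕ}

theorem lookup_eq_some {d : Dict L} {i : Fin (2 ^ L)} {b : Bool} (h : d.lookup i = some b) :
    (i, b) ∈ d := by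
  induction d with
  | nil => simp at h
  | cons p d ih =>
    rw [List.lookup_cons] at h
    by_cases hp : i = p.1
    · simp [hp] at h
      simp [hp, ← h]
    · have : (i == p.1) = false := by simpa using hp
      rw [this] at h
      exact List.mem_cons_of_mem _ (ih h)

theorem realizes_lazyQuery (i : ℕ) (d : Dict L) :
    Realizes (lazyQuery L i d) d fun w => (List.ofFn w)[i]? := by
  unfold lazyQuery
  split_ifs with hi
  · split
    · next b h =>
      refine realizes_ret fun w hw => ?_
      simp [hi, hw _ (lookup_eq_some h)]
    · next h =>
      refine realizes_flip (i := ⟨i, hi⟩) ?_ fun b => realizes_ret fun w hw => ?_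
      · intro p hp h'
        have := List.lookup_eq_none_iff.1 h p hp
        simp [h'] at this
      · simp [hi, (consistent_cons.1 hw).2]
  · exact realizes_ret fun w hw => by simpa using hi

theorem bounded_lazyQuery (i : ℕ) (d : Dict L) : (lazyQuery L i d).Bounded 1 := by
  unfold lazyQuery
  split_ifs
  · split
    · trivial
    · exact ⟨le_rfl, fun _ => trivial⟩
  · trivial

variable (M : Machine)

theorem realizes_lazySim (t : ℕ) (c : M.Cfg) (d : Dict L) :
    Realizes (lazySim M L t c d) d fun w => clocked M (List.ofFn w) t c := by
  induction t generalizing c d with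
  | zero => exact realizes_ret fun _ _ => rfl
  | succ t ih =>
    unfold lazySim clocked
    split
    · next h => exact realizes_ret fun _ _ => by rw [h]
    · next h =>
      simp only [h, Machine.step]
      exact ih _ _
    · next h =>
      simp only [h, Machine.step]
      exact ih _ _
    · next k next h =>
      simp only [h, Machine.step]
      exact (realizes_lazyQuery (val (c.stk k)) d).bind
        (h' := fun o w => clocked M (List.ofFn w) t ⟨next o, c.stk⟩) fun p => ih _ _

/-- A step makes at most one query, and a query at most one toss. -/
theorem bounded_lazySim (t : ℕ) (c : M.Cfg) (d : Dict L) : (lazySim M L t c d).Bounded t := by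
  induction t generalizing c d with
  | zero => trivial
  | succ t ih =>
    unfold lazySim
    split
    · trivial
    · exact (ih _ _).mono (by omega)
    · exact (ih _ _).mono (by omega)
    · rw [add_comm]
      exact (bounded_lazyQuery _ _).bind fun _ => ih _ _

/-- Noticing the halting instruction uses up one unit of the clock, hence the strict inequality. -/
theorem clocked_of_halt {w : List Bool} {t T : ℕ} (hT : t < T) {c : M.Cfg} {b : Bool}
    (h : M.code ((M.step w)^[t] c).state = .halt b) : clocked M w T c = some b := by
  induction T generalizing t c with
  | zero => omega
  | succ T ih =>
    unfold clocked
    split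
    · next b' h' =>
      rw [M.iterate_step_of_halt w h', h'] at h
      simpa using h
    · next h' =>
      rcases t with _ | t
      · exact absurd h (h' b)
      · exact ih (by omega) h

/-- One attempt: simulation on the inputs in a list, and on `x` if all results are as stated in the
list. -/
def attempt (L t : ℕ) (x : List Bool) : List (List Bool × Bool) → Dict L →
    Rnd (Option Bool × Dict L)
  | [], d => (lazySim M L t (M.init x []) d).bind fun p => .ret (some (p.1 == some true), p.2)
  | (y, b) :: l, d => (lazySim M L t (M.init y []) d).bind fun p =>
    if p.1 = some b then attempt L t x l p.2 else .ret (none, p.2)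

/-- At most `T` attempts. -/
def trials (L t : ℕ) (x : List Bool) (l : List (List Bool × Bool)) : ℕ → Rnd Bool
  | 0 => .ret false
  | T + 1 => (attempt M L t x l []).bind fun p =>
    match p.1 with
    | some b => .ret b
    | none => trials L t x l T

/-- One dictionary passes through all the simulations, so the tests and the final run on `x` see the
same random advice. -/
theorem realizes_attempt (t : ℕ) (x : List Bool) (l : List (List Bool × Bool)) (d : Dict L) :
    Realizes (attempt M L t x l d) d fun w =>
      if ∀ p ∈ l, clocked M (List.ofFn w) t (M.init p.1 []) = some p.2 then
        some (clocked M (List.ofFn w) t (M.init x []) == some true) else none := by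
  induction l generalizing d with
  | nil =>
    simp only [attempt, List.not_mem_nil, false_implies, implies_true, if_true]
    exact (realizes_lazySim M t _ d).bind (h' := fun o _ => some (o == some true))
      fun p => realizes_ret fun _ _ => rfl
  | cons p l ih =>
    obtain ⟨y, b⟩ := p
    have := (realizes_lazySim M t (M.init y []) d).bind
      (k := fun p => if p.1 = some b then attempt M L t x l p.2 else .ret (none, p.2))
      (h' := fun o w => if o = some b then
        (if ∀ p ∈ l, clocked M (List.ofFn w) t (M.init p.1 []) = some p.2 then
        some (clocked M (List.ofFn w) t (M.init x []) == some true) else none) else none) (by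
        intro p
        split_ifs
        · exact ih p.2
        · exact realizes_ret fun _ _ => rfl)
    simp only [attempt, List.forall_mem_cons, ite_and]
    exact this

theorem bounded_attempt (t : ℕ) (x : List Bool) (l : List (List Bool × Bool)) (d : Dict L) :
    (attempt M L t x l d).Bounded ((l.length + 1) * t) := by
  induction l generalizing d with
  | nil =>
    simp only [attempt, List.length_nil, zero_add, one_mul]
    exact ((bounded_lazySim M t _ _).bind (n := 0) fun _ => trivial)
  | cons p l ih =>
    simp only [attempt]
    refine ((bounded_lazySim M t _ _).bind (n := (l.length + 1) * t) fun _ => ?_).mono ?_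
    · split_ifs
      · exact ih _
      · trivial
    · simp only [List.length_cons]
      linarith

theorem bounded_trials (t : ℕ) (x : List Bool) (l : List (List Bool × Bool)) (T : ℕ) :
    (trials M L t x l T).Bounded (T * ((l.length + 1) * t)) := by
  induction T with
  | zero => trivial
  | succ T ih =>
    rw [trials, add_mul, one_mul, add_comm]
    refine (bounded_attempt M t x l []).bind fun p => ?_
    split
    · trivial
    · exact ih

end lazySim

end Advice

/-! ### Greedy choice of the tests and success probability. -/

namespace Advice

/-- Greedy choice: an `x` violating the first conclusion is added to the list, and then fewer than
3/4 of the survivors remain, so the second conclusion is preserved. The number of survivors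
decreases strictly but stays positive because of `w₀`, so the process ends. -/
theorem exists_list_of_forall {Ω X : Type} [Fintype Ω] (C : X → Ω → Prop) {w₀ : Ω}
    (h₀ : ∀ x, C x w₀) :
    ∃ l : List X,
      (∀ x, 3 / 4 * (Nat.card {w // ∀ y ∈ l, C y w} : ℝ) ≤
        Nat.card {w // (∀ y ∈ l, C y w) ∧ C x w}) ∧
      (Nat.card {w // ∀ y ∈ l, C y w} : ℝ) * (4 / 3) ^ l.length ≤ Nat.card Ω := by
  classical
  suffices H : ∀ (m : ℕ) (l : List X), Nat.card {w // ∀ y ∈ l, C y w} ≤ m →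
      (Nat.card {w // ∀ y ∈ l, C y w} : ℝ) * (4 / 3) ^ l.length ≤ Nat.card Ω →
      ∃ l : List X,
      (∀ x, 3 / 4 * (Nat.card {w // ∀ y ∈ l, C y w} : ℝ) ≤
        Nat.card {w // (∀ y ∈ l, C y w) ∧ C x w}) ∧
      (Nat.card {w // ∀ y ∈ l, C y w} : ℝ) * (4 / 3) ^ l.length ≤ Nat.card Ω by
    refine H _ [] le_rfl ?_
    simp
  have hpos : ∀ l : List X, 0 < Nat.card {w // ∀ y ∈ l, C y w} := fun l =>
    Nat.card_pos_iff.2 ⟨⟨w₀, fun y _ => h₀ y⟩, inferInstance⟩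
  intro m
  induction m with
  | zero =>
    intro l hl
    exact absurd hl (hpos l).not_ge
  | succ m ih =>
    intro l hm hl
    by_cases h : ∀ x, 3 / 4 * (Nat.card {w // ∀ y ∈ l, C y w} : ℝ) ≤
        Nat.card {w // (∀ y ∈ l, C y w) ∧ C x w}
    · exact ⟨l, h, hl⟩
    · push Not at h
      obtain ⟨x, hx⟩ := h
      have e : Nat.card {w // ∀ y ∈ x :: l, C y w} =
          Nat.card {w // (∀ y ∈ l, C y w) ∧ C x w} :=
        Nat.card_congr (Equiv.subtypeEquivRight fun w => by simp [and_comm])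
      have hp : (0 : ℝ) < Nat.card {w // ∀ y ∈ l, C y w} := by exact_mod_cast hpos l
      refine ih (x :: l) ?_ ?_
      · rw [e]
        have : (Nat.card {w // (∀ y ∈ l, C y w) ∧ C x w} : ℝ) <
            Nat.card {w // ∀ y ∈ l, C y w} := by linarith
        have : Nat.card {w // (∀ y ∈ l, C y w) ∧ C x w} < Nat.card {w // ∀ y ∈ l, C y w} := by
          exact_mod_cast this
        omega
      · rw [e, List.length_cons, pow_succ]
        refine le_trans ?_ hl
        have h4 : (0 : ℝ) < (4 / 3) ^ l.length := by positivity
        nlinarith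

section trials

variable (M : Machine) {L : ℕ}

/-- Here `m` is the probability that a draw passes all tests. A draw returns `b` with probability at
least `3/4 * m` and leads to a new one with probability `1 - m`; the bound solves the recursion `p'
= 3/4 * m + (1 - m) * p`. -/
theorem le_expect_trials (t : ℕ) (x : List Bool) (l : List (List Bool × Bool)) (b : Bool) (m : ℝ)
    (hm : m * 2 ^ 2 ^ L = Nat.card {w : Fin (2 ^ L) → Bool // ∀ p ∈ l,
      clocked M (List.ofFn w) t (M.init p.1 []) = some p.2})
    (hx : 3 / 4 * (m * 2 ^ 2 ^ L) ≤ Nat.card {w : Fin (2 ^ L) → Bool // (∀ p ∈ l,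
      clocked M (List.ofFn w) t (M.init p.1 []) = some p.2) ∧
      clocked M (List.ofFn w) t (M.init x []) = some b}) (T : ℕ) :
    3 / 4 * (1 - (1 - m) ^ T) ≤
      (trials M L t x l T).expect fun a => if a = b then 1 else 0 := by
  induction T with
  | zero =>
    simp only [trials, Rnd.expect, pow_zero]
    split_ifs <;> norm_num
  | succ T ih =>
    set p := (trials M L t x l T).expect fun a => if a = b then (1 : ℝ) else 0 with hp
    set p' : ℝ := 3 / 4 * (1 - (1 - m) ^ T) with hp'
    have hN : (0 : ℝ) < 2 ^ 2 ^ L := by positivity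
    have hm0 : 0 ≤ m := by
      have : 0 ≤ m * 2 ^ 2 ^ L := by rw [hm]; positivity
      exact nonneg_of_mul_nonneg_left this hN
    have hm1 : m ≤ 1 := by
      have h1 : m * 2 ^ 2 ^ L ≤ 1 * 2 ^ 2 ^ L := by
        rw [hm]
        have := Nat.card_le_card_of_injective (Subtype.val : {w : Fin (2 ^ L) → Bool // ∀ p ∈ l,
          clocked M (List.ofFn w) t (M.init p.1 []) = some p.2} → _) Subtype.val_injective
        have h2 : Nat.card (Fin (2 ^ L) → Bool) = 2 ^ 2 ^ L := by simp
        rw [h2] at this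
        rw [one_mul]
        exact_mod_cast this
      exact le_of_mul_le_mul_right h1 hN
    have hp'0 : 0 ≤ p' := by
      have : (1 - m) ^ T ≤ 1 := pow_le_one₀ (by linarith) (by linarith)
      rw [hp']
      linarith
    -- A failed attempt is credited with the lower bound `p'` for the remaining trials. They start
    -- from the empty dictionary, so the bound does not depend on the bits revealed.
    have h1 := (realizes_attempt (L := L) M t x l []).avg_le_expect
      (F := fun o => match o with
        | some a => if a = b then 1 else 0
        | none => p') (by
        intro a
        rcases a with _ | a
        · exact hp'0
        · dsimp only
          split_ifs <;> norm_num)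
    have h2 : (trials M L t x l (T + 1)).expect (fun a => if a = b then (1 : ℝ) else 0) ≥
        (attempt M L t x l []).expect (fun p => match p.1 with
        | some a => if a = b then 1 else 0
        | none => p') := by
      rw [trials, Rnd.expect_bind]
      refine Rnd.expect_mono _ fun a => ?_
      rcases a with ⟨_ | a, d⟩
      · exact ih
      · exact le_rfl
    refine le_trans ?_ (h1.trans h2)
    rw [avg]
    have h3 : (Finset.univ.filter (Consistent ([] : Dict L))) = Finset.univ := by
      ext w
      simp [Consistent]
    rw [h3, Finset.card_univ, le_div_iff₀ (by simp)]
    have h4 : ((Fintype.card (Fin (2 ^ L) → Bool) : ℕ) : ℝ) = 2 ^ 2 ^ L := by simp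
    rw [h4]
    have h5 : ∀ w : Fin (2 ^ L) → Bool,
        (if (∀ p ∈ l, clocked M (List.ofFn w) t (M.init p.1 []) = some p.2) ∧
          clocked M (List.ofFn w) t (M.init x []) = some b then (1 : ℝ) else 0) +
        (if ∀ p ∈ l, clocked M (List.ofFn w) t (M.init p.1 []) = some p.2 then 0 else p') ≤
        (match (if ∀ p ∈ l, clocked M (List.ofFn w) t (M.init p.1 []) = some p.2 then
          some (clocked M (List.ofFn w) t (M.init x []) == some true) else none) with
        | some a => if a = b then 1 else 0
        | none => p') := by
      intro w
      by_cases h : ∀ p ∈ l, clocked M (List.ofFn w) t (M.init p.1 []) = some p.2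
      · rw [if_pos h, if_pos h]
        by_cases h' : clocked M (List.ofFn w) t (M.init x []) = some b
        · rw [if_pos ⟨h, h'⟩, h']
          cases b <;> simp
        · rw [if_neg fun hh => h' hh.2]
          simp only
          split_ifs <;> norm_num
      · rw [if_neg h, if_neg h, if_neg fun h' => h h'.1]
        simp
    refine le_trans ?_ (Finset.sum_le_sum fun w _ => h5 w)
    rw [Finset.sum_add_distrib]
    have h6 : ∑ w : Fin (2 ^ L) → Bool, (if (∀ p ∈ l,
          clocked M (List.ofFn w) t (M.init p.1 []) = some p.2) ∧
          clocked M (List.ofFn w) t (M.init x []) = some b then (1 : ℝ) else 0) =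
        Nat.card {w : Fin (2 ^ L) → Bool // (∀ p ∈ l,
          clocked M (List.ofFn w) t (M.init p.1 []) = some p.2) ∧
          clocked M (List.ofFn w) t (M.init x []) = some b} := by
      rw [Nat.card_eq_fintype_card, Fintype.card_subtype, Finset.sum_boole]
    have h7 : ∑ w : Fin (2 ^ L) → Bool, (if ∀ p ∈ l,
        clocked M (List.ofFn w) t (M.init p.1 []) = some p.2 then 0 else p') =
        p' * (2 ^ 2 ^ L - m * 2 ^ 2 ^ L) := by
      have h8 : ∀ w : Fin (2 ^ L) → Bool, (if ∀ p ∈ l,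
          clocked M (List.ofFn w) t (M.init p.1 []) = some p.2 then 0 else p') =
          p' * (1 - if ∀ p ∈ l, clocked M (List.ofFn w) t (M.init p.1 []) = some p.2
            then 1 else 0) := by
        intro w
        split_ifs <;> ring
      rw [Finset.sum_congr rfl fun w _ => h8 w, ← Finset.mul_sum, Finset.sum_sub_distrib,
        Finset.sum_boole, hm, Nat.card_eq_fintype_card, Fintype.card_subtype]
      simp
    rw [h6, h7]
    have h9 : 3 / 4 * (1 - (1 - m) ^ (T + 1)) * 2 ^ 2 ^ L =
        3 / 4 * (m * 2 ^ 2 ^ L) + p' * (2 ^ 2 ^ L - m * 2 ^ 2 ^ L) := by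
      rw [hp', pow_succ]
      ring
    linarith

/-- Bernoulli's inequality gives `(1 + m) ^ T ≥ 1 + 8 = 9`, so `(1 - m) ^ T ≤ 1/9` because the
product of the two powers is at most 1; and `3/4 * 8/9 = 2/3`. -/
theorem two_thirds_le {m : ℝ} {X T : ℕ} (hm0 : 0 ≤ m) (hm1 : m ≤ 1) (hX : 1 ≤ m * X)
    (hT : 8 * X ≤ T) : (2 / 3 : ℝ) ≤ 3 / 4 * (1 - (1 - m) ^ T) := by
  have h1 : (1 : ℝ) + T * m ≤ (1 + m) ^ T := one_add_mul_le_pow (by linarith) T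
  have h2 : (1 - m) ^ T * (1 + m) ^ T ≤ 1 := by
    rw [← mul_pow]
    exact pow_le_one₀ (by nlinarith) (by nlinarith)
  have h3 : (9 : ℝ) ≤ (1 + m) ^ T := by
    have : (8 * X : ℝ) ≤ T := by exact_mod_cast hT
    nlinarith
  have h4 : 0 ≤ (1 - m) ^ T := pow_nonneg (by linarith) T
  nlinarith

theorem two_thirds_le_card_trials (t : ℕ) (x : List Bool) (l : List (List Bool × Bool)) (b : Bool)
    {X T q : ℕ}
    (hl : 2 ^ 2 ^ L ≤ X * Nat.card {w : Fin (2 ^ L) → Bool // ∀ p ∈ l,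
      clocked M (List.ofFn w) t (M.init p.1 []) = some p.2})
    (hx : 3 / 4 * (Nat.card {w : Fin (2 ^ L) → Bool // ∀ p ∈ l,
      clocked M (List.ofFn w) t (M.init p.1 []) = some p.2} : ℝ) ≤
      Nat.card {w : Fin (2 ^ L) → Bool // (∀ p ∈ l,
      clocked M (List.ofFn w) t (M.init p.1 []) = some p.2) ∧
      clocked M (List.ofFn w) t (M.init x []) = some b})
    (hT : 8 * X ≤ T) (hq : T * ((l.length + 1) * t) ≤ q) :
    (2 / 3 : ℝ) ≤ (Nat.card {r : Fin q → Bool //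
      ((trials M L t x l T).run (List.ofFn r)).1 = b} : ℝ) / 2 ^ q := by
  set c := Nat.card {w : Fin (2 ^ L) → Bool // ∀ p ∈ l,
      clocked M (List.ofFn w) t (M.init p.1 []) = some p.2} with hc
  have hN : (0 : ℝ) < 2 ^ 2 ^ L := by positivity
  have hm : (c : ℝ) / 2 ^ 2 ^ L * 2 ^ 2 ^ L = c := by field_simp
  have hcN : (c : ℝ) ≤ 2 ^ 2 ^ L := by
    have := Nat.card_le_card_of_injective (Subtype.val : {w : Fin (2 ^ L) → Bool // ∀ p ∈ l,
      clocked M (List.ofFn w) t (M.init p.1 []) = some p.2} → _) Subtype.val_injective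
    have h2 : Nat.card (Fin (2 ^ L) → Bool) = 2 ^ 2 ^ L := by simp
    rw [h2] at this
    exact_mod_cast this
  have h1 := le_expect_trials M t x l b ((c : ℝ) / 2 ^ 2 ^ L) hm (by rw [hm]; exact hx) T
  have h2 := Rnd.sum_run ((bounded_trials (L := L) M t x l T).mono hq)
    fun a => if a = b then (1 : ℝ) else 0
  rw [Nat.card_eq_fintype_card, Fintype.card_subtype, ← Finset.sum_boole, h2,
    mul_div_cancel_left₀ _ (by positivity)]
  refine le_trans (two_thirds_le (X := X) (by positivity) ?_ ?_ hT) h1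
  · exact div_le_one_of_le₀ hcN hN.le
  · rw [div_mul_eq_mul_div, le_div_iff₀ hN, one_mul, mul_comm]
    exact_mod_cast hl

end trials

end Advice

/-! ### Stack layout, and lazy sampling as a stack program. -/

namespace Advice

open Function (update)

/-- Names of stacks. -/
inductive V : Type
  | inp | rnd | out | tmp | tmp2 | cnt | size | width | time | clk | dict | dict2 | key | key2 | arg
  | adv | ctr | tries
  deriving DecidableEq

instance : Fintype V where
  elems := {.inp, .rnd, .out, .tmp, .tmp2, .cnt, .size, .width, .time, .clk, .dict, .dict2, .key,
    .key2, .arg, .adv, .ctr, .tries}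
  complete v := by cases v <;> decide

instance {κ : Type} : Inhabited (V ⊕ κ) := ⟨.inl .inp⟩

/-- The contents of the named stacks, and of further stacks indexed by `κ`. -/
structure Mem (κ : Type) : Type where
  (inp rnd out tmp tmp2 cnt size width time clk dict dict2 key key2 arg adv ctr tries : List Bool)
  aux : κ → List Bool

namespace Mem

variable {κ : Type}

/-- The contents of a stack. -/
def get (s : Mem κ) : Store (V ⊕ κ)
  | .inl .inp => s.inp
  | .inl .rnd => s.rnd
  | .inl .out => s.out
  | .inl .tmp => s.tmp
  | .inl .tmp2 => s.tmp2
  | .inl .cnt => s.cnt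
  | .inl .size => s.size
  | .inl .width => s.width
  | .inl .time => s.time
  | .inl .clk => s.clk
  | .inl .dict => s.dict
  | .inl .dict2 => s.dict2
  | .inl .key => s.key
  | .inl .key2 => s.key2
  | .inl .arg => s.arg
  | .inl .adv => s.adv
  | .inl .ctr => s.ctr
  | .inl .tries => s.tries
  | .inr k => s.aux k

/-- Replaces the contents of a named stack. -/
def set (s : Mem κ) : V → List Bool → Mem κ
  | .inp, x => { s with inp := x }
  | .rnd, x => { s with rnd := x }
  | .out, x => { s with out := x }
  | .tmp, x => { s with tmp := x }
  | .tmp2, x => { s with tmp2 := x }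
  | .cnt, x => { s with cnt := x }
  | .size, x => { s with size := x }
  | .width, x => { s with width := x }
  | .time, x => { s with time := x }
  | .clk, x => { s with clk := x }
  | .dict, x => { s with dict := x }
  | .dict2, x => { s with dict2 := x }
  | .key, x => { s with key := x }
  | .key2, x => { s with key2 := x }
  | .arg, x => { s with arg := x }
  | .adv, x => { s with adv := x }
  | .ctr, x => { s with ctr := x }
  | .tries, x => { s with tries := x }

variable [DecidableEq κ]

/-- Turns updates of stacks into updates of record fields. Symbolic execution of a fragment then
reduces to computation, without case distinctions on stack names. -/
theorem update_get (s : Mem κ) (v : V) (x : List Bool) :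
    update s.get (.inl v) x = (s.set v x).get := by
  ext1 k
  rcases k with k | k
  · by_cases h : k = v
    · subst h
      rw [Function.update_self]
      cases k <;> rfl
    · rw [Function.update_of_ne (by simpa using h)]
      cases v <;> cases k <;> first | rfl | exact absurd rfl h
  · rw [Function.update_of_ne (by simp)]
    cases v <;> rfl

theorem update_get_aux (s : Mem κ) (k : κ) (x : List Bool) :
    update s.get (.inr k) x = ({ s with aux := update s.aux k x }).get := by
  ext1 j
  rcases j with j | j
  · rw [Function.update_of_ne (by simp)]
    cases j <;> rfl
  · by_cases h : j = k
    · subst h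
      simp [get]
    · rw [Function.update_of_ne (by simpa using h)]
      simp [get, h]

end Mem

/-- The first `L` binary digits of a number, least significant digit first. -/
def bitsOf : ℕ → ℕ → List Bool
  | 0, _ => []
  | L + 1, i => (i % 2 == 1) :: bitsOf L (i / 2)

@[simp]
theorem length_bitsOf (L i : ℕ) : (bitsOf L i).length = L := by
  induction L generalizing i with
  | zero => rfl
  | succ L ih => simp [bitsOf, ih]

theorem val_bitsOf {L i : ℕ} (h : i < 2 ^ L) : val (bitsOf L i) = i := by
  induction L generalizing i with
  | zero => simp at h; simp [bitsOf, h]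
  | succ L ih =>
    rw [bitsOf, val_cons, ih (by rw [pow_succ] at h; omega)]
    rcases Nat.mod_two_eq_zero_or_one i with h' | h' <;> · simp [h']; omega

theorem bitsOf_injective {L i j : ℕ} (hi : i < 2 ^ L) (hj : j < 2 ^ L)
    (h : bitsOf L i = bitsOf L j) : i = j := by
  rw [← val_bitsOf hi, h, val_bitsOf hj]

theorem head?_beq_some_true (c : List Bool) : (c.head? == some true) = (val c % 2 == 1) := by
  rcases c with _ | ⟨b, c⟩
  · rfl
  · cases b <;> simp

theorem val_tail (c : List Bool) : val c.tail = val c / 2 := by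
  rcases c with _ | ⟨b, c⟩
  · rfl
  · cases b <;> · simp; try omega

/-- An index on a query stack may carry leading zeros, so whether it is in range is read off from
the digits beyond the first `L`, not from its length. -/
theorem all_drop_eq (L : ℕ) (c : List Bool) :
    (c.drop L).all (fun b => !b) = decide (val c < 2 ^ L) := by
  induction L generalizing c with
  | zero =>
    induction c with
    | nil => rfl
    | cons b c ih =>
      simp only [List.drop_zero, pow_zero, Nat.lt_one_iff, List.all_cons, val_cons] at ih ⊢
      rw [ih]
      cases b <;> simp
  | succ L ih =>
    rcases c with _ | ⟨b, c⟩
    · simp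
    · rw [List.drop_succ_cons, ih, val_cons, pow_succ]
      have := Bool.toNat_le b
      congr 1
      apply propext
      omega

/-- The list of bits that stores a partial assignment. -/
def encDict {L : ℕ} (d : Dict L) : List Bool := d.flatMap fun p => p.2 :: bitsOf L p.1

theorem encDict_cons {L : ℕ} (i : Fin (2 ^ L)) (b : Bool) (d : Dict L) :
    encDict ((i, b) :: d) = b :: (bitsOf L i ++ encDict d) := rfl

theorem length_encDict {L : ℕ} (d : Dict L) : (encDict d).length = (L + 1) * d.length := by
  induction d with
  | nil => simp [encDict]
  | cons p d ih =>
    obtain ⟨i, b⟩ := p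
    rw [encDict_cons]
    simp [ih]
    ring

namespace Frag

variable {κ : Type}

/-- Takes the first `|cnt|` bits of the number on `tmp2` and puts them in reversed order
on `key2`. -/
def takeBits : Frag (V ⊕ κ) Unit :=
  iter (fun _ : Unit => (pop (.inl .cnt)).bind fun o => match o with
    | none => ret (.inr ())
    | some _ => (pop (.inl .tmp2)).bind fun o => (push (.inl .key2) (o == some true)).bind fun _ =>
      ret (.inl ())) ()

/-- Empties the stack `tmp2` and checks if all bits are zero. -/
def allZero : Bool → Frag (V ⊕ κ) Bool :=
  iter (fun flag : Bool => (pop (.inl .tmp2)).bind fun o => match o with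
    | none => ret (.inr flag)
    | some b => ret (.inl (flag && !b)))

/-- Puts the first `|width|` bits of the number on the stack `k` on `key` and checks if the remaining
bits are zero. -/
def readKey (k : V ⊕ κ) : Frag (V ⊕ κ) Bool :=
  (copy k (.inl .tmp) (.inl .tmp2)).bind fun _ =>
  (copy (.inl .width) (.inl .tmp) (.inl .cnt)).bind fun _ =>
  takeBits.bind fun _ => (move (.inl .key2) (.inl .key)).bind fun _ => allZero true

/-- Compares `key` with the top of `dict`, moving both to `key2` and `dict2`. -/
def compareKey : Bool → Frag (V ⊕ κ) Bool :=
  iter (fun flag : Bool => (pop (.inl .key)).bind fun o => match o with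
    | none => ret (.inr flag)
    | some a => (push (.inl .key2) a).bind fun _ => (pop (.inl .dict)).bind fun o =>
      (push (.inl .dict2) (o == some true)).bind fun _ => ret (.inl (flag && (o == some a))))

/-- Looks for `key` in `dict`; the part of `dict` that was searched is moved to `dict2`. -/
def scan : Frag (V ⊕ κ) (Option Bool) :=
  iter (fun _ : Unit => (pop (.inl .dict)).bind fun o => match o with
    | none => ret (.inr none)
    | some b => (push (.inl .dict2) b).bind fun _ => (compareKey true).bind fun f =>
      (move (.inl .key2) (.inl .key)).bind fun _ =>
        if f then ret (.inr (some b)) else ret (.inl ())) ()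

/-- Answers the query on the stack `k` from `dict`, which is extended by a random bit if
necessary. -/
def oracle (k : V ⊕ κ) : Frag (V ⊕ κ) (Option Bool) :=
  (readKey k).bind fun ok =>
    if ok then
      scan.bind fun o => (move (.inl .dict2) (.inl .dict)).bind fun _ => match o with
        | some b => (clear (.inl .key)).bind fun _ => ret (some b)
        | none => (pop (.inl .rnd)).bind fun r =>
          (copy (.inl .key) (.inl .tmp) (.inl .dict)).bind fun _ =>
          (push (.inl .dict) (r == some true)).bind fun _ =>
          (clear (.inl .key)).bind fun _ => ret (some (r == some true))
    else (clear (.inl .key)).bind fun _ => ret none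

variable [DecidableEq κ] {w : List Bool}

theorem wp_takeBits {L : ℕ} {s : Mem κ} (hs : s.cnt = List.replicate L false)
    {P : Unit → Store (V ⊕ κ) → ℕ → Prop}
    (h : ∀ t ≤ 4 * L + 2, P () ({ s with
      cnt := [], tmp2 := s.tmp2.drop L, key2 := (bitsOf L (val s.tmp2)).reverse ++ s.key2}).get t) :
    wp w takeBits s.get P := by
  induction L generalizing s P with
  | zero =>
    rw [takeBits, wp_iter]
    simp only [wp_bind, wp_pop, Mem.get, hs, List.replicate_zero, List.head?_nil, wp_ret,
      Mem.update_get, Mem.set, Sum.elim_inr, List.tail_nil]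
    exact h 2 (by simp)
  | succ L ih =>
    rw [takeBits, wp_iter]
    simp only [wp_bind, wp_pop, Mem.get, hs, List.replicate_succ, List.head?_cons, wp_ret,
      Mem.update_get, Mem.set, Sum.elim_inl, List.tail_cons, wp_push]
    refine ih rfl fun t ht => ?_
    have := h (1 + (1 + (1 + 1)) + t) (by omega)
    simpa [bitsOf, val_tail, head?_beq_some_true] using this

theorem wp_allZero {s : Mem κ} {f : Bool} {P : Bool → Store (V ⊕ κ) → ℕ → Prop}
    (h : ∀ t ≤ 2 * s.tmp2.length + 2,
      P (f && s.tmp2.all fun b => !b) ({ s with tmp2 := [] }).get t) :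
    wp w (allZero f) s.get P := by
  obtain ⟨l, hl⟩ : ∃ l, s.tmp2 = l := ⟨_, rfl⟩
  induction l generalizing s f P with
  | nil =>
    rw [allZero, wp_iter]
    simp only [wp_bind, wp_pop, Mem.get, hl, List.head?_nil, wp_ret,
      Mem.update_get, Mem.set, Sum.elim_inr, List.tail_nil]
    simpa [hl] using h 2 (by simp)
  | cons b l ih =>
    rw [allZero, wp_iter]
    simp only [wp_bind, wp_pop, Mem.get, hl, List.head?_cons, wp_ret,
      Mem.update_get, Mem.set, Sum.elim_inl, List.tail_cons]
    refine ih (fun t ht => ?_) rfl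
    have := h (1 + 1 + t) (by simp [hl]; simp at ht; omega)
    simpa [hl, Bool.and_assoc] using this

theorem wp_readKey {L : ℕ} {k : κ} {s : Mem κ} (hw : s.width = List.replicate L false)
    (h1 : s.tmp = []) (h2 : s.tmp2 = []) (h3 : s.cnt = []) (h4 : s.key = []) (h5 : s.key2 = [])
    {P : Bool → Store (V ⊕ κ) → ℕ → Prop}
    (h : ∀ t ≤ 9 * (s.aux k).length + 14 * L + 20, P (decide (val (s.aux k) < 2 ^ L))
      ({ s with key := bitsOf L (val (s.aux k)) }).get t) :
    wp w (readKey (.inr k)) s.get P := by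
  obtain ⟨⟩ := s
  dsimp only at *
  subst h1 h2 h3 h4 h5 hw
  simp only [readKey, wp_bind]
  refine wp_copy (by simp) (by simp) (by simp) rfl fun t1 ht1 => ?_
  simp only [Mem.get, Mem.update_get, Mem.set] at ht1 ⊢
  refine wp_copy (by simp) (by simp) (by simp) rfl fun t2 ht2 => ?_
  simp only [Mem.get, Mem.update_get, Mem.set, List.length_replicate] at ht2 ⊢
  refine wp_takeBits (L := L) (by simp) fun t3 ht3 => ?_
  refine wp_move (by simp) fun t4 ht4 => ?_
  simp only [Mem.get, Mem.update_get, Mem.set, List.append_nil, List.reverse_reverse,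
    List.length_reverse, length_bitsOf] at ht4 ⊢
  refine wp_allZero fun t5 ht5 => ?_
  simp only [Bool.true_and, all_drop_eq, List.length_drop] at ht5 ⊢
  exact h _ (by omega)

theorem wp_compareKey {a a' : List Bool} (ha : a.length = a'.length) {s : Mem κ} {r : List Bool}
    {f : Bool} (hk : s.key = a) (hd : s.dict = a' ++ r) {P : Bool → Store (V ⊕ κ) → ℕ → Prop}
    (h : ∀ t ≤ 5 * a.length + 2, P (f && decide (a = a')) ({ s with
      key := [], key2 := a.reverse ++ s.key2, dict := r, dict2 := a'.reverse ++ s.dict2 }).get t) :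
    wp w (compareKey f) s.get P := by
  induction a generalizing a' s f P with
  | nil =>
    obtain rfl : a' = [] := by simpa [eq_comm] using ha
    rw [compareKey, wp_iter]
    simp only [wp_bind, wp_pop, Mem.get, hk, List.head?_nil, wp_ret,
      Mem.update_get, Mem.set, Sum.elim_inr, List.tail_nil]
    have := h 2 (by simp)
    rw [List.nil_append] at hd
    simpa [← hd] using this
  | cons x a ih =>
    rcases a' with _ | ⟨y, a'⟩
    · simp at ha
    rw [compareKey, wp_iter]
    simp only [wp_bind, wp_pop, Mem.get, hk, List.head?_cons, wp_ret, wp_push, hd, List.cons_append,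
      Mem.update_get, Mem.set, Sum.elim_inl, List.tail_cons]
    refine ih (a' := a') (by simpa using ha) rfl rfl fun t ht => ?_
    have := h (1 + (1 + (1 + (1 + 1))) + t) (by simp; omega)
    have e1 : (some y == some true) = y := by cases y <;> rfl
    have e2 : (f && some y == some x && decide (a = a')) = (f && decide (x :: a = y :: a')) := by
      cases f <;> cases x <;> cases y <;> simp
    rw [e1, e2]
    simpa using this

/-- The search stops at the first match, so only the concatenation of the searched part and the rest
is specified; the caller moves `dict2` back. -/
theorem wp_scan {L : ℕ} {i : Fin (2 ^ L)} {d : Dict L} {s : Mem κ} (hk : s.key = bitsOf L i)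
    (hd : s.dict = encDict d) (hk2 : s.key2 = []) {P : Option Bool → Store (V ⊕ κ) → ℕ → Prop}
    (h : ∀ t ≤ (8 * L + 10) * d.length + 2, ∀ x y, y.reverse ++ x = s.dict2.reverse ++ s.dict →
      y.length ≤ s.dict2.length + s.dict.length →
      P (d.lookup i) ({ s with dict := x, dict2 := y }).get t) :
    wp w scan s.get P := by
  induction d generalizing s P with
  | nil =>
    rw [scan, wp_iter]
    simp only [encDict, List.flatMap_nil] at hd
    simp only [wp_bind, wp_pop, Mem.get, hd, List.head?_nil, wp_ret,
      Mem.update_get, Mem.set, Sum.elim_inr, List.tail_nil]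
    exact h 2 (by simp) [] s.dict2 (by simp [hd]) (by simp)
  | cons p d ih =>
    obtain ⟨j, b⟩ := p
    rw [scan, wp_iter]
    rw [encDict_cons] at hd
    simp only [wp_bind, wp_pop, Mem.get, hd, List.head?_cons, wp_push,
      Mem.update_get, Mem.set, List.tail_cons]
    refine wp_compareKey (a := bitsOf L i) (a' := bitsOf L j) (r := encDict d) (by simp)
      (by exact hk) (by rfl)
      fun t1 ht1 => ?_
    refine wp_move (by simp) fun t2 ht2 => ?_
    simp only [Mem.get, Mem.update_get, Mem.set, hk2, Bool.true_and, length_bitsOf,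
      List.append_nil, List.reverse_reverse, List.length_reverse] at ht1 ht2 ⊢
    by_cases hij : bitsOf L i = bitsOf L j
    · have hij' : i = j := Fin.ext (bitsOf_injective i.2 j.2 hij)
      simp only [hij, decide_true, if_true, wp_ret, Sum.elim_inr]
      have := h (1 + (1 + (t1 + (t2 + 1)))) (by simp; nlinarith) (encDict d)
        ((bitsOf L j).reverse ++ b :: s.dict2) (by simp [hd]) (by simp [hd]; omega)
      rw [hij', List.lookup_cons, beq_self_eq_true] at this
      rw [hk2, hk, hij] at this
      exact this
    · have hij' : (i == j) = false := by
        rw [beq_eq_false_iff_ne]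
        rintro rfl
        exact hij rfl
      simp only [hij, decide_false, Bool.false_eq_true, if_false, wp_ret, Sum.elim_inl]
      refine ih rfl rfl rfl fun t3 ht3 x y h1 h2 => ?_
      have := h (1 + (1 + (t1 + (t2 + 1))) + t3) (by simp; nlinarith) x y
        (by rw [h1]; simp [hd]) (by simp at h2; simp [hd]; omega)
      rw [List.lookup_cons, hij'] at this
      rw [hk2, hk] at this
      exact this

/-- The fragment agrees with `lazyQuery` outcome by outcome, including the unused random bits, so
all probabilistic statements can be made about `Rnd` and not about machines. -/
theorem wp_oracle {L : ℕ} {k : κ} {d : Dict L} {s : Mem κ} (hw : s.width = List.replicate L false)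
    (hd : s.dict = encDict d) (h1 : s.tmp = []) (h2 : s.tmp2 = []) (h3 : s.cnt = [])
    (h4 : s.key = []) (h5 : s.key2 = []) (h6 : s.dict2 = [])
    {P : Option Bool → Store (V ⊕ κ) → ℕ → Prop}
    (h : ∀ t ≤ 9 * (s.aux k).length + 60 * (L + 1) * (d.length + 1),
      P ((lazyQuery L (val (s.aux k)) d).run s.rnd).1.1
        ({ s with
          dict := encDict ((lazyQuery L (val (s.aux k)) d).run s.rnd).1.2
          rnd := ((lazyQuery L (val (s.aux k)) d).run s.rnd).2 }).get t) :
    wp w (oracle (.inr k)) s.get P := by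
  obtain ⟨⟩ := s
  dsimp only at *
  subst h1 h2 h3 h4 h5 h6 hw hd
  rw [oracle, wp_bind]
  refine wp_readKey rfl rfl rfl rfl rfl rfl fun t1 ht1 => ?_
  dsimp only at ht1 ⊢
  rename_i inp rnd out size time clk arg adv ctr tries aux
  by_cases hi : val (aux k) < 2 ^ L
  · simp only [hi, decide_true, if_true, wp_bind]
    refine wp_scan (i := ⟨_, hi⟩) rfl rfl rfl fun t2 ht2 x y h7 h8 => ?_
    refine wp_move (by simp) fun t3 ht3 => ?_
    simp only [List.reverse_nil, List.nil_append, List.length_nil, zero_add] at h7 h8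
    simp only [Mem.get, Mem.update_get, Mem.set, h7] at ht3 ⊢
    rw [length_encDict] at h8
    rcases hl : d.lookup ⟨val (aux k), hi⟩ with _ | b
    · simp only [hl, wp_bind, wp_pop, Mem.get, Mem.update_get, Mem.set]
      refine wp_copy (by simp) (by simp) (by simp) rfl fun t4 ht4 => ?_
      simp only [wp_push, Mem.get, Mem.update_get, Mem.set] at ht4 ⊢
      refine wp_clear fun t5 ht5 => ?_
      simp only [wp_ret, Mem.get, Mem.update_get, Mem.set, length_bitsOf] at ht4 ht5 ⊢
      have := h (t1 + (t2 + (t3 + (1 + (t4 + (1 + (t5 + 1))))))) (by nlinarith)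
      have e : (lazyQuery L (val (aux k)) d).run rnd = ((some (rnd.head? == some true),
          (⟨val (aux k), hi⟩, rnd.head? == some true) :: d), rnd.tail) := by
        simp only [lazyQuery, hi, dif_pos, hl]
        rfl
      rw [e] at this
      exact this
    · simp only [hl, wp_bind]
      refine wp_clear fun t5 ht5 => ?_
      simp only [wp_ret, Mem.get, Mem.update_get, Mem.set, length_bitsOf] at ht5 ⊢
      have := h (t1 + (t2 + (t3 + (t5 + 1)))) (by nlinarith)
      have e : (lazyQuery L (val (aux k)) d).run rnd = ((some b, d), rnd) := by
        simp only [lazyQuery, hi, dif_pos, hl]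
        rfl
      rw [e] at this
      exact this
  · simp only [hi, decide_false, Bool.false_eq_true, if_false, wp_bind]
    refine wp_clear fun t2 ht2 => ?_
    simp only [wp_ret, Mem.get, Mem.update_get, Mem.set, length_bitsOf] at ht2 ⊢
    have := h (t1 + (t2 + 1)) (by nlinarith)
    have e : (lazyQuery L (val (aux k)) d).run rnd = ((none, d), rnd) := by
      simp only [lazyQuery, hi]
      rfl
    rw [e] at this
    exact this

end Frag

end Advice

/-! ### Clocked and unclocked simulation of machines. -/

namespace Advice

open Function (update)

/-- The stacks of a simulated machine are embedded by an injection `i`, and those outside its range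
stay empty. An arbitrary injection is allowed because the reconstruction simulates two machines on
disjoint sets of stacks. -/
theorem update_extend {α β γ : Type} [DecidableEq α] [DecidableEq β] {i : α → β}
    (hi : Function.Injective i) (f : α → γ) (g : β → γ) (a : α) (x : γ) :
    update (Function.extend i f g) (i a) x = Function.extend i (update f a x) g := by
  ext1 b
  by_cases h : ∃ a', i a' = b
  · obtain ⟨a', rfl⟩ := h
    rw [hi.extend_apply]
    by_cases h' : a' = a
    · subst h'
      simp
    · rw [Function.update_of_ne (hi.ne h'), Function.update_of_ne h', hi.extend_apply]
  · rw [Function.extend_apply' _ _ _ h, Function.update_of_ne, Function.extend_apply' _ _ _ h]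
    rintro rfl
    exact h ⟨a, rfl⟩

theorem extend_init (M : Machine) {κ : Type} [DecidableEq κ] {i : M.K → κ}
    (hi : Function.Injective i) (x : List Bool) :
    update (fun _ => []) (i M.inp) x = Function.extend i (M.init x []).stk fun _ => [] := by
  have : (M.init x []).stk = update (fun _ => []) M.inp x := by
    ext1 k
    simp only [Machine.init, Function.update_apply]
    split_ifs <;> rfl
  rw [this, ← update_extend hi]
  congr 1
  ext1 b
  by_cases h : ∃ a', i a' = b
  · obtain ⟨a', rfl⟩ := h
    rw [hi.extend_apply]
  · rw [Function.extend_apply' _ _ _ h]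

theorem length_lazyQuery {L i : ℕ} (d : Dict L) (r : List Bool) :
    ((lazyQuery L i d).run r).1.2.length ≤ d.length + 1 := by
  unfold lazyQuery
  split_ifs
  · split
    · simp
    · simp [Rnd.run]
  · simp

theorem length_lazySim (M : Machine) {L : ℕ} (t : ℕ) (c : M.Cfg) (d : Dict L) (r : List Bool) :
    ((lazySim M L t c d).run r).1.2.length ≤ d.length + t := by
  induction t generalizing c d r with
  | zero => simp [lazySim]
  | succ t ih =>
    unfold lazySim
    split
    · simp
    · exact (ih _ _ _).trans (by omega)
    · exact (ih _ _ _).trans (by omega)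
    · rw [Rnd.run_bind]
      refine (ih _ _ _).trans ?_
      have := length_lazyQuery (i := val (c.stk ‹_›)) d r
      omega

theorem length_update_cons_le {K : Type} [DecidableEq K] {s : Store K} {B t : ℕ}
    (h : ∀ k, (s k).length + (t + 1) ≤ B) (k₀ : K) (b : Bool) (k : K) :
    (update s k₀ (b :: s k₀) k).length + t ≤ B := by
  by_cases hk : k = k₀
  · subst hk
    rw [Function.update_self]
    have := h k
    simp only [List.length_cons]
    omega
  · rw [Function.update_of_ne hk]
    have := h k
    omega

theorem length_update_tail_le {K : Type} [DecidableEq K] {s : Store K} {B t : ℕ}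
    (h : ∀ k, (s k).length + (t + 1) ≤ B) (k₀ : K) (k : K) :
    (update s k₀ (s k₀).tail k).length + t ≤ B := by
  by_cases hk : k = k₀
  · subst hk
    rw [Function.update_self]
    have := h k
    simp only [List.length_tail]
    omega
  · rw [Function.update_of_ne hk]
    have := h k
    omega

namespace Frag

variable {κ : Type}

/-- Empties the stacks in a list. -/
def clearList : List κ → Frag (V ⊕ κ) Unit
  | [] => ret ()
  | k :: l => (clear (.inr k)).bind fun _ => clearList l

/-- Simulates a machine until the stack `clk` is empty; the queries are answered by `oracle`. -/
def simLoop (M : Machine) (i : M.K → κ) : M.Q → Frag (V ⊕ κ) (Option Bool) :=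
  iter fun q => (pop (.inl .clk)).bind fun o => match o with
    | none => ret (.inr none)
    | some _ => match M.code q with
      | .push k b next => (push (.inr (i k)) b).bind fun _ => ret (.inl next)
      | .pop k next => (pop (.inr (i k))).bind fun o => ret (.inl (next o))
      | .query k next => (oracle (.inr (i k))).bind fun o => ret (.inl (next o))
      | .halt b => ret (.inr (some b))

/-- Simulates a machine on the input `arg` for `time` steps; the queries are answered by
`oracle`. -/
noncomputable def simulate [Fintype κ] (M : Machine) (i : M.K → κ) : Frag (V ⊕ κ) (Option Bool) :=
  (copy (.inl .arg) (.inl .tmp) (.inr (i M.inp))).bind fun _ =>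
  (copy (.inl .time) (.inl .tmp) (.inl .clk)).bind fun _ =>
  (simLoop M i M.start).bind fun o => (clear (.inl .clk)).bind fun _ =>
  (clearList (Finset.univ : Finset κ).toList).bind fun _ => ret o

/-- Simulates a machine with the empty advice. -/
def freeLoop (M : Machine) (i : M.K → κ) : M.Q → Frag (V ⊕ κ) Bool :=
  iter fun q => match M.code q with
    | .push k b next => (push (.inr (i k)) b).bind fun _ => ret (.inl next)
    | .pop k next => (pop (.inr (i k))).bind fun o => ret (.inl (next o))
    | .query _ next => ret (.inl (next none))
    | .halt b => ret (.inr b)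

/-- Simulates a machine on the input `arg` with the empty advice. -/
noncomputable def simulateFree [Fintype κ] (M : Machine) (i : M.K → κ) : Frag (V ⊕ κ) Bool :=
  (copy (.inl .arg) (.inl .tmp) (.inr (i M.inp))).bind fun _ =>
  (freeLoop M i M.start).bind fun b =>
  (clearList (Finset.univ : Finset κ).toList).bind fun _ => ret b

variable [DecidableEq κ] {w : List Bool}

theorem wp_clearList {l : List κ} {B : ℕ} {s : Mem κ} (hB : ∀ k, (s.aux k).length ≤ B)
    {P : Unit → Store (V ⊕ κ) → ℕ → Prop}
    (h : ∀ t ≤ l.length * (2 * B + 2) + 1,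
      P () ({ s with aux := fun k => if k ∈ l then [] else s.aux k }).get t) :
    wp w (clearList l) s.get P := by
  induction l generalizing s P with
  | nil =>
    rw [clearList, wp_ret]
    simpa using h 1 (by simp)
  | cons k l ih =>
    rw [clearList, wp_bind]
    refine wp_clear fun t1 ht1 => ?_
    rw [Mem.update_get_aux]
    refine ih (fun j => ?_) fun t2 ht2 => ?_
    · by_cases hj : j = k
      · subst hj
        simp
      · simpa [hj] using hB j
    · have := h (t1 + t2) (by
        have : t1 ≤ 2 * B + 2 := ht1.trans (by have := hB k; simp only [Mem.get]; omega)
        simp only [List.length_cons]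
        linarith)
      convert this using 3
      ext1 j
      simp only [List.mem_cons, Function.update_apply]
      split_ifs <;> simp_all

theorem wp_clearList_univ [Fintype κ] {B : ℕ} {s : Mem κ} (hB : ∀ k, (s.aux k).length ≤ B)
    {P : Unit → Store (V ⊕ κ) → ℕ → Prop}
    (h : ∀ t ≤ Fintype.card κ * (2 * B + 2) + 1, P () ({ s with aux := fun _ => [] }).get t) :
    wp w (clearList (Finset.univ : Finset κ).toList) s.get P := by
  refine wp_clearList hB fun t ht => ?_
  simp only [Finset.mem_toList, Finset.mem_univ, if_true]
  exact h t (by simpa using ht)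

/-- A step lengthens a stack, or the dictionary, by at most one entry. Size plus remaining time
therefore never increases, and `B` and `D` bound all sizes throughout the run. -/
theorem wp_simLoop {M : Machine} {i : M.K → κ} (hi : Function.Injective i) {L T B D : ℕ}
    {q : M.Q} {stk : M.K → List Bool} {d : Dict L} {s : Mem κ}
    (hw : s.width = List.replicate L false) (hclk : s.clk = List.replicate T false)
    (hd : s.dict = encDict d) (ha : s.aux = Function.extend i stk fun _ => [])
    (h1 : s.tmp = []) (h2 : s.tmp2 = []) (h3 : s.cnt = [])
    (h4 : s.key = []) (h5 : s.key2 = []) (h6 : s.dict2 = [])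
    (hB : ∀ k, (stk k).length + T ≤ B) (hD : d.length + T ≤ D)
    {P : Option Bool → Store (V ⊕ κ) → ℕ → Prop}
    (h : ∀ t ≤ (T + 1) * (9 * B + 60 * (L + 1) * (D + 1) + 2), ∀ clk stk',
      clk.length ≤ T → (∀ k, (stk' k).length ≤ B) →
      P ((lazySim M L T ⟨q, stk⟩ d).run s.rnd).1.1
        ({ s with
          clk := clk
          aux := Function.extend i stk' fun _ => []
          dict := encDict ((lazySim M L T ⟨q, stk⟩ d).run s.rnd).1.2
          rnd := ((lazySim M L T ⟨q, stk⟩ d).run s.rnd).2 }).get t) :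
    wp w (simLoop M i q) s.get P := by
  induction T generalizing q stk d s P with
  | zero =>
    obtain ⟨⟩ := s
    dsimp only at *
    subst h1 h2 h3 h4 h5 h6 hw hd ha hclk
    rw [simLoop, wp_iter]
    simp only [wp_bind, wp_pop, Mem.get, List.replicate_zero, List.head?_nil, wp_ret,
      Mem.update_get, Mem.set, Sum.elim_inr, List.tail_nil]
    exact h 2 (by omega) [] stk (by simp) hB
  | succ T ih =>
    obtain ⟨⟩ := s
    dsimp only at *
    subst h1 h2 h3 h4 h5 h6 hw hd ha hclk
    rename_i rnd _ _ _ _ _ _ _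
    rw [simLoop, wp_iter]
    simp only [wp_bind, wp_pop, Mem.get, List.replicate_succ, List.head?_cons,
      Mem.update_get, Mem.set, List.tail_cons]
    rcases hc : M.code q with ⟨k, b, next⟩ | ⟨k, next⟩ | ⟨k, next⟩ | b
    · simp only [wp_bind, wp_push, wp_ret, Sum.elim_inl, Mem.update_get_aux, Mem.get,
        hi.extend_apply, update_extend hi]
      refine ih rfl rfl rfl rfl rfl rfl rfl rfl rfl rfl (length_update_cons_le hB k b) (by omega)
        fun t ht clk stk' h7 h8 => ?_
      have := h (1 + (1 + 1) + t) (by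
        have : 3 ≤ 9 * B + 60 * (L + 1) * (D + 1) + 2 := by nlinarith
        linarith) clk stk' (by omega) h8
      simp only [lazySim, hc] at this
      exact this
    · simp only [wp_bind, wp_pop, wp_ret, Sum.elim_inl, Mem.update_get_aux, Mem.get,
        hi.extend_apply, update_extend hi]
      refine ih rfl rfl rfl rfl rfl rfl rfl rfl rfl rfl (length_update_tail_le hB k) (by omega)
        fun t ht clk stk' h7 h8 => ?_
      have := h (1 + (1 + 1) + t) (by
        have : 3 ≤ 9 * B + 60 * (L + 1) * (D + 1) + 2 := by nlinarith
        linarith) clk stk' (by omega) h8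
      simp only [lazySim, hc] at this
      exact this
    · simp only [wp_bind]
      refine wp_oracle (d := d) rfl rfl rfl rfl rfl rfl rfl rfl fun t1 ht1 => ?_
      simp only [wp_ret, Sum.elim_inl, hi.extend_apply] at ht1 ⊢
      have hlen := length_lazyQuery (L := L) (i := val (stk k)) d rnd
      refine ih rfl rfl rfl rfl rfl rfl rfl rfl rfl rfl (fun k => ?_) ?_
        fun t ht clk stk' h7 h8 => ?_
      · have := hB k
        omega
      · exact (Nat.add_le_add_right hlen T).trans (by omega)
      have := h (1 + (t1 + 1) + t) (by
        have h9 : t1 ≤ 9 * B + 60 * (L + 1) * (D + 1) := by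
          refine ht1.trans (add_le_add ?_ ?_)
          · have := hB k
            omega
          · exact Nat.mul_le_mul_left _ (by omega)
        linarith) clk stk' (by omega) h8
      simp only [lazySim, hc, Rnd.run_bind] at this
      exact this
    · simp only [wp_ret, Sum.elim_inr]
      have := h (1 + 1) (by
        have : 2 ≤ 9 * B + 60 * (L + 1) * (D + 1) + 2 := by omega
        nlinarith) (List.replicate T false) stk (by simp) (fun k => (Nat.le_add_right _ _).trans (hB k))
      simp only [lazySim, hc] at this
      exact this

/-- A time bound for `simulate`. -/
def simTime (c n T L D : ℕ) : ℕ := 100 * (c + 1) * (T + 1) * (n + T + 1 + (L + 1) * (D + 1))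

theorem wp_simulate [Fintype κ] {M : Machine} {i : M.K → κ} (hi : Function.Injective i)
    {L T D : ℕ} {d : Dict L} {s : Mem κ}
    (hw : s.width = List.replicate L false) (htime : s.time = List.replicate T false)
    (hd : s.dict = encDict d) (ha : s.aux = fun _ => []) (hclk : s.clk = [])
    (h1 : s.tmp = []) (h2 : s.tmp2 = []) (h3 : s.cnt = [])
    (h4 : s.key = []) (h5 : s.key2 = []) (h6 : s.dict2 = []) (hD : d.length + T ≤ D)
    {P : Option Bool → Store (V ⊕ κ) → ℕ → Prop}
    (h : ∀ t ≤ simTime (Fintype.card κ) s.arg.length T L D,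
      P ((lazySim M L T (M.init s.arg []) d).run s.rnd).1.1
        ({ s with
          dict := encDict ((lazySim M L T (M.init s.arg []) d).run s.rnd).1.2
          rnd := ((lazySim M L T (M.init s.arg []) d).run s.rnd).2 }).get t) :
    wp w (simulate M i) s.get P := by
  obtain ⟨⟩ := s
  dsimp only at *
  subst h1 h2 h3 h4 h5 h6 hw hd ha hclk htime
  rename_i inp rnd out size arg adv ctr tries
  simp only [simulate, wp_bind]
  refine wp_copy (by simp) (by simp) (by simp) rfl fun t1 ht1 => ?_
  rw [Mem.update_get_aux]
  simp only [Mem.get, List.append_nil, extend_init M hi] at ht1 ⊢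
  refine wp_copy (by simp) (by simp) (by simp) rfl fun t2 ht2 => ?_
  simp only [Mem.get, List.append_nil, Mem.update_get, Mem.set, List.length_replicate] at ht2 ⊢
  refine wp_simLoop hi (L := L) (T := T) (B := arg.length + T) (D := D) (d := d) rfl rfl rfl rfl
    rfl rfl rfl rfl rfl rfl (fun k => ?_) hD fun t3 ht3 clk stk' h7 h8 => ?_
  · simp only [Machine.init]
    split_ifs <;> simp
  refine wp_clear fun t4 ht4 => ?_
  simp only [Mem.get, Mem.update_get, Mem.set] at ht4 ⊢
  refine wp_clearList_univ (B := arg.length + T) (fun k => ?_) fun t5 ht5 => ?_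
  · by_cases hk : ∃ k', i k' = k
    · obtain ⟨k', rfl⟩ := hk
      simpa [hi.extend_apply] using h8 k'
    · simp [Function.extend_apply' _ _ _ hk]
  simp only [wp_ret]
  refine h _ ?_
  rw [simTime]
  set c := Fintype.card κ
  set n := arg.length
  set X := n + T + 1 + (L + 1) * (D + 1) with hX
  have e1 : 9 * (n + T) + 60 * (L + 1) * (D + 1) + 2 ≤ 60 * X := by rw [hX]; nlinarith
  have e2 : t3 ≤ (T + 1) * (60 * X) := ht3.trans (Nat.mul_le_mul_left _ e1)
  have e3 : t5 ≤ c * (2 * X) + 1 := ht5.trans (by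
    have : 2 * (n + T) + 2 ≤ 2 * X := by omega
    nlinarith)
  have e4 : n + T + 1 ≤ X := by omega
  have e5 : X ≤ (T + 1) * X := by nlinarith
  have e6 : c * (2 * X) ≤ c * (100 * ((T + 1) * X)) := Nat.mul_le_mul_left _ (by omega)
  have e7 : 100 * (c + 1) * (T + 1) * X = c * (100 * ((T + 1) * X)) + 100 * ((T + 1) * X) := by ring
  rw [e7]
  have e8 : (T + 1) * (60 * X) = 60 * ((T + 1) * X) := by ring
  rw [e8] at e2
  omega

/-- This loop serves the exponential-time machine for `A`. It needs no clock, since halting is a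
hypothesis; so the exponential bound `T` never has to be written on a stack. -/
theorem wp_freeLoop {M : Machine} {i : M.K → κ} (hi : Function.Injective i) {T B : ℕ}
    {q : M.Q} {stk : M.K → List Bool} {b : Bool} {s : Mem κ}
    (hb : M.code ((M.step [])^[T] ⟨q, stk⟩).state = .halt b)
    (ha : s.aux = Function.extend i stk fun _ => [])
    (hB : ∀ k, (stk k).length + T ≤ B)
    {P : Bool → Store (V ⊕ κ) → ℕ → Prop}
    (h : ∀ t ≤ 2 * T + 1, ∀ stk', (∀ k, (stk' k).length ≤ B) →
      P b ({ s with aux := Function.extend i stk' fun _ => [] }).get t) :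
    wp w (freeLoop M i q) s.get P := by
  by_cases hh : ∃ b', M.code q = .halt b'
  · obtain ⟨b', hh⟩ := hh
    rw [M.iterate_step_of_halt [] (c := ⟨q, stk⟩) hh, hh] at hb
    obtain rfl : b' = b := by simpa using hb
    rw [freeLoop, wp_iter]
    simp only [hh, wp_ret, Sum.elim_inr]
    have := h 1 (by omega) stk fun k => (Nat.le_add_right _ _).trans (hB k)
    rw [← ha] at this
    exact this
  induction T generalizing q stk s P with
  | zero => exact absurd ⟨b, hb⟩ hh
  | succ T ih =>
    rw [Function.iterate_succ_apply] at hb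
    have step : ∀ q' stk' (t : ℕ), M.step [] ⟨q, stk⟩ = ⟨q', stk'⟩ → t ≤ 2 →
        (∀ k, (stk' k).length + T ≤ B) →
        wp w (freeLoop M i q') ({ s with aux := Function.extend i stk' fun _ => [] }).get
          fun e s' t' => P e s' (t + t') := by
      intro q' stk' t h1 h2 h3
      rw [h1] at hb
      have h4 : ∀ t' ≤ 2 * T + 1, ∀ stk'', (∀ k, (stk'' k).length ≤ B) →
          P b ({ s with aux := Function.extend i stk'' fun _ => [] }).get (t + t') :=
        fun t' ht' stk'' h5 => h _ (by omega) stk'' h5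
      by_cases hh' : ∃ b', M.code q' = .halt b'
      · obtain ⟨b', hh'⟩ := hh'
        rw [M.iterate_step_of_halt [] (c := ⟨q', stk'⟩) hh', hh'] at hb
        obtain rfl : b' = b := by simpa using hb
        rw [freeLoop, wp_iter]
        simp only [hh', wp_ret, Sum.elim_inr]
        exact h4 1 (by omega) stk' fun k => (Nat.le_add_right _ _).trans (h3 k)
      · exact ih hb rfl h3 h4 hh'
    rw [freeLoop, wp_iter]
    rcases hc : M.code q with ⟨k, b, next⟩ | ⟨k, next⟩ | ⟨k, next⟩ | b
    · simp only [wp_bind, wp_push, wp_ret, Sum.elim_inl, Mem.update_get_aux, Mem.get, ha,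
        hi.extend_apply, update_extend hi]
      exact step _ _ _ (by simp [Machine.step, hc]) (by omega) (length_update_cons_le hB k b)
    · simp only [wp_bind, wp_pop, wp_ret, Sum.elim_inl, Mem.update_get_aux, Mem.get, ha,
        hi.extend_apply, update_extend hi]
      exact step _ _ _ (by simp [Machine.step, hc]) (by omega) (length_update_tail_le hB k)
    · simp only [wp_ret, Sum.elim_inl]
      have := step (next none) stk 1 (by simp [Machine.step, hc]) (by omega)
        fun k => by have := hB k; omega
      rw [← ha] at this
      exact this
    · exact absurd ⟨b, hc⟩ hh

theorem wp_simulateFree [Fintype κ] {M : Machine} {i : M.K → κ} (hi : Function.Injective i)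
    {T : ℕ} {b : Bool} {s : Mem κ} (hb : M.HaltsWith s.arg [] [] T b)
    (ha : s.aux = fun _ => []) (h1 : s.tmp = [])
    {P : Bool → Store (V ⊕ κ) → ℕ → Prop}
    (h : ∀ t ≤ 20 * (Fintype.card κ + 1) * (s.arg.length + T + 1), P b s.get t) :
    wp w (simulateFree M i) s.get P := by
  obtain ⟨⟩ := s
  dsimp only at *
  subst h1 ha
  rename_i inp rnd out _ _ _ _ _ _ _ _ _ _ arg adv ctr tries
  simp only [simulateFree, wp_bind]
  refine wp_copy (by simp) (by simp) (by simp) rfl fun t1 ht1 => ?_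
  rw [Mem.update_get_aux]
  simp only [Mem.get, List.append_nil, extend_init M hi] at ht1 ⊢
  refine wp_freeLoop hi (T := T) (B := arg.length + T) hb rfl (fun k => ?_)
    fun t2 ht2 stk' h2 => ?_
  · split_ifs <;> simp
  refine wp_clearList_univ (B := arg.length + T) (fun k => ?_) fun t3 ht3 => ?_
  · by_cases hk : ∃ k', i k' = k
    · obtain ⟨k', rfl⟩ := hk
      simpa [hi.extend_apply] using h2 k'
    · simp [Function.extend_apply' _ _ _ hk]
  simp only [wp_ret]
  refine h _ ?_
  nlinarith

end Frag

end Advice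

/-! ### The probabilistic machine. -/

namespace Advice

theorem length_attempt (M : Machine) {L : ℕ} (t : ℕ) (x : List Bool) (l : List (List Bool × Bool))
    (d : Dict L) (r : List Bool) :
    ((attempt M L t x l d).run r).1.2.length ≤ d.length + (l.length + 1) * t := by
  induction l generalizing d r with
  | nil =>
    simp only [attempt, Rnd.run_bind, Rnd.run_ret, List.length_nil, zero_add, one_mul]
    exact length_lazySim M t _ d r
  | cons p l ih =>
    simp only [attempt, Rnd.run_bind]
    have h := length_lazySim M t (M.init p.1 []) d r
    simp only [List.length_cons, add_mul] at ih ⊢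
    split_ifs
    · exact (ih _ _).trans (by omega)
    · simp only [Rnd.run_ret]
      omega

/-- The list of bits that stores a list of inputs with their answers. -/
def encList (l : List (List Bool × Bool)) : List Bool := l.flatMap fun p => p.2 :: p.1.reverse

theorem length_encList {n : ℕ} {l : List (List Bool × Bool)} (h : ∀ p ∈ l, p.1.length = n) :
    (encList l).length = l.length * (n + 1) := by
  induction l with
  | nil => simp [encList]
  | cons p l ih =>
    have : encList (p :: l) = p.2 :: (p.1.reverse ++ encList l) := rfl
    rw [this]
    simp only [List.length_cons, List.length_append, List.length_reverse,
      ih fun q hq => h q (List.mem_cons_of_mem _ hq), h p List.mem_cons_self]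
    ring

namespace Frag

variable {κ : Type}

/-- Moves `tmp2` back to `inp`, and writes its length on `size`. -/
def measureLoop : Frag (V ⊕ κ) Unit :=
  iter (fun _ : Unit => (pop (.inl .tmp2)).bind fun o => match o with
    | none => ret (.inr ())
    | some x => (push (.inl .inp) x).bind fun _ => (push (.inl .size) false).bind fun _ =>
      ret (.inl ())) ()

/-- Writes the length of `inp` in unary on `size`. -/
def measure : Frag (V ⊕ κ) Unit :=
  (move (.inl .inp) (.inl .tmp2)).bind fun _ => measureLoop

/-- Writes a power of `size` on the empty stack `k`. -/
def power (k : V) (e : ℕ) : Frag (V ⊕ κ) Unit :=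
  (push (.inl k) false).bind fun _ => mulPow (.inl .size) (.inl .tmp) (.inl k) (.inl .tmp2) e

/-- Computes the parameters of the simulations from `inp`. -/
def prepare (d e e' : ℕ) : Frag (V ⊕ κ) Unit :=
  measure.bind fun _ => (power .width d).bind fun _ =>
  (push (.inl .size) false).bind fun _ => (push (.inl .size) false).bind fun _ =>
  (power .time e).bind fun _ => (power .tries e').bind fun _ =>
  (pop (.inl .size)).bind fun _ => (pop (.inl .size)).bind fun _ => ret ()

/-- Moves `|cnt|` bits from `adv` to `arg`. -/
def takeArg : Frag (V ⊕ κ) Unit :=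
  iter (fun _ : Unit => (pop (.inl .cnt)).bind fun o => match o with
    | none => ret (.inr ())
    | some _ => (pop (.inl .adv)).bind fun o => (push (.inl .arg) (o == some true)).bind fun _ =>
      ret (.inl ())) ()

/-- Carries out one attempt with the list stored on `adv`. -/
noncomputable def attemptLoop [Fintype κ] (M : Machine) (i : M.K → κ) :
    Frag (V ⊕ κ) (Option Bool) :=
  iter (fun _ : Unit => (pop (.inl .adv)).bind fun o => match o with
    | none => (copy (.inl .inp) (.inl .tmp) (.inl .arg)).bind fun _ => (simulate M i).bind fun o =>
      ret (.inr (some (o == some true)))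
    | some b => (copy (.inl .size) (.inl .tmp) (.inl .cnt)).bind fun _ => takeArg.bind fun _ =>
      (simulate M i).bind fun o => (clear (.inl .arg)).bind fun _ =>
        if o = some b then ret (.inl ())
        else (clear (.inl .adv)).bind fun _ => ret (.inr none)) ()

/-- Carries out `|tries|` attempts with the list stored in the advice. -/
noncomputable def trialsLoop [Fintype κ] (M : Machine) (i : M.K → κ) : Frag (V ⊕ κ) Bool :=
  iter (fun _ : Unit => (pop (.inl .tries)).bind fun o => match o with
    | none => ret (.inr false)
    | some _ => (readAdvice (.inl .ctr) (.inl .tmp) (.inl .adv)).bind fun _ =>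
      (attemptLoop M i).bind fun o => (clear (.inl .dict)).bind fun _ => match o with
        | some b => ret (.inr b)
        | none => ret (.inl ())) ()

variable [DecidableEq κ] {w : List Bool}

theorem wp_measureLoop {s : Mem κ} {P : Unit → Store (V ⊕ κ) → ℕ → Prop}
    (h : ∀ t ≤ 4 * s.tmp2.length + 2, P () ({ s with
      inp := s.tmp2.reverse ++ s.inp, tmp2 := [],
      size := List.replicate s.tmp2.length false ++ s.size }).get t) :
    wp w measureLoop s.get P := by
  obtain ⟨l, hl⟩ : ∃ l, s.tmp2 = l := ⟨_, rfl⟩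
  induction l generalizing s P with
  | nil =>
    rw [measureLoop, wp_iter]
    simp only [wp_bind, wp_pop, Mem.get, hl, List.head?_nil, wp_ret,
      Mem.update_get, Mem.set, Sum.elim_inr, List.tail_nil]
    simpa [hl] using h 2 (by simp)
  | cons b l ih =>
    rw [measureLoop, wp_iter]
    simp only [wp_bind, wp_pop, wp_push, Mem.get, hl, List.head?_cons, wp_ret,
      Mem.update_get, Mem.set, Sum.elim_inl, List.tail_cons]
    refine ih (fun t ht => ?_) rfl
    have := h (1 + (1 + (1 + 1)) + t) (by simp [hl]; simp at ht; omega)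
    have e : List.replicate l.length false ++ false :: s.size =
        List.replicate (l.length + 1) false ++ s.size := by
      rw [List.replicate_succ', List.append_assoc]
      rfl
    simpa [hl, e] using this

theorem wp_measure {s : Mem κ} (h1 : s.tmp2 = []) (h2 : s.size = [])
    {P : Unit → Store (V ⊕ κ) → ℕ → Prop}
    (h : ∀ t ≤ 7 * s.inp.length + 4,
      P () ({ s with size := List.replicate s.inp.length false }).get t) :
    wp w measure s.get P := by
  obtain ⟨⟩ := s
  dsimp only at *
  subst h1 h2
  simp only [measure, wp_bind]
  refine wp_move (by simp) fun t1 ht1 => ?_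
  simp only [Mem.get, Mem.update_get, Mem.set, List.append_nil] at ht1 ⊢
  refine wp_measureLoop fun t2 ht2 => ?_
  simp only [List.reverse_reverse, List.append_nil, List.length_reverse] at ht2 ⊢
  exact h _ (by omega)

theorem wp_power {k : V} (hk1 : k ≠ .size) (hk2 : k ≠ .tmp) (hk3 : k ≠ .tmp2) {e n : ℕ} {s : Mem κ}
    (hn : s.size = List.replicate n false)
    (h1 : s.tmp = []) (h2 : s.tmp2 = []) (h3 : s.get (.inl k) = [])
    {P : Unit → Store (V ⊕ κ) → ℕ → Prop}
    (h : ∀ t ≤ 20 * (e + 1) * (n + 1) ^ (e + 1) + 1,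
      P () (s.set k (List.replicate (n ^ e) false)).get t) :
    wp w (power k e) s.get P := by
  simp only [power, wp_bind, wp_push]
  refine wp_mulPow (m := n) (n := 1) (by simp) (by simpa using hk1.symm) (by simp)
    (by simpa using hk2.symm) (by simp) (by simpa using hk3)
    ?_ ?_ ?_ ?_ fun t ht => ?_
  · rw [Function.update_of_ne (by simpa using hk1.symm)]
    exact hn
  · rw [Function.update_of_ne (by simpa using hk2.symm)]
    exact h1
  · rw [Function.update_self, h3]
    rfl
  · rw [Function.update_of_ne (by simpa using hk3.symm)]
    exact h2
  · rw [Function.update_idem, Mem.update_get, one_mul]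
    refine h _ ?_
    linarith

theorem wp_prepare {d e e' : ℕ} {s : Mem κ}
    (h1 : s.tmp = []) (h2 : s.tmp2 = []) (h3 : s.size = []) (h4 : s.width = [])
    (h5 : s.time = []) (h6 : s.tries = []) {P : Unit → Store (V ⊕ κ) → ℕ → Prop}
    (h : ∀ t ≤ 20 * (d + e + e' + 5) * (s.inp.length + 3) ^ (d + e + e' + 1), P () ({ s with
      size := List.replicate s.inp.length false
      width := List.replicate (s.inp.length ^ d) false
      time := List.replicate ((s.inp.length + 2) ^ e) false
      tries := List.replicate ((s.inp.length + 2) ^ e') false }).get t) :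
    wp w (prepare d e e') s.get P := by
  obtain ⟨⟩ := s
  dsimp only at *
  subst h1 h2 h3 h4 h5 h6
  rename_i inp _ _ _ _ _ _ _ _ _ _ _ _
  simp only [prepare, wp_bind]
  refine wp_measure rfl rfl fun t1 ht1 => ?_
  refine wp_power (n := inp.length) (by simp) (by simp) (by simp) rfl rfl rfl rfl fun t2 ht2 => ?_
  simp only [wp_push, Mem.get, Mem.update_get, Mem.set]
  -- `size` is raised by two while these powers are computed: the powers of `n + 2` dominate every
  -- polynomial also at `n = 0` and `n = 1`.
  refine wp_power (n := inp.length + 2) (by simp) (by simp) (by simp)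
    (by simp [List.replicate_succ]) rfl rfl rfl fun t3 ht3 => ?_
  refine wp_power (n := inp.length + 2) (by simp) (by simp) (by simp)
    (by simp [Mem.set, List.replicate_succ]) rfl rfl rfl fun t4 ht4 => ?_
  simp only [wp_pop, Mem.get, Mem.update_get, Mem.set, List.tail_cons, wp_ret]
  refine h _ ?_
  dsimp only at ht1
  set n := inp.length
  have e1 : ∀ j ≤ d + e + e', ∀ m ≤ n + 2, (m + 1) ^ (j + 1) ≤ (n + 3) ^ (d + e + e' + 1) :=
    fun j hj m hm => (Nat.pow_le_pow_left (by omega) _).trans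
      (Nat.pow_le_pow_right (by omega) (by omega))
  have e2 := Nat.mul_le_mul_left (20 * (d + 1)) (e1 d (by omega) n (by omega))
  have e3 := Nat.mul_le_mul_left (20 * (e + 1)) (e1 e (by omega) (n + 2) (by omega))
  have e4 := Nat.mul_le_mul_left (20 * (e' + 1)) (e1 e' (by omega) (n + 2) (by omega))
  have e5 : n + 3 ≤ (n + 3) ^ (d + e + e' + 1) := Nat.le_self_pow (by omega) _
  nlinarith

theorem wp_takeArg {y r : List Bool} {s : Mem κ} (hs : s.cnt = List.replicate y.length false)
    (ha : s.adv = y ++ r) {P : Unit → Store (V ⊕ κ) → ℕ → Prop}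
    (h : ∀ t ≤ 4 * y.length + 2, P () ({ s with
      cnt := [], adv := r, arg := y.reverse ++ s.arg}).get t) :
    wp w takeArg s.get P := by
  induction y generalizing s P with
  | nil =>
    rw [takeArg, wp_iter]
    simp only [wp_bind, wp_pop, Mem.get, hs, List.length_nil, List.replicate_zero, List.head?_nil,
      wp_ret, Mem.update_get, Mem.set, Sum.elim_inr, List.tail_nil]
    have := h 2 (by simp)
    rw [List.nil_append] at ha
    simpa [← ha] using this
  | cons b y ih =>
    rw [takeArg, wp_iter]
    simp only [wp_bind, wp_pop, Mem.get, hs, List.length_cons, List.replicate_succ, List.head?_cons,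
      wp_ret, ha, List.cons_append,
      Mem.update_get, Mem.set, Sum.elim_inl, List.tail_cons, wp_push]
    refine ih rfl rfl fun t ht => ?_
    have := h (1 + (1 + (1 + 1)) + t) (by simp; omega)
    have e1 : (some b == some true) = b := by cases b <;> rfl
    rw [e1]
    simpa using this

/-- The stack `arg` has to be empty again only if the attempt failed, as only then another one
follows. -/
theorem wp_attemptLoop [Fintype κ] {M : Machine} {i : M.K → κ} (hi : Function.Injective i)
    {n L T D : ℕ} {l : List (List Bool × Bool)} (hl : ∀ p ∈ l, p.1.length = n)
    {d : Dict L} {s : Mem κ} (hn : s.inp.length = n)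
    (hsize : s.size = List.replicate n false) (hadv : s.adv = encList l) (harg : s.arg = [])
    (hw : s.width = List.replicate L false) (htime : s.time = List.replicate T false)
    (hd : s.dict = encDict d) (ha : s.aux = fun _ => []) (hclk : s.clk = [])
    (h1 : s.tmp = []) (h2 : s.tmp2 = []) (h3 : s.cnt = [])
    (h4 : s.key = []) (h5 : s.key2 = []) (h6 : s.dict2 = []) (hD : d.length + (l.length + 1) * T ≤ D)
    {P : Option Bool → Store (V ⊕ κ) → ℕ → Prop}
    (h : ∀ t ≤ (l.length + 1) * (simTime (Fintype.card κ) n T L D + 40 * (n + 1)), ∀ arg,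
      (((attempt M L T s.inp l d).run s.rnd).1.1 = none → arg = []) →
      P ((attempt M L T s.inp l d).run s.rnd).1.1
        ({ s with
          adv := []
          arg := arg
          dict := encDict ((attempt M L T s.inp l d).run s.rnd).1.2
          rnd := ((attempt M L T s.inp l d).run s.rnd).2 }).get t) :
    wp w (attemptLoop M i) s.get P := by
  induction l generalizing d s P with
  | nil =>
    obtain ⟨⟩ := s
    dsimp only at *
    subst h1 h2 h3 h4 h5 h6 hw hd ha hclk htime harg hadv hsize hn
    rename_i inp rnd _ _ _
    rw [attemptLoop, wp_iter]
    simp only [wp_bind, wp_pop, Mem.get, encList, List.flatMap_nil, List.head?_nil,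
      Mem.update_get, Mem.set, List.tail_nil]
    refine wp_copy (by simp) (by simp) (by simp) rfl fun t1 ht1 => ?_
    simp only [Mem.get, Mem.update_get, Mem.set, List.append_nil] at ht1 ⊢
    refine wp_simulate hi (L := L) (T := T) (D := D) (d := d) rfl rfl rfl rfl rfl rfl rfl rfl rfl
      rfl rfl (by simpa using hD) fun t2 ht2 => ?_
    dsimp only at ht2
    simp only [wp_ret, Sum.elim_inr]
    have := h (1 + (t1 + (t2 + 1))) (by simp only [List.length_nil]; omega) inp
    simp only [attempt, Rnd.run_bind, Rnd.run_ret, reduceCtorEq, false_implies] at this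
    exact this trivial
  | cons p l ih =>
    obtain ⟨y, b⟩ := p
    obtain ⟨⟩ := s
    dsimp only at *
    subst h1 h2 h3 h4 h5 h6 hw hd ha hclk htime harg hadv hsize
    rename_i inp rnd _ _ _
    have hy : y.length = n := hl _ List.mem_cons_self
    have hl' : ∀ p ∈ l, p.1.length = n := fun p hp => hl p (List.mem_cons_of_mem _ hp)
    have henc : encList ((y, b) :: l) = b :: (y.reverse ++ encList l) := rfl
    rw [attemptLoop, wp_iter]
    simp only [wp_bind, wp_pop, Mem.get, henc, List.head?_cons,
      Mem.update_get, Mem.set, List.tail_cons]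
    refine wp_copy (by simp) (by simp) (by simp) rfl fun t1 ht1 => ?_
    simp only [Mem.get, Mem.update_get, Mem.set, List.append_nil, List.length_replicate] at ht1 ⊢
    -- Moving bits between stacks reverses them, which is why `encList` stores the inputs backwards.
    refine wp_takeArg (y := y.reverse) (r := encList l) (by simp [hy]) (by rfl) fun t2 ht2 => ?_
    simp only [List.reverse_reverse, List.append_nil, List.length_reverse] at ht2 ⊢
    simp only [List.length_cons] at hD h
    have hDl : (l.length + 1 + 1) * T = (l.length + 1) * T + T := by ring
    refine wp_simulate hi (L := L) (T := T) (D := D) (d := d) rfl rfl rfl rfl rfl rfl rfl rfl rfl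
      rfl rfl (by omega) fun t3 ht3 => ?_
    dsimp only at ht3
    rw [hy] at ht3 ht2
    refine wp_clear fun t4 ht4 => ?_
    simp only [Mem.get, Mem.update_get, Mem.set, hy] at ht4 ⊢
    have hlen := length_lazySim M T (M.init y []) d rnd
    simp only [attempt, Rnd.run_bind] at h
    set S := simTime (Fintype.card κ) n T L D
    by_cases ho : ((lazySim M L T (M.init y []) d).run rnd).1.1 = some b
    · simp only [ho, if_true, wp_ret, Sum.elim_inl] at h ⊢
      refine ih hl' hn rfl rfl rfl rfl rfl rfl rfl rfl rfl rfl rfl rfl rfl rfl ?_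
        fun t5 ht5 arg' harg' => ?_
      · omega
      · exact h (1 + (t1 + (t2 + (t3 + (t4 + 1)))) + t5) (by linarith) arg' harg'
    · simp only [ho, if_false, Rnd.run_ret, wp_bind] at h ⊢
      refine wp_clear fun t5 ht5 => ?_
      simp only [Mem.get, Mem.update_get, Mem.set, wp_ret, Sum.elim_inr] at ht5 ⊢
      rw [length_encList hl'] at ht5
      exact h (1 + (t1 + (t2 + (t3 + (t4 + (t5 + 1)))))) (by nlinarith) [] fun _ => rfl

/-- The advice is read afresh for each attempt, since an attempt consumes its copy. Reading reverses
it, so it is supplied as the reverse of `encList l`. -/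
theorem wp_trialsLoop [Fintype κ] {M : Machine} {i : M.K → κ} (hi : Function.Injective i)
    {n L T D N : ℕ} {l : List (List Bool × Bool)} (hl : ∀ p ∈ l, p.1.length = n)
    {s : Mem κ} (hn : s.inp.length = n) (hN : s.tries = List.replicate N false)
    (hsize : s.size = List.replicate n false) (hadv : s.adv = []) (harg : s.arg = [])
    (hctr : s.ctr = [])
    (hw : s.width = List.replicate L false) (htime : s.time = List.replicate T false)
    (hd : s.dict = []) (ha : s.aux = fun _ => []) (hclk : s.clk = [])
    (h1 : s.tmp = []) (h2 : s.tmp2 = []) (h3 : s.cnt = [])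
    (h4 : s.key = []) (h5 : s.key2 = []) (h6 : s.dict2 = []) (hD : (l.length + 1) * T ≤ D)
    {P : Bool → Store (V ⊕ κ) → ℕ → Prop}
    (h : ∀ t ≤ (N + 1) * (10 * ((encList l).length + 2) ^ 2 +
        (l.length + 1) * (simTime (Fintype.card κ) n T L D + 40 * (n + 1)) +
        2 * ((L + 1) * D) + 10), ∀ s',
      P ((trials M L T s.inp l N).run s.rnd).1 s' t) :
    wp (encList l).reverse (trialsLoop M i) s.get P := by
  induction N generalizing s P with
  | zero =>
    rw [trialsLoop, wp_iter]
    simp only [wp_bind, wp_pop, Mem.get, hN, List.replicate_zero, List.head?_nil, wp_ret,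
      Mem.update_get, Mem.set, Sum.elim_inr, List.tail_nil]
    exact h 2 (by omega) _
  | succ N ih =>
    obtain ⟨⟩ := s
    dsimp only at *
    subst h1 h2 h3 h4 h5 h6 hw hd ha hclk htime harg hadv hsize hctr hN
    rename_i inp rnd _
    rw [trialsLoop, wp_iter]
    simp only [wp_bind, wp_pop, Mem.get, List.replicate_succ, List.head?_cons,
      Mem.update_get, Mem.set, List.tail_cons]
    refine wp_readAdvice (by simp) (by simp) (by simp) rfl rfl fun t1 ht1 => ?_
    simp only [Mem.get, Mem.update_get, Mem.set, List.append_nil, List.reverse_reverse,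
      List.length_reverse] at ht1 ⊢
    refine wp_attemptLoop hi (n := n) (L := L) (T := T) (D := D) (l := l) (d := []) hl hn rfl rfl rfl
      rfl rfl rfl rfl rfl rfl rfl rfl rfl rfl rfl (by simpa using hD) fun t2 ht2 arg' harg' => ?_
    refine wp_clear fun t3 ht3 => ?_
    simp only [Mem.get, Mem.update_get, Mem.set, length_encDict] at ht3 ⊢
    have hlen := length_attempt M T inp l ([] : Dict L) rnd
    simp only [List.length_nil, zero_add] at hlen
    have ht3' : t3 ≤ 2 * ((L + 1) * D) + 2 := ht3.trans
      (by have := Nat.mul_le_mul_left (L + 1) (hlen.trans hD); omega)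
    simp only [trials, Rnd.run_bind] at h
    rcases ho : ((attempt M L T inp l []).run rnd).1.1 with _ | b
    · simp only [ho, wp_ret, Sum.elim_inl] at h ⊢
      refine ih hn rfl rfl rfl (harg' ho) rfl rfl rfl rfl rfl rfl rfl rfl rfl rfl rfl rfl
        fun t4 ht4 s' => ?_
      exact h (1 + (t1 + (t2 + (t3 + 1))) + t4) (by linarith) s'
    · simp only [ho, wp_ret, Sum.elim_inr] at h ⊢
      exact h (1 + (t1 + (t2 + (t3 + 1)))) (by nlinarith) _

end Frag

/-- A time bound for the probabilistic machine. -/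
def bppTime (c d e e' n k : ℕ) : ℕ :=
  20 * (d + e + e' + 5) * (n + 3) ^ (d + e + e' + 1) +
    ((n + 2) ^ e' + 1) * (10 * (k * (n + 1) + 2) ^ 2 +
    (k + 1) * (Frag.simTime c n ((n + 2) ^ e) (n ^ d) ((k + 1) * (n + 2) ^ e) + 40 * (n + 1)) +
    2 * ((n ^ d + 1) * ((k + 1) * (n + 2) ^ e)) + 10)

/-- The machine depends on `M` and the exponents alone; the tests reach it only through the advice.
-/
theorem exists_machine_trials (M : Machine) (d e e' : ℕ) :
    ∃ M' : Machine, ∀ (x : List Bool) (l : List (List Bool × Bool)) (r : List Bool),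
      (∀ p ∈ l, p.1.length = x.length) →
      M'.HaltsWith x (encList l).reverse r
        (bppTime (Fintype.card M.K) d e e' x.length l.length)
        ((trials M (x.length ^ d) ((x.length + 2) ^ e) x l ((x.length + 2) ^ e')).run r).1 := by
  refine ⟨((Frag.prepare d e e').bind fun _ => Frag.trialsLoop M (id : M.K → M.K)).toMachine
    (.inl .inp) (.inl .rnd) (.inl .out), fun x l r hl => ?_⟩
  have key := Machine.run_toMachine ((Frag.prepare d e e').bind fun _ =>
    Frag.trialsLoop M (id : M.K → M.K)) (.inl .inp) (.inl .rnd) (.inl .out)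
    (encList l).reverse x r (T := bppTime (Fintype.card M.K) d e e' x.length l.length)
    (P := fun b _ => b = ((trials M (x.length ^ d) ((x.length + 2) ^ e) x l
      ((x.length + 2) ^ e')).run r).1) ?_
  · obtain ⟨b, h1, rfl⟩ := key
    exact h1
  · have e0 : (fun k : V ⊕ M.K => if k = .inl .inp then x else if k = .inl .rnd then r else []) =
        Mem.get ⟨x, r, [], [], [], [], [], [], [], [], [], [], [], [], [], [], [], [],
          fun _ => []⟩ := by
      ext1 k
      rcases k with k | k
      · cases k <;> simp [Mem.get]
      · simp [Mem.get]
    rw [e0, Frag.wp_bind]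
    refine Frag.wp_prepare rfl rfl rfl rfl rfl rfl fun t1 ht1 => ?_
    refine Frag.wp_trialsLoop Function.injective_id (n := x.length) (L := x.length ^ d)
      (T := (x.length + 2) ^ e) (D := (l.length + 1) * (x.length + 2) ^ e)
      (N := (x.length + 2) ^ e') hl rfl rfl rfl rfl rfl rfl rfl rfl rfl rfl rfl rfl rfl rfl rfl rfl
      rfl le_rfl fun t2 ht2 s' => ⟨rfl, ?_⟩
    rw [length_encList hl] at ht2
    dsimp only at ht1
    rw [bppTime]
    omega

end Advice

/-! ### Deciding whether an advice string is right on all inputs of a given length. -/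

namespace Advice

/-- With a complete dictionary no coin is ever tossed, so the simulator of the probabilistic machine
also runs `M` with a prescribed advice string. -/
theorem lazySim_of_lookup (M : Machine) {L : ℕ} {d : Dict L} {w : List Bool}
    (hw : w.length = 2 ^ L) (hd : ∀ i : Fin (2 ^ L), d.lookup i = w[i.1]?) (t : ℕ) (c : M.Cfg) :
    lazySim M L t c d = .ret (clocked M w t c, d) := by
  have query : ∀ i, lazyQuery L i d = .ret (w[i]?, d) := by
    intro i
    unfold lazyQuery
    split_ifs with hi
    · have h := hd ⟨i, hi⟩
      have h' : w[i]? = some (w[i]'(by omega)) := List.getElem?_eq_getElem _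
      rw [h'] at h ⊢
      simp only [h]
    · rw [List.getElem?_eq_none (by omega)]
  induction t generalizing c with
  | zero => rfl
  | succ t ih =>
    unfold lazySim clocked
    split
    · next h => rw [h]
    · next h => simp only [h, Machine.step, ih]
    · next h => simp only [h, Machine.step, ih]
    · next h =>
      simp only [h, Machine.step, query, Rnd.bind, ih]
      rfl

theorem incr_bitsOf {L j : ℕ} (hj : j < 2 ^ L) :
    (incr false (bitsOf L j)).1 = decide (j + 1 = 2 ^ L) ∧
      (j + 1 < 2 ^ L → (incr false (bitsOf L j)).2 = bitsOf L (j + 1)) := by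
  have h := val_incr_false (bitsOf L j)
  have h2 := val_lt (incr false (bitsOf L j)).2
  rw [length_incr_false, length_bitsOf] at h2
  rw [val_bitsOf hj, length_bitsOf] at h
  rcases ho : (incr false (bitsOf L j)).1 with _ | _
  · rw [ho] at h
    simp only [Bool.toNat_false, zero_mul, add_zero] at h
    refine ⟨by simp; omega, fun h3 => val_injective ?_ ?_⟩
    · rw [length_incr_false]
      simp
    · rw [h, val_bitsOf h3]
  · rw [ho] at h
    simp only [Bool.toNat_true, one_mul] at h
    exact ⟨by simp; omega, fun h3 => by omega⟩

theorem bitsOf_val (l : List Bool) : bitsOf l.length (val l) = l :=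
  val_injective (by simp) (val_bitsOf (val_lt l))

theorem bitsOf_zero (L : ℕ) : bitsOf L 0 = List.replicate L false := by
  induction L with
  | zero => rfl
  | succ L ih => simp [bitsOf, ih, List.replicate_succ]

namespace Frag

variable {κ : Type}

/-- Extends `dict` by the bits on `cnt`, whose indices start at `key`; checks if the largest index
is that of the last bit. -/
def buildLoop : Frag (V ⊕ κ) Bool :=
  iter (fun _ : Unit => (pop (.inl .cnt)).bind fun o => match o with
    | none => ret (.inr false)
    | some b => (copy (.inl .key) (.inl .tmp) (.inl .dict)).bind fun _ =>
      (push (.inl .dict) b).bind fun _ => (inc (.inl .key) (.inl .tmp) false).bind fun o =>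
        if o then (pop (.inl .cnt)).bind fun o => ret (.inr (o == none)) else ret (.inl ())) ()

/-- Stores the assignment `out` in `dict`; checks if its length is `2 ^ |width|`. -/
def build : Frag (V ⊕ κ) Bool :=
  (copy (.inl .width) (.inl .tmp) (.inl .key)).bind fun _ =>
  (copy (.inl .out) (.inl .tmp) (.inl .cnt)).bind fun _ => buildLoop.bind fun o =>
  (clear (.inl .key)).bind fun _ => (clear (.inl .cnt)).bind fun _ => ret o

/-- Checks if two machines agree on all inputs from `arg` on. -/
noncomputable def testLoop [Fintype κ] (M M' : Machine) (i : M.K → κ) (i' : M'.K → κ) :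
    Frag (V ⊕ κ) Bool :=
  iter (fun _ : Unit => (simulate M i).bind fun o => (simulateFree M' i').bind fun b =>
    if o = some b then (inc (.inl .arg) (.inl .tmp) false).bind fun o =>
      if o then ret (.inr true) else ret (.inl ())
    else ret (.inr false)) ()

/-- Checks if two machines agree on all inputs of length `|size|`. -/
noncomputable def test [Fintype κ] (M M' : Machine) (i : M.K → κ) (i' : M'.K → κ) :
    Frag (V ⊕ κ) Bool :=
  (copy (.inl .size) (.inl .tmp) (.inl .arg)).bind fun _ => (testLoop M M' i i').bind fun o =>
  (clear (.inl .arg)).bind fun _ => ret o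

variable [DecidableEq κ] {w : List Bool}

theorem wp_buildLoop {L j : ℕ} {v l : List Bool} {d : Dict L} {s : Mem κ} (hj : j < 2 ^ L)
    (hjl : j + l.length = v.length) (hl : v.drop j = l)
    (hk : s.key = bitsOf L j) (hc : s.cnt = l) (hd : s.dict = encDict d) (h1 : s.tmp = [])
    (hdv : ∀ i : Fin (2 ^ L), i.1 < j → d.lookup i = v[i.1]?)
    {P : Bool → Store (V ⊕ κ) → ℕ → Prop}
    (h : ∀ t ≤ (13 * L + 20) * (l.length + 1), ∀ key cnt (d' : Dict L), key.length = L →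
      cnt.length ≤ l.length → d'.length ≤ d.length + l.length →
      (v.length = 2 ^ L → ∀ i : Fin (2 ^ L), d'.lookup i = v[i.1]?) →
      P (decide (v.length = 2 ^ L))
        ({ s with key := key, cnt := cnt, dict := encDict d' }).get t) :
    wp w buildLoop s.get P := by
  induction l generalizing j d s P with
  | nil =>
    obtain ⟨⟩ := s
    dsimp only at *
    subst h1 hk hc hd
    have hv : v.length ≠ 2 ^ L := by simp at hjl; omega
    simp only [hv, decide_false, false_implies] at h
    rw [buildLoop, wp_iter]
    simp only [wp_bind, wp_pop, Mem.get, List.head?_nil,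
      wp_ret, Mem.update_get, Mem.set, Sum.elim_inr, List.tail_nil]
    exact h 2 (by simp) _ [] d (by simp) (by simp) (by simp) trivial
  | cons b l ih =>
    obtain ⟨⟩ := s
    dsimp only at *
    subst h1 hk hc hd
    have hvj : v[j]? = some b := by
      have : (v.drop j)[0]? = some b := by rw [hl]; rfl
      simpa using this
    have hl' : v.drop (j + 1) = l := by
      rw [← List.drop_drop, hl]
      rfl
    rw [List.length_cons] at hjl
    have hdv' : ∀ i : Fin (2 ^ L), i.1 < j + 1 →
        List.lookup i ((⟨j, hj⟩, b) :: d) = v[i.1]? := by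
      intro i hi
      rw [List.lookup_cons]
      by_cases hij : i = ⟨j, hj⟩
      · subst hij
        simpa using hvj.symm
      · have : (i == (⟨j, hj⟩, b).1) = false := by simpa using hij
        rw [this]
        refine hdv i ?_
        have : i.1 ≠ j := fun h' => hij (Fin.ext h')
        omega
    rw [buildLoop, wp_iter]
    simp only [wp_bind, wp_pop, Mem.get, List.head?_cons, Mem.update_get, Mem.set, List.tail_cons]
    refine wp_copy (by simp) (by simp) (by simp) rfl fun t1 ht1 => ?_
    simp only [wp_push, Mem.get, Mem.update_get, Mem.set, length_bitsOf] at ht1 ⊢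
    refine wp_inc (by simp) rfl fun t2 ht2 => ?_
    simp only [Mem.get, Mem.update_get, Mem.set, length_bitsOf, (incr_bitsOf hj).1] at ht2 ⊢
    by_cases hjL : j + 1 = 2 ^ L
    · simp only [hjL, decide_true, if_true, wp_bind, wp_pop, wp_ret, Sum.elim_inr, Mem.get,
        Mem.update_get, Mem.set]
      -- The index counter overflows exactly after `2 ^ L` bits; the length is then `2 ^ L` if and
      -- only if no bit is left.
      have e : (l.head? == none) = decide (v.length = 2 ^ L) := by
        rcases l with _ | ⟨x, l⟩
        · simp at hjl
          simp
          omega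
        · simp at hjl
          simp
          omega
      rw [e]
      exact h (1 + (t1 + (1 + (t2 + (1 + 1))))) (by simp; nlinarith) _ l.tail ((⟨j, hj⟩, b) :: d)
        (by simp [length_incr_false]) (by simp; omega) (by simp)
        fun _ i => hdv' i (by have := i.2; omega)
    · simp only [hjL, decide_false, Bool.false_eq_true, if_false, wp_ret, Sum.elim_inl,
        (incr_bitsOf hj).2 (show j + 1 < 2 ^ L by omega)]
      refine ih (d := (⟨j, hj⟩, b) :: d) (by omega) (by omega) hl' rfl rfl rfl rfl hdv'
        fun t3 ht3 key cnt d' h2 h3 h4 h5 => ?_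
      exact h (1 + (t1 + (1 + (t2 + 1))) + t3) (by simp; nlinarith) key cnt d' h2 (by simp; omega)
        (by simp at h4 ⊢; omega) h5

/-- Used for filling the dictionary and also as a test for the length `2 ^ L`. The contents matter
only if that length is right, but the size bound is needed in any case for the running time. -/
theorem wp_build {L : ℕ} {s : Mem κ} (hw : s.width = List.replicate L false) (h1 : s.tmp = [])
    (h2 : s.cnt = []) (h3 : s.key = []) (h4 : s.dict = [])
    {P : Bool → Store (V ⊕ κ) → ℕ → Prop}
    (h : ∀ t ≤ 40 * (L + 1) * (s.out.length + 1), ∀ d : Dict L,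
      d.length ≤ s.out.length →
      (s.out.length = 2 ^ L → ∀ i : Fin (2 ^ L), d.lookup i = s.out[i.1]?) →
      P (decide (s.out.length = 2 ^ L)) ({ s with dict := encDict d }).get t) :
    wp w build s.get P := by
  obtain ⟨⟩ := s
  dsimp only at *
  subst h1 h2 h3 h4 hw
  rename_i inp rnd out _ _ _ _ _ _ _ _ _ _ _
  simp only [build, wp_bind]
  refine wp_copy (by simp) (by simp) (by simp) rfl fun t1 ht1 => ?_
  simp only [Mem.get, Mem.update_get, Mem.set, List.append_nil, List.length_replicate] at ht1 ⊢
  refine wp_copy (by simp) (by simp) (by simp) rfl fun t2 ht2 => ?_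
  simp only [Mem.get, Mem.update_get, Mem.set, List.append_nil] at ht2 ⊢
  refine wp_buildLoop (L := L) (j := 0) (v := out) (l := out) (d := []) (by positivity) (by simp)
    (by simp) (by simp [bitsOf_zero]) rfl rfl rfl (fun i hi => by simp at hi)
    fun t3 ht3 key cnt d' h5 h6 h7 h8 => ?_
  refine wp_clear fun t4 ht4 => ?_
  simp only [Mem.get, Mem.update_get, Mem.set] at ht4 ⊢
  refine wp_clear fun t5 ht5 => ?_
  simp only [Mem.get, Mem.update_get, Mem.set, wp_ret] at ht5 ⊢
  exact h _ (by nlinarith) d' (by simpa using h7) h8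

/-- The inputs of length `n` are enumerated by counting upwards on `arg`; `m` is the number of those
still to be examined. -/
theorem wp_testLoop [Fintype κ] {M M' : Machine} {i : M.K → κ} {i' : M'.K → κ}
    (hi : Function.Injective i) (hi' : Function.Injective i') {n L T T' m : ℕ} {d : Dict L}
    {v : List Bool} (hv : v.length = 2 ^ L) (hd : ∀ i : Fin (2 ^ L), d.lookup i = v[i.1]?)
    {a : List Bool → Bool} (ha' : ∀ x : List Bool, x.length = n → M'.HaltsWith x [] [] T' (a x))
    {s : Mem κ} (hn : s.arg.length = n) (hm : val s.arg + m = 2 ^ n)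
    (hw : s.width = List.replicate L false) (htime : s.time = List.replicate T false)
    (hsd : s.dict = encDict d) (ha : s.aux = fun _ => []) (hclk : s.clk = [])
    (h1 : s.tmp = []) (h2 : s.tmp2 = []) (h3 : s.cnt = [])
    (h4 : s.key = []) (h5 : s.key2 = []) (h6 : s.dict2 = [])
    {P : Bool → Store (V ⊕ κ) → ℕ → Prop}
    (h : ∀ t ≤ (m + 1) * (simTime (Fintype.card κ) n T L (d.length + T) +
        20 * (Fintype.card κ + 1) * (n + T' + 1) + 6 * n + 10), ∀ f x,
      (f = true ↔ ∀ x : List Bool, x.length = n → val s.arg ≤ val x →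
        clocked M v T (M.init x []) = some (a x)) → x.length = n →
      P f ({ s with arg := x }).get t) :
    wp w (testLoop M M' i i') s.get P := by
  induction m generalizing s P with
  | zero =>
    have := val_lt s.arg
    rw [hn] at this
    omega
  | succ m ih =>
    obtain ⟨⟩ := s
    dsimp only at *
    subst h1 h2 h3 h4 h5 h6 hw hsd ha hclk htime hn
    rename_i inp rnd out size arg adv ctr tries
    rw [testLoop, wp_iter]
    simp only [wp_bind]
    refine wp_simulate hi (L := L) (T := T) (D := d.length + T) (d := d) rfl rfl rfl rfl rfl rfl rfl
      rfl rfl rfl rfl le_rfl fun t1 ht1 => ?_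
    rw [lazySim_of_lookup M hv hd]
    simp only [Rnd.run_ret] at ht1 ⊢
    refine wp_simulateFree hi' (T := T') (ha' arg rfl) rfl rfl fun t2 ht2 => ?_
    dsimp only at ht2
    set S := simTime (Fintype.card κ) arg.length T L (d.length + T)
    set S' := 20 * (Fintype.card κ + 1) * (arg.length + T' + 1)
    by_cases ho : clocked M v T (M.init arg []) = some (a arg)
    · simp only [ho, if_true, wp_bind]
      refine wp_inc (by simp) rfl fun t3 ht3 => ?_
      have hval : val arg < 2 ^ arg.length := val_lt arg
      have hincr := incr_bitsOf hval
      rw [bitsOf_val] at hincr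
      simp only [Mem.get, Mem.update_get, Mem.set, hincr.1] at ht3 ⊢
      by_cases hlast : val arg + 1 = 2 ^ arg.length
      · simp only [hlast, decide_true, if_true, wp_ret, Sum.elim_inr]
        refine h _ (by nlinarith) true _ ?_ (length_incr_false arg)
        simp only [true_iff]
        intro x hx hle
        have h7 : val x = val arg := by
          have := val_lt x
          rw [hx] at this
          omega
        rw [val_injective hx h7]
        exact ho
      · simp only [hlast, decide_false, Bool.false_eq_true, if_false, wp_ret, Sum.elim_inl]
        have hlt : val arg + 1 < 2 ^ arg.length := by omega
        have hval' : val (incr false arg).2 = val arg + 1 := by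
          rw [hincr.2 hlt, val_bitsOf hlt]
        refine ih (length_incr_false arg) (by rw [hval']; omega) rfl rfl rfl rfl rfl rfl rfl rfl rfl
          rfl rfl fun t4 ht4 f x hf hx => ?_
        refine h (t1 + (t2 + (t3 + 1)) + t4) (by linarith) f x ?_ hx
        rw [hf]
        constructor
        · intro h8 y hy hle
          rcases hle.eq_or_lt with h9 | h9
          · rw [← val_injective hy.symm h9]
            exact ho
          · exact h8 y hy (by rw [hval']; omega)
        · intro h8 y hy hle
          exact h8 y hy (by rw [hval'] at hle; omega)
    · simp only [ho, if_false, wp_ret, Sum.elim_inr]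
      refine h _ (by nlinarith) false arg ?_ rfl
      simp only [Bool.false_eq_true, false_iff]
      intro h8
      exact ho (h8 arg rfl le_rfl)

theorem wp_test [Fintype κ] {M M' : Machine} {i : M.K → κ} {i' : M'.K → κ}
    (hi : Function.Injective i) (hi' : Function.Injective i') {n L T T' : ℕ} {d : Dict L}
    {v : List Bool} (hv : v.length = 2 ^ L) (hd : ∀ i : Fin (2 ^ L), d.lookup i = v[i.1]?)
    {a : List Bool → Bool} (ha' : ∀ x : List Bool, x.length = n → M'.HaltsWith x [] [] T' (a x))
    {s : Mem κ} (hn : s.size = List.replicate n false) (harg : s.arg = [])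
    (hw : s.width = List.replicate L false) (htime : s.time = List.replicate T false)
    (hsd : s.dict = encDict d) (ha : s.aux = fun _ => []) (hclk : s.clk = [])
    (h1 : s.tmp = []) (h2 : s.tmp2 = []) (h3 : s.cnt = [])
    (h4 : s.key = []) (h5 : s.key2 = []) (h6 : s.dict2 = [])
    {P : Bool → Store (V ⊕ κ) → ℕ → Prop}
    (h : ∀ t ≤ (2 ^ n + 1) * (simTime (Fintype.card κ) n T L (d.length + T) +
        20 * (Fintype.card κ + 1) * (n + T' + 1) + 15 * n + 20), ∀ f,
      (f = true ↔ ∀ x : List Bool, x.length = n → clocked M v T (M.init x []) = some (a x)) →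
      P f s.get t) :
    wp w (test M M' i i') s.get P := by
  obtain ⟨⟩ := s
  dsimp only at *
  subst h1 h2 h3 h4 h5 h6 hw hsd ha hclk htime hn harg
  simp only [test, wp_bind]
  refine wp_copy (by simp) (by simp) (by simp) rfl fun t1 ht1 => ?_
  simp only [Mem.get, Mem.update_get, Mem.set, List.append_nil, List.length_replicate] at ht1 ⊢
  have hval : val (List.replicate n false) = 0 := by
    rw [← bitsOf_zero, val_bitsOf (by positivity)]
  refine wp_testLoop hi hi' (n := n) (L := L) (T := T) (m := 2 ^ n) hv hd ha' (by simp)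
    (by simp [hval]) rfl rfl rfl rfl rfl rfl rfl rfl rfl rfl rfl fun t2 ht2 f x hf hx => ?_
  refine wp_clear fun t3 ht3 => ?_
  simp only [Mem.get, Mem.update_get, Mem.set, wp_ret, hx] at ht3 ⊢
  refine h _ ?_ f ?_
  · set S := simTime (Fintype.card κ) n T L (d.length + T) + 20 * (Fintype.card κ + 1) * (n + T' + 1)
    have e1 : (2 ^ n + 1) * (S + 15 * n + 20) =
      (2 ^ n + 1) * (S + 6 * n + 10) + (2 ^ n + 1) * (9 * n + 10) := by ring
    have e2 : 9 * n + 10 ≤ (2 ^ n + 1) * (9 * n + 10) :=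
      Nat.le_mul_of_pos_left _ (Nat.succ_pos _)
    linarith
  · rw [hf, hval]
    simp

end Frag

end Advice

/-! ### Reconstruction of a good string from its rank. -/

namespace Advice

open Classical in
/-- The number of bit strings `v` of length `N` for which `G v` holds and whose numbers are between
`u` and `u'`. -/
noncomputable def rank (N : ℕ) (G : List Bool → Prop) (u u' : ℕ) : ℕ :=
  ((Finset.Ico u u').filter fun j => G (bitsOf N j)).card

section rank

variable {N : ℕ} {G : List Bool → Prop} {u u' : ℕ}

theorem rank_self : rank N G u u = 0 := by simp [rank]

theorem rank_of_pos (hu : u < u') (h : G (bitsOf N u)) :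
    rank N G u u' = rank N G (u + 1) u' + 1 := by
  classical
  rw [rank, rank, ← Finset.insert_Ico_add_one_left_eq_Ico hu, Finset.filter_insert, if_pos h,
    Finset.card_insert_of_notMem (by simp)]

theorem rank_of_neg (hu : u < u') (h : ¬ G (bitsOf N u)) :
    rank N G u u' = rank N G (u + 1) u' := by
  classical
  rw [rank, rank, ← Finset.insert_Ico_add_one_left_eq_Ico hu, Finset.filter_insert, if_neg h]

end rank

namespace Frag

variable {κ : Type}

/-- Proceeds to the next assignment. -/
def nextOut : Frag (V ⊕ κ) (Unit ⊕ Bool) :=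
  (inc (.inl .out) (.inl .tmp) false).bind fun o =>
    if o then ret (.inr false) else ret (.inl ())

/-- Enumerates the assignments from `out` on for which two machines agree on all inputs of
length `|size|`, and counts them on `adv` until there is an overflow. -/
noncomputable def enumLoop [Fintype κ] (M M' : Machine) (i : M.K → κ) (i' : M'.K → κ) :
    Frag (V ⊕ κ) Bool :=
  iter (fun _ : Unit => build.bind fun _ => (test M M' i i').bind fun g =>
    (clear (.inl .dict)).bind fun _ =>
    if g then (inc (.inl .adv) (.inl .tmp) false).bind fun o =>
      if o then ret (.inr true) else nextOut
    else nextOut) ()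

/-- Looks for a number `n`, with `|size| ≤ n < |size| + |tries|`, such that the length of `out` is
`2 ^ n ^ d`. -/
def searchLoop (d : ℕ) : Frag (V ⊕ κ) Bool :=
  iter (fun _ : Unit => (pop (.inl .tries)).bind fun o => match o with
    | none => ret (.inr false)
    | some _ => (power .width d).bind fun _ => build.bind fun o =>
      (clear (.inl .dict)).bind fun _ =>
      if o then ret (.inr true)
      else (clear (.inl .width)).bind fun _ => (push (.inl .size) false).bind fun _ =>
        ret (.inl ())) ()

/-- Reconstructs an assignment on `out` from the advice. -/
noncomputable def reconstruct [Fintype κ] (M M' : Machine) (i : M.K → κ) (i' : M'.K → κ)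
    (d e : ℕ) : Frag (V ⊕ κ) Bool :=
  (copy (.inl .inp) (.inl .tmp) (.inl .out)).bind fun _ =>
  (copy (.inl .inp) (.inl .tmp) (.inl .tries)).bind fun _ =>
  (searchLoop d).bind fun o => if o then
    (push (.inl .size) false).bind fun _ => (push (.inl .size) false).bind fun _ =>
    (power .time e).bind fun _ =>
    (pop (.inl .size)).bind fun _ => (pop (.inl .size)).bind fun _ =>
    (readAdvice (.inl .ctr) (.inl .tmp) (.inl .adv)).bind fun _ => enumLoop M M' i i'
  else ret false

variable [DecidableEq κ] {w : List Bool}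

/-- A time bound for one step of `enumLoop`. -/
def enumTime (c n T T' L N k : ℕ) : ℕ :=
  40 * (L + 1) * (N + 1) + (2 ^ n + 1) * (simTime c n T L (N + T) +
    20 * (c + 1) * (n + T' + 1) + 15 * n + 20) + 2 * ((L + 1) * N) + 6 * k + 6 * N + 20

theorem simTime_mono {c n T L D D' : ℕ} (h : D ≤ D') : simTime c n T L D ≤ simTime c n T L D' := by
  unfold simTime
  gcongr

/-- The advice is itself the counter: it is incremented at each good string, and its overflow marks
the target. So the target `u'` is described by rank plus one plus counter being `2 ^ k`. Without
such a target the output is unspecified, but the loop still ends within the bound, as the machine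
must halt on every input. -/
theorem wp_enumLoop [Fintype κ] {M M' : Machine} {i : M.K → κ} {i' : M'.K → κ}
    (hi : Function.Injective i) (hi' : Function.Injective i') {n L T T' N k m u : ℕ}
    (hN : N = 2 ^ L) {a : List Bool → Bool}
    (ha' : ∀ x : List Bool, x.length = n → M'.HaltsWith x [] [] T' (a x))
    {s : Mem κ} (hout : s.out = bitsOf N u) (hm : u + m = 2 ^ N) (hu : u < 2 ^ N)
    (hk : s.adv.length = k)
    (hn : s.size = List.replicate n false) (harg : s.arg = [])
    (hw : s.width = List.replicate L false) (htime : s.time = List.replicate T false)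
    (hd : s.dict = []) (ha : s.aux = fun _ => []) (hclk : s.clk = [])
    (h1 : s.tmp = []) (h2 : s.tmp2 = []) (h3 : s.cnt = [])
    (h4 : s.key = []) (h5 : s.key2 = []) (h6 : s.dict2 = [])
    {P : Bool → Store (V ⊕ κ) → ℕ → Prop}
    (h : ∀ t ≤ (m + 1) * enumTime (Fintype.card κ) n T T' L N k, ∀ b s',
      (∀ u', u ≤ u' → u' < 2 ^ N →
        (∀ x : List Bool, x.length = n →
          clocked M (bitsOf N u') T (M.init x []) = some (a x)) →
        rank N (fun v => ∀ x : List Bool, x.length = n →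
          clocked M v T (M.init x []) = some (a x)) u u' + 1 + val s.adv = 2 ^ k →
        s' (.inl .out) = bitsOf N u') →
      P b s' t) :
    wp w (enumLoop M M' i i') s.get P := by
  induction m generalizing u s P with
  | zero => omega
  | succ m ih =>
    obtain ⟨⟩ := s
    dsimp only at *
    subst h1 h2 h3 h4 h5 h6 hw hd ha hclk htime hn harg hout
    rename_i inp rnd adv ctr tries
    set G : List Bool → Prop := fun v => ∀ x : List Bool, x.length = n →
          clocked M v T (M.init x []) = some (a x) with hG
    rw [enumLoop, wp_iter]
    simp only [wp_bind]
    refine wp_build (L := L) rfl rfl rfl rfl rfl fun t1 ht1 d hd1 hd2 => ?_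
    simp only [length_bitsOf] at ht1 hd1 hd2
    refine wp_test hi hi' (n := n) (L := L) (T := T) (v := bitsOf N u) (by simpa using hN) (hd2 hN)
      ha' rfl rfl rfl rfl rfl rfl rfl rfl rfl rfl rfl rfl rfl fun t2 ht2 g hg => ?_
    refine wp_clear fun t3 ht3 => ?_
    simp only [Mem.get, Mem.update_get, Mem.set, length_encDict] at ht3 ⊢
    have ht2' : t2 ≤ (2 ^ n + 1) * (simTime (Fintype.card κ) n T L (N + T) +
        20 * (Fintype.card κ + 1) * (n + T' + 1) + 15 * n + 20) :=
      ht2.trans (Nat.mul_le_mul_left _ (by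
        have := simTime_mono (c := Fintype.card κ) (n := n) (T := T) (L := L)
          (Nat.add_le_add_right hd1 T)
        omega))
    have ht3' : t3 ≤ 2 * ((L + 1) * N) + 2 := ht3.trans
      (by have := Nat.mul_le_mul_left (L + 1) hd1; omega)
    -- The continuation after string number `u`, whether or not the counter has moved: the first
    -- implication passes the invariant on to `u + 1`, the second says that `u` is not the target.
    have next : ∀ (adv' : List Bool) (t : ℕ), adv'.length = k →
        t + 6 * N + 10 ≤ enumTime (Fintype.card κ) n T T' L N k →
        (∀ u', u < u' → rank N G u u' + 1 + val adv = 2 ^ k → G (bitsOf N u') →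
          rank N G (u + 1) u' + 1 + val adv' = 2 ^ k) →
        (G (bitsOf N u) → 1 + val adv ≠ 2 ^ k) →
        wp w nextOut (Mem.get (κ := κ) ⟨inp, rnd, bitsOf N u, [], [], [], List.replicate n false,
          List.replicate L false, List.replicate T false, [], [], [], [], [], [], adv', ctr, tries,
          fun _ => []⟩) fun x s' t' => Sum.elim
            (fun _ => wp w (enumLoop M M' i i') s' fun b s' t'' => P b s' (t + t' + t''))
            (fun b => P b s' (t + t')) x := by
      intro adv' t hk' ht h7 h8
      rw [nextOut, wp_bind]
      refine wp_inc (by simp) rfl fun t4 ht4 => ?_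
      simp only [Mem.get, Mem.update_get, Mem.set, length_bitsOf, (incr_bitsOf hu).1] at ht4 ⊢
      have hne : ∀ u', u ≤ u' → G (bitsOf N u') → rank N G u u' + 1 + val adv = 2 ^ k → u < u' := by
        intro u' h9 h10 h11
        refine h9.lt_of_ne ?_
        rintro rfl
        rw [rank_self, Nat.zero_add] at h11
        exact h8 h10 h11
      by_cases hlast : u + 1 = 2 ^ N
      · simp only [hlast, decide_true, if_true, wp_ret, Sum.elim_inr]
        refine h _ (by nlinarith) _ _ fun u' h9 h10 h11 h12 => ?_
        have := hne u' h9 h11 h12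
        omega
      · simp only [hlast, decide_false, Bool.false_eq_true, if_false, wp_ret, Sum.elim_inl,
          (incr_bitsOf hu).2 (show u + 1 < 2 ^ N by omega)]
        refine ih (u := u + 1) rfl (by omega) (by omega) hk' rfl rfl rfl rfl rfl rfl rfl rfl rfl rfl
          rfl rfl rfl fun t5 ht5 b s' h9 => ?_
        refine h _ (by linarith) b s' fun u' h10 h11 h12 h13 => ?_
        have := hne u' h10 h12 h13
        exact h9 u' (by omega) h11 h12 (h7 u' this h13 h12)
    by_cases hgt : g = true
    · have hGu : G (bitsOf N u) := hg.1 hgt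
      simp only [hgt, if_true, wp_bind]
      refine wp_inc (by simp) rfl fun t4 ht4 => ?_
      have hinc := incr_bitsOf (val_lt adv)
      rw [bitsOf_val] at hinc
      simp only [Mem.get, Mem.update_get, Mem.set, hinc.1, hk] at ht4 ⊢
      rw [hk] at hinc
      by_cases hov : val adv + 1 = 2 ^ k
      · simp only [hov, decide_true, if_true, wp_ret, Sum.elim_inr]
        refine h _ ?_ _ _ fun u' h9 h10 h11 h12 => ?_
        · refine le_trans ?_ (Nat.le_mul_of_pos_left _ (Nat.succ_pos _))
          rw [enumTime]
          omega
        · rcases h9.eq_or_lt with h13 | h13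
          · rw [← h13]
            rfl
          · rw [rank_of_pos h13 hGu] at h12
            omega
      · simp only [hov, decide_false, Bool.false_eq_true, if_false]
        have hlt : val adv + 1 < 2 ^ k := by
          have := val_lt adv
          rw [hk] at this
          omega
        have hval : val (incr false adv).2 = val adv + 1 := by
          rw [hinc.2 hlt, val_bitsOf hlt]
        have := next (incr false adv).2 (t1 + (t2 + (t3 + t4))) (by rw [length_incr_false, hk]) ?_ ?_
          fun _ => by omega
        · refine wp_mono this fun x s' t' h9 => ?_
          rcases x with x | x
          · simp only [Sum.elim_inl, ← add_assoc] at h9 ⊢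
            exact h9
          · simp only [Sum.elim_inr, ← add_assoc] at h9 ⊢
            exact h9
        · rw [enumTime]
          omega
        · intro u' h9 h10 h11
          rw [rank_of_pos h9 hGu] at h10
          omega
    · have hGu : ¬ G (bitsOf N u) := fun h7 => hgt (hg.2 h7)
      simp only [hgt, Bool.false_eq_true, if_false]
      have := next adv (t1 + (t2 + t3)) hk ?_ ?_ fun h7 => absurd h7 hGu
      · refine wp_mono this fun x s' t' h9 => ?_
        rcases x with x | x
        · simp only [Sum.elim_inl, ← add_assoc] at h9 ⊢
          exact h9
        · simp only [Sum.elim_inr, ← add_assoc] at h9 ⊢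
          exact h9
      · rw [enumTime]
        omega
      · intro u' h9 h10 h11
        rwa [rank_of_neg h9 hGu] at h10

/-- The machine is given only `N` and has to find `n` with `N = 2 ^ n ^ d`; the candidates are tried
in turn by the length test of `build`. -/
theorem wp_searchLoop {d n m B : ℕ} {s : Mem κ} (hn : s.size = List.replicate n false)
    (hm : s.tries = List.replicate m false) (hB : n + m ≤ B) (hw : s.width = [])
    (h1 : s.tmp = []) (h2 : s.tmp2 = []) (h3 : s.cnt = []) (h4 : s.key = []) (hd : s.dict = [])
    {P : Bool → Store (V ⊕ κ) → ℕ → Prop}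
    (h : ∀ t ≤ (m + 1) * (200 * (d + 1) * (B + 1) ^ (d + 1) * (s.out.length + 1)),
      (∀ n' tries, n' < B → s.out.length = 2 ^ n' ^ d → P true ({ s with
        size := List.replicate n' false, width := List.replicate (n' ^ d) false,
        tries := tries }).get t) ∧
      ∀ s', (∀ n', n ≤ n' → n' < n + m → s.out.length ≠ 2 ^ n' ^ d) → P false s' t) :
    wp w (searchLoop d) s.get P := by
  induction m generalizing n s P with
  | zero =>
    obtain ⟨⟩ := s
    dsimp only at *
    subst h1 h2 h3 h4 hn hm hd hw
    rw [searchLoop, wp_iter]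
    simp only [wp_bind, wp_pop, Mem.get, List.replicate_zero, List.head?_nil, wp_ret,
      Mem.update_get, Mem.set, Sum.elim_inr, List.tail_nil]
    refine (h 2 ?_).2 _ fun n' h5 h6 => by omega
    have : 0 < (d + 1) * (B + 1) ^ (d + 1) := by positivity
    nlinarith
  | succ m ih =>
    obtain ⟨⟩ := s
    dsimp only at *
    subst h1 h2 h3 h4 hn hm hd hw
    rename_i inp rnd out _ _ _ _ _ _ _ _
    rw [searchLoop, wp_iter]
    simp only [wp_bind, wp_pop, Mem.get, List.replicate_succ, List.head?_cons,
      Mem.update_get, Mem.set, List.tail_cons]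
    refine wp_power (n := n) (by simp) (by simp) (by simp) rfl rfl rfl rfl fun t1 ht1 => ?_
    simp only [Mem.set]
    refine wp_build (L := n ^ d) rfl rfl rfl rfl rfl fun t2 ht2 dict hd1 _ => ?_
    refine wp_clear fun t3 ht3 => ?_
    simp only [Mem.get, Mem.update_get, Mem.set, length_encDict] at ht2 ht3 hd1 ⊢
    have ht3' : t3 ≤ 2 * ((n ^ d + 1) * out.length) + 2 := ht3.trans
      (by have := Nat.mul_le_mul_left (n ^ d + 1) hd1; omega)
    set N := out.length
    have hnB : n + 1 ≤ B + 1 := by omega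
    have e1 : (n + 1) ^ (d + 1) ≤ (B + 1) ^ (d + 1) := Nat.pow_le_pow_left hnB _
    have e2 : n ^ d + 1 ≤ (B + 1) ^ (d + 1) + 1 := by
      refine Nat.succ_le_succ ((Nat.pow_le_pow_left (by omega : n ≤ B + 1) d).trans
        (Nat.pow_le_pow_right (by omega) (by omega)))
    set X := (B + 1) ^ (d + 1)
    have hX : 1 ≤ X := Nat.one_le_pow _ _ (by omega)
    have total : t1 + t2 + t3 + 2 * n ^ d + 10 ≤ 200 * (d + 1) * X * (N + 1) := by
      have f1 : t1 ≤ 20 * (d + 1) * X + 1 := ht1.trans (by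
        have := Nat.mul_le_mul_left (20 * (d + 1)) e1
        omega)
      have f0 : n ^ d + 1 ≤ 2 * X := by omega
      have f2 : t2 ≤ 40 * (2 * X) * (N + 1) := ht2.trans (by gcongr)
      have f3 : t3 ≤ 2 * (2 * X * N) + 2 := ht3'.trans (by gcongr)
      have f4 : X ≤ X * (N + 1) := Nat.le_mul_of_pos_right _ (Nat.succ_pos _)
      have f5 : (d + 1) * X ≤ (d + 1) * (X * (N + 1)) := Nat.mul_le_mul_left _ f4
      have f6 : 1 * (X * (N + 1)) ≤ (d + 1) * (X * (N + 1)) := Nat.mul_le_mul_right _ (by omega)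
      linarith
    by_cases hN : N = 2 ^ n ^ d
    · simp only [hN, decide_true, if_true, wp_ret, Sum.elim_inr]
      refine (h _ ?_).1 n _ (by omega) hN
      have := Nat.le_mul_of_pos_left (200 * (d + 1) * X * (N + 1)) (show 0 < m + 1 + 1 by omega)
      omega
    · simp only [hN, decide_false, Bool.false_eq_true, if_false, wp_bind]
      refine wp_clear fun t4 ht4 => ?_
      simp only [Mem.get, Mem.update_get, Mem.set, wp_push, wp_ret, Sum.elim_inl,
        List.length_replicate] at ht4 ⊢
      refine ih (n := n + 1) rfl rfl (by omega) rfl rfl rfl rfl rfl rfl fun t5 ht5 => ?_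
      change t5 ≤ (m + 1) * (200 * (d + 1) * X * (N + 1)) at ht5
      obtain ⟨h5, h6⟩ := h (1 + (t1 + (t2 + (t3 + (t4 + (1 + 1))))) + t5) (by
        have : (m + 1 + 1) * (200 * (d + 1) * X * (N + 1)) =
          (m + 1) * (200 * (d + 1) * X * (N + 1)) + 200 * (d + 1) * X * (N + 1) := by ring
        omega)
      refine ⟨h5, fun s' h7 => h6 s' fun n' h8 h9 => ?_⟩
      rcases h8.eq_or_lt with h10 | h10
      · rw [← h10]
        exact hN
      · exact h7 n' (by omega) (by omega)

/-- A time bound for `reconstruct`. -/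
def reconstructTime (c d e T' N k : ℕ) : ℕ :=
  14 * N + 20 + (N + 1) * (200 * (d + 1) * (N + 1) ^ (d + 1) * (N + 1)) +
    20 * (e + 1) * (N + 3) ^ (e + 1) + 10 * (k + 2) ^ 2 +
    (2 ^ N + 1) * enumTime c N ((N + 2) ^ e) T' (N ^ d) N k

theorem enumTime_mono {c n n' T T₁ T' L L' N k : ℕ} (hn : n ≤ n') (hT : T ≤ T₁) (hL : L ≤ L') :
    enumTime c n T T' L N k ≤ enumTime c n' T₁ T' L' N k := by
  unfold enumTime simTime
  gcongr
  norm_num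

theorem wp_reconstruct [Fintype κ] {M M' : Machine} {i : M.K → κ} {i' : M'.K → κ}
    (hi : Function.Injective i) (hi' : Function.Injective i') {d e T' N : ℕ} (hd : 0 < d)
    {a : List Bool → Bool}
    (ha' : ∀ x : List Bool, x.length ≤ N → M'.HaltsWith x [] [] T' (a x))
    {s : Mem κ} (hN : s.inp = List.replicate N false) (hout : s.out = []) (hadv : s.adv = [])
    (hn : s.size = []) (harg : s.arg = []) (hctr : s.ctr = []) (htries : s.tries = [])
    (hw : s.width = []) (htime : s.time = [])
    (hdict : s.dict = []) (ha : s.aux = fun _ => []) (hclk : s.clk = [])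
    (h1 : s.tmp = []) (h2 : s.tmp2 = []) (h3 : s.cnt = [])
    (h4 : s.key = []) (h5 : s.key2 = []) (h6 : s.dict2 = [])
    {P : Bool → Store (V ⊕ κ) → ℕ → Prop}
    (h : ∀ t ≤ reconstructTime (Fintype.card κ) d e T' N w.length, ∀ b s',
      (∀ n v, N = 2 ^ n ^ d → v.length = N →
        (∀ x : List Bool, x.length = n →
          clocked M v ((n + 2) ^ e) (M.init x []) = some (a x)) →
        rank N (fun v => ∀ x : List Bool, x.length = n →
          clocked M v ((n + 2) ^ e) (M.init x []) = some (a x)) 0 (val v) + 1 + val w.reverse =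
          2 ^ w.length →
        s' (.inl .out) = v) →
      P b s' t) :
    wp w (reconstruct M M' i i' d e) s.get P := by
  obtain ⟨⟩ := s
  dsimp only at *
  subst h1 h2 h3 h4 h5 h6 hw hdict ha hclk htime hn harg hout hadv hctr htries hN
  -- Hence a search below `N` cannot miss `n`. For `d = 0` this would fail.
  have hlt : ∀ n, n < 2 ^ n ^ d := fun n => Nat.lt_two_pow_self.trans_le
    (Nat.pow_le_pow_right (by omega) (Nat.le_self_pow hd.ne' n))
  simp only [reconstruct, wp_bind]
  refine wp_copy (by simp) (by simp) (by simp) rfl fun t1 ht1 => ?_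
  simp only [Mem.get, Mem.update_get, Mem.set, List.append_nil, List.length_replicate] at ht1 ⊢
  refine wp_copy (by simp) (by simp) (by simp) rfl fun t2 ht2 => ?_
  simp only [Mem.get, Mem.update_get, Mem.set, List.append_nil, List.length_replicate] at ht2 ⊢
  refine wp_searchLoop (n := 0) (m := N) (B := N) rfl rfl (by omega) rfl rfl rfl rfl rfl rfl
    fun t3 ht3 => ⟨fun n tries hnB hNn => ?_, fun s' hs' => ?_⟩
  · simp only [List.length_replicate] at ht3 hNn
    simp only [if_true, wp_bind, wp_push, Mem.get, Mem.update_get, Mem.set]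
    refine wp_power (n := n + 2) (by simp) (by simp) (by simp)
      (by simp [List.replicate_succ]) rfl rfl rfl fun t4 ht4 => ?_
    simp only [wp_pop, Mem.get, Mem.update_get, Mem.set, List.tail_cons]
    refine wp_readAdvice (by simp) (by simp) (by simp) rfl rfl fun t5 ht5 => ?_
    simp only [Mem.get, Mem.update_get, Mem.set, List.append_nil]
    -- The copy of the input on `out` consists of `N` zeros and so is already string number 0, where
    -- the enumeration starts.
    refine wp_enumLoop hi hi' (n := n) (L := n ^ d) (T := (n + 2) ^ e) (T' := T') (N := N)
      (k := w.length) (m := 2 ^ N) (u := 0) hNn (fun x hx => ha' x (by omega)) (bitsOf_zero N).symm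
      (by simp) (by positivity) (by simp) rfl rfl rfl rfl rfl rfl rfl rfl rfl rfl rfl rfl rfl
      fun t6 ht6 b s' hs' => ?_
    refine h _ ?_ b s' fun n' v hn' hv hgood hrank => ?_
    · have e1 : t6 ≤ (2 ^ N + 1) * enumTime (Fintype.card κ) N ((N + 2) ^ e) T' (N ^ d) N w.length :=
        ht6.trans (Nat.mul_le_mul_left _ (enumTime_mono hnB.le
          (Nat.pow_le_pow_left (by omega) _) (Nat.pow_le_pow_left hnB.le _)))
      have e2 : t4 ≤ 20 * (e + 1) * (N + 3) ^ (e + 1) + 1 := ht4.trans (by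
        have : (n + 2 + 1) ^ (e + 1) ≤ (N + 3) ^ (e + 1) := Nat.pow_le_pow_left (by omega) _
        gcongr)
      rw [reconstructTime]
      omega
    · have hnn : n = n' := by
        have := Nat.pow_right_injective le_rfl (hNn.symm.trans hn')
        exact Nat.pow_left_injective (by omega) this
      subst hnn
      have hbv : bitsOf N (val v) = v := by
        rw [← hv]
        exact bitsOf_val v
      rw [← hbv]
      refine hs' (val v) (by omega) (by rw [← hv]; exact val_lt v) (by rwa [hbv]) hrank
  · simp only [List.length_replicate] at ht3 hs'
    simp only [Bool.false_eq_true, if_false, wp_ret]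
    refine h _ ?_ _ _ fun n v hn => ?_
    · rw [reconstructTime]
      omega
    · refine absurd hn (hs' n (by omega) ?_)
      have := hlt n
      omega

end Frag

theorem exists_machine_reconstruct (M M' : Machine) (d e : ℕ) (hd : 0 < d) :
    ∃ (M₁ : Machine) (c : ℕ), ∀ (a : List Bool → Bool) (w : List Bool) (T' N : ℕ),
      (∀ x : List Bool, x.length ≤ N → M'.HaltsWith x [] [] T' (a x)) →
      ∃ y, M₁.Outputs (List.replicate N false) w (Frag.reconstructTime c d e T' N w.length) y ∧
        ∀ n v, N = 2 ^ n ^ d → v.length = N →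
        (∀ x : List Bool, x.length = n →
          clocked M v ((n + 2) ^ e) (M.init x []) = some (a x)) →
        rank N (fun v => ∀ x : List Bool, x.length = n →
          clocked M v ((n + 2) ^ e) (M.init x []) = some (a x)) 0 (val v) + 1 + val w.reverse =
          2 ^ w.length → y = v := by
  refine ⟨(Frag.reconstruct M M' (Sum.inl : M.K → M.K ⊕ M'.K) Sum.inr d e).toMachine
    (.inl .inp) (.inl .rnd) (.inl .out), Fintype.card (M.K ⊕ M'.K), fun a w T' N ha => ?_⟩
  obtain ⟨b, h1, h2⟩ := Machine.run_toMachine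
    (Frag.reconstruct M M' (Sum.inl : M.K → M.K ⊕ M'.K) Sum.inr d e)
    (.inl .inp) (.inl .rnd) (.inl .out) w (List.replicate N false) []
    (T := Frag.reconstructTime (Fintype.card (M.K ⊕ M'.K)) d e T' N w.length)
    (P := fun _ s' => ∀ n v, N = 2 ^ n ^ d → v.length = N →
        (∀ x : List Bool, x.length = n →
          clocked M v ((n + 2) ^ e) (M.init x []) = some (a x)) →
        rank N (fun v => ∀ x : List Bool, x.length = n →
          clocked M v ((n + 2) ^ e) (M.init x []) = some (a x)) 0 (val v) + 1 + val w.reverse =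
          2 ^ w.length → s' (.inl .out) = v) (by
      have e0 : (fun k : V ⊕ (M.K ⊕ M'.K) => if k = .inl .inp then List.replicate N false else
          if k = .inl .rnd then [] else []) =
          Mem.get ⟨List.replicate N false, [], [], [], [], [], [], [], [], [], [], [], [], [], [],
            [], [], [], fun _ => []⟩ := by
        ext1 k
        rcases k with k | k
        · cases k <;> simp [Mem.get]
        · simp [Mem.get]
      rw [e0]
      exact Frag.wp_reconstruct Sum.inl_injective Sum.inr_injective hd ha rfl rfl rfl rfl rfl rfl
        rfl rfl rfl rfl rfl rfl rfl rfl rfl rfl rfl rfl fun t ht b s' hs' => ⟨hs', ht⟩)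
  exact ⟨_, ⟨⟨b, h1⟩, rfl⟩, h2⟩

end Advice

namespace Advice

/-! ### Polynomial and exponential bounds -/

/-- `f` is bounded by a polynomial. -/
def PolyBdd (f : ℕ → ℕ) : Prop := ∃ p : Polynomial ℕ, ∀ n, f n ≤ p.eval n

namespace PolyBdd

variable {f g : ℕ → ℕ}

theorem const (c : ℕ) : PolyBdd fun _ => c := ⟨.C c, by simp⟩

theorem id : PolyBdd fun n => n := ⟨.X, by simp⟩

theorem add (hf : PolyBdd f) (hg : PolyBdd g) : PolyBdd fun n => f n + g n := by
  obtain ⟨p, hp⟩ := hf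
  obtain ⟨q, hq⟩ := hg
  exact ⟨p + q, fun n => by simpa using Nat.add_le_add (hp n) (hq n)⟩

theorem mul (hf : PolyBdd f) (hg : PolyBdd g) : PolyBdd fun n => f n * g n := by
  obtain ⟨p, hp⟩ := hf
  obtain ⟨q, hq⟩ := hg
  exact ⟨p * q, fun n => by simpa using Nat.mul_le_mul (hp n) (hq n)⟩

theorem pow (hf : PolyBdd f) (e : ℕ) : PolyBdd fun n => f n ^ e := by
  obtain ⟨p, hp⟩ := hf
  exact ⟨p ^ e, fun n => by simpa using Nat.pow_le_pow_left (hp n) e⟩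

end PolyBdd

/-- `f` is bounded by `2 ^ p(n)` for a polynomial `p`. -/
def ExpBdd (f : ℕ → ℕ) : Prop := ∃ p : Polynomial ℕ, ∀ n, f n ≤ 2 ^ p.eval n

namespace ExpBdd

variable {f g : ℕ → ℕ}

theorem two_pow (hf : PolyBdd f) : ExpBdd fun n => 2 ^ f n := by
  obtain ⟨p, hp⟩ := hf
  exact ⟨p, fun n => Nat.pow_le_pow_right two_pos (hp n)⟩

theorem const (c : ℕ) : ExpBdd fun _ => c := ⟨.C c, by simpa using Nat.lt_two_pow_self.le⟩

theorem id : ExpBdd fun n => n := ⟨.X, fun n => by simpa using Nat.lt_two_pow_self.le⟩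

theorem add (hf : ExpBdd f) (hg : ExpBdd g) : ExpBdd fun n => f n + g n := by
  obtain ⟨p, hp⟩ := hf
  obtain ⟨q, hq⟩ := hg
  refine ⟨p + q + 1, fun n => (Nat.add_le_add (hp n) (hq n)).trans ?_⟩
  simp only [Polynomial.eval_add, Polynomial.eval_one, pow_succ, pow_add]
  have h1 : 1 ≤ 2 ^ p.eval n := Nat.one_le_two_pow
  have h2 : 1 ≤ 2 ^ q.eval n := Nat.one_le_two_pow
  nlinarith

theorem mul (hf : ExpBdd f) (hg : ExpBdd g) : ExpBdd fun n => f n * g n := by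
  obtain ⟨p, hp⟩ := hf
  obtain ⟨q, hq⟩ := hg
  exact ⟨p + q, fun n => by simpa [pow_add] using Nat.mul_le_mul (hp n) (hq n)⟩

theorem pow (hf : ExpBdd f) (e : ℕ) : ExpBdd fun n => f n ^ e := by
  obtain ⟨p, hp⟩ := hf
  exact ⟨p * .C e, fun n => by simpa [pow_mul] using Nat.pow_le_pow_left (hp n) e⟩

end ExpBdd

/-- Strict, to leave the extra clock unit required by `clocked_of_halt`. -/
theorem exists_eval_lt_pow (p : Polynomial ℕ) : ∃ e, ∀ n, p.eval n < (n + 2) ^ e := by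
  induction p using Polynomial.induction_on' with
  | add p q hp hq =>
    obtain ⟨a, ha⟩ := hp
    obtain ⟨b, hb⟩ := hq
    refine ⟨a + b + 1, fun n => ?_⟩
    have h1 : (n + 2) ^ a ≤ (n + 2) ^ (a + b) := Nat.pow_le_pow_right (by omega) (by omega)
    have h2 : (n + 2) ^ b ≤ (n + 2) ^ (a + b) := Nat.pow_le_pow_right (by omega) (by omega)
    have h3 : (n + 2) ^ (a + b) * 2 ≤ (n + 2) ^ (a + b) * (n + 2) :=
      Nat.mul_le_mul_left _ (by omega)
    rw [Polynomial.eval_add, pow_succ]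
    have := ha n
    have := hb n
    omega
  | monomial k c =>
    refine ⟨c + k, fun n => ?_⟩
    rw [Polynomial.eval_monomial, pow_add]
    have h1 : c < (n + 2) ^ c :=
      Nat.lt_two_pow_self.trans_le (Nat.pow_le_pow_left (by omega) c)
    calc c * n ^ k ≤ c * (n + 2) ^ k := Nat.mul_le_mul_left _ (Nat.pow_le_pow_left (by omega) k)
      _ < (n + 2) ^ c * (n + 2) ^ k := Nat.mul_lt_mul_of_pos_right h1 (by positivity)

namespace Machine

variable {M : Machine} {x w r : List Bool} {t t' : ℕ} {b : Bool}

theorem HaltsWith.run_eq (h : M.HaltsWith x w r t b) (ht : t ≤ t') :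
    M.run x w r t' = M.run x w r t := by
  obtain ⟨u, rfl⟩ := Nat.exists_eq_add_of_le' ht
  rw [run, Function.iterate_add_apply]
  exact M.iterate_step_of_halt w h u

theorem HaltsWith.mono (h : M.HaltsWith x w r t b) (ht : t ≤ t') : M.HaltsWith x w r t' b := by
  rw [HaltsWith, h.run_eq ht]
  exact h

theorem Outputs.mono {y : List Bool} (h : M.Outputs x w t y) (ht : t ≤ t') :
    M.Outputs x w t' y := by
  obtain ⟨⟨b, hb⟩, hy⟩ := h
  exact ⟨⟨b, hb.mono ht⟩, by rw [hb.run_eq ht, hy]⟩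

end Machine

theorem polyBdd_bppTime (c d e e' : ℕ) {k : ℕ → ℕ} (hk : PolyBdd k) :
    PolyBdd fun n => bppTime c d e e' n (k n) := by
  unfold bppTime Frag.simTime
  repeat' first | exact hk | exact .const _ | exact .id | apply PolyBdd.add | apply PolyBdd.mul |
    apply PolyBdd.pow

theorem bppTime_mono {c d e e' n k k' : ℕ} (h : k ≤ k') :
    bppTime c d e e' n k ≤ bppTime c d e e' n k' := by
  unfold bppTime Frag.simTime
  gcongr

theorem expBdd_reconstructTime (c d e : ℕ) {T : ℕ → ℕ} (hT : ExpBdd T) :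
    ExpBdd fun N => Frag.reconstructTime c d e (T N) N N := by
  unfold Frag.reconstructTime Frag.enumTime Frag.simTime
  repeat' first | exact hT | exact .const _ | exact .id | apply ExpBdd.add | apply ExpBdd.mul |
    exact .two_pow .id | apply ExpBdd.pow

theorem reconstructTime_mono {c d e T N k k' : ℕ} (h : k ≤ k') :
    Frag.reconstructTime c d e T N k ≤ Frag.reconstructTime c d e T N k' := by
  unfold Frag.reconstructTime Frag.enumTime
  gcongr

/-! ### The number of good advice strings -/

/-- The `+ 1` is `v` itself, which is good and is not counted in its own rank. -/
theorem rank_lt_card {N : ℕ} {G : List Bool → Prop} {v : List Bool} (hv : v.length = N)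
    (hG : G v) : rank N G 0 (val v) + 1 ≤ Nat.card {w : Fin N → Bool // G (List.ofFn w)} := by
  classical
  subst hv
  have h1 : rank v.length G 0 (val v) + 1 =
      ((Finset.range (val v + 1)).filter fun j => G (bitsOf v.length j)).card := by
    rw [Finset.range_add_one, Finset.filter_insert, if_pos (by rwa [bitsOf_val]),
      Finset.card_insert_of_notMem (by simp), rank, ← Finset.range_eq_Ico]
  have hof : ∀ j, List.ofFn (fun i : Fin v.length =>
      (bitsOf v.length j)[(i : ℕ)]'(by simp)) = bitsOf v.length j := fun j => by
    apply List.ext_getElem <;> simp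
  rw [h1, ← Nat.card_eq_finsetCard]
  refine Nat.card_le_card_of_injective (fun j => ⟨fun i => (bitsOf v.length j)[(i : ℕ)]'(by simp),
    by rw [hof]; exact (Finset.mem_filter.1 j.2).2⟩) fun j j' h => ?_
  have hlt : ∀ j : {j // j ∈ (Finset.range (val v + 1)).filter fun j => G (bitsOf v.length j)},
      (j : ℕ) < 2 ^ v.length := fun j => by
    have := Finset.mem_range.1 (Finset.mem_filter.1 j.2).1
    have := val_lt v
    omega
  refine Subtype.ext (bitsOf_injective (hlt j) (hlt j') ?_)
  rw [← hof j, ← hof j']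
  exact congrArg (fun w => List.ofFn w.1) h

section density

variable {α : ℕ → List Bool} {M M' : Machine} {d e eA : ℕ} {a : List Bool → Bool}

/-- The advice string `v` makes `M` answer correctly on all inputs of length `n`. -/
def Good (M : Machine) (e : ℕ) (a : List Bool → Bool) (n : ℕ) (v : List Bool) : Prop :=
  ∀ x : List Bool, x.length = n → clocked M v ((n + 2) ^ e) (M.init x []) = some (a x)

theorem pow_pow_injective (hd : 0 < d) : Function.Injective fun n : ℕ => 2 ^ n ^ d :=
  (Nat.pow_right_injective le_rfl).comp (Nat.pow_left_injective hd.ne')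

/-- Compression: among at most `2 ^ f(N)` good strings the rank of `α N` fits into `f(N)` bits, and
`exists_machine_reconstruct` recovers `α N` in time `2 ^ poly(N)`. If this happened for infinitely
many `n`, it would put `α` into the class excluded by hardness. The condition `f(N) ≤ N` only keeps
the reading time of the advice under control. -/
theorem finite_setOf_card_good_le (hlen : ∀ n, (α n).length = n) {f : ℕ → ℕ}
    (hhard : α ∉ InfinitelyOften (UnaryFunEXPAdvice f)) (hd : 0 < d)
    (hM' : ∀ x : List Bool, M'.HaltsWith x [] [] (2 ^ (x.length + 2) ^ eA) (a x))
    (hα : ∀ n, Good M e a n (α (2 ^ n ^ d))) :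
    {n | Nat.card {w : Fin (2 ^ n ^ d) → Bool // Good M e a n (List.ofFn w)} ≤ 2 ^ f (2 ^ n ^ d) ∧
      f (2 ^ n ^ d) ≤ 2 ^ n ^ d}.Finite := by
  by_contra hS
  change Set.Infinite _ at hS
  set S := {n | Nat.card {w : Fin (2 ^ n ^ d) → Bool // Good M e a n (List.ofFn w)} ≤
    2 ^ f (2 ^ n ^ d) ∧ f (2 ^ n ^ d) ≤ 2 ^ n ^ d} with hSdef
  have hβ : ∀ N, ∃ b : List Bool, b.length ≤ f N ∧ b.length ≤ N ∧ ∀ n ∈ S, N = 2 ^ n ^ d →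
      rank N (Good M e a n) 0 (val (α N)) + 1 + val b.reverse = 2 ^ b.length := by
    intro N
    by_cases h : ∃ n ∈ S, N = 2 ^ n ^ d
    · obtain ⟨n, hn, rfl⟩ := h
      have h1 := (rank_lt_card (hlen (2 ^ n ^ d)) (hα n)).trans hn.1
      refine ⟨(bitsOf (f (2 ^ n ^ d))
        -- The counter value that overflows exactly at `α N`.
        (2 ^ f (2 ^ n ^ d) - 1 - rank (2 ^ n ^ d) (Good M e a n) 0 (val (α (2 ^ n ^ d))))).reverse,
        by simp, by simpa using hn.2, fun m hm hmn => ?_⟩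
      obtain rfl := pow_pow_injective hd hmn
      rw [List.reverse_reverse, List.length_reverse, length_bitsOf, val_bitsOf (by omega)]
      omega
    · exact ⟨[], by simp, by simp, fun n hn hN => absurd ⟨n, hn, hN⟩ h⟩
  choose β hβf hβN hβr using hβ
  obtain ⟨M₁, c, hM₁⟩ := exists_machine_reconstruct M M' d e hd
  obtain ⟨p, hp⟩ := expBdd_reconstructTime c d e (T := fun N => 2 ^ (N + 2) ^ eA)
    (.two_pow ((PolyBdd.id.add (.const 2)).pow eA))
  have hg : ∀ N, ∃ y, M₁.Outputs (List.replicate N false) (β N) (2 ^ p.eval N) y ∧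
      ∀ n ∈ S, N = 2 ^ n ^ d → α N = y := by
    intro N
    obtain ⟨y, hy, hyα⟩ := hM₁ a (β N) (2 ^ (N + 2) ^ eA) N fun x hx => (hM' x).mono (by
      gcongr
      · norm_num)
    refine ⟨y, hy.mono ((reconstructTime_mono (hβN N)).trans (hp N)), fun n hn hN => ?_⟩
    exact (hyα n (α N) hN (hlen N) (hN ▸ hα n) (hβr N n hn hN)).symm
  choose g hg hgα using hg
  refine hhard ⟨g, ⟨β, hβf, M₁, p, hg⟩, ?_⟩
  refine (hS.image (pow_pow_injective hd).injOn).mono ?_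
  rintro N ⟨n, hn, rfl⟩
  exact hgα _ n hn rfl

theorem exists_pow_mul_card_good (hlen : ∀ n, (α n).length = n) {c : ℝ} (hc : 0 < c)
    (hhard : α ∉ InfinitelyOften (UnaryFunEXPAdvice
      (fun n => ⌊(n : ℝ) - c * Real.logb 2 (Real.logb 2 n)⌋₊))) (hd : 0 < d)
    (hM' : ∀ x : List Bool, M'.HaltsWith x [] [] (2 ^ (x.length + 2) ^ eA) (a x))
    (hα : ∀ n, Good M e a n (α (2 ^ n ^ d))) :
    ∃ X, ∀ n, 2 ^ 2 ^ n ^ d ≤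
      (n + 2) ^ X * Nat.card {w : Fin (2 ^ n ^ d) → Bool // Good M e a n (List.ofFn w)} := by
  have hfin := finite_setOf_card_good_le hlen hhard hd hM' hα
  -- The summand `c * d` comes from `c log log N = c * d * log n`; the summand 1 pays for rounding
  -- down, since `log (n + 2) ≥ 1`.
  obtain ⟨E, hE⟩ := exists_nat_ge (c * d + 1)
  -- The sum takes care of the finitely many exceptional `n`: there `(n + 2) ^ 2 ^ n ^ d ≥ 2 ^ 2 ^ n
  -- ^ d`, and at least one string is good.
  refine ⟨E + ∑ n ∈ hfin.toFinset, 2 ^ n ^ d, fun n => ?_⟩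
  have hpos : 0 < Nat.card {w : Fin (2 ^ n ^ d) → Bool // Good M e a n (List.ofFn w)} :=
    (Nat.succ_pos _).trans_le (rank_lt_card (hlen _) (hα n))
  by_cases hn : n ∈ hfin.toFinset
  · refine le_trans ?_ (Nat.le_mul_of_pos_right _ hpos)
    have := Finset.single_le_sum (f := fun n => 2 ^ n ^ d) (fun _ _ => Nat.zero_le _) hn
    exact (Nat.pow_le_pow_left (by omega) _).trans (Nat.pow_le_pow_right (by omega)
      (this.trans (Nat.le_add_left _ _)))
  refine le_trans ?_ (Nat.mul_le_mul_right _ (Nat.pow_le_pow_right (by omega) (Nat.le_add_right E _)))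
  by_contra! hlt
  simp only [Set.Finite.mem_toFinset, Set.mem_ofPred_eq] at hn
  -- At `n = 0` both sides vanish, because `Real.logb 2 0 = 0`.
  have hlog : Real.logb 2 (Real.logb 2 ((2 ^ n ^ d : ℕ) : ℝ)) = d * Real.logb 2 n := by
    rw [Nat.cast_pow, Nat.cast_ofNat, Real.logb_pow, Real.logb_self_eq_one one_lt_two, mul_one,
      Nat.cast_pow, Real.logb_pow]
  rw [hlog] at hn
  set m := ⌊((2 ^ n ^ d : ℕ) : ℝ) - c * (d * Real.logb 2 n)⌋₊
  have h0 : 0 ≤ Real.logb 2 n := by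
    rcases n.eq_zero_or_pos with rfl | h
    · simp
    · exact Real.logb_nonneg one_lt_two (by exact_mod_cast h)
  have h1 : Real.logb 2 n ≤ Real.logb 2 (n + 2) := by
    rcases n.eq_zero_or_pos with rfl | h
    · simp
    · exact Real.logb_le_logb_of_le one_lt_two (by exact_mod_cast h) (by linarith)
  have h2 : 1 ≤ Real.logb 2 (n + 2) := by
    rw [Real.le_logb_iff_rpow_le one_lt_two (by positivity)]
    simp
  have hm : m ≤ 2 ^ n ^ d := Nat.floor_le_of_le (by
    have : 0 ≤ c * (d * Real.logb 2 n) := by positivity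
    linarith)
  have hm' : 2 ^ m < Nat.card {w : Fin (2 ^ n ^ d) → Bool // Good M e a n (List.ofFn w)} := by
    by_contra! h
    exact hn ⟨h, hm⟩
  have h3 : ((n + 2 : ℕ) : ℝ) ^ E * 2 ^ m ≤ 2 ^ 2 ^ n ^ d := by
    exact_mod_cast (Nat.mul_le_mul_left _ hm'.le).trans hlt.le
  have h4 := Real.logb_le_logb_of_le one_lt_two (by positivity) h3
  rw [Real.logb_mul (by positivity) (by positivity), Real.logb_pow, Real.logb_pow, Real.logb_pow,
    Real.logb_self_eq_one one_lt_two] at h4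
  have h5 := Nat.lt_floor_add_one (((2 ^ n ^ d : ℕ) : ℝ) - c * (d * Real.logb 2 n))
  change _ < (m : ℝ) + 1 at h5
  push_cast at h4 h5
  have h6 : (c * d + 1) * Real.logb 2 (n + 2) ≤ E * Real.logb 2 (n + 2) :=
    mul_le_mul_of_nonneg_right hE (by linarith)
  have h7 : c * d * Real.logb 2 n ≤ c * d * Real.logb 2 (n + 2) :=
    mul_le_mul_of_nonneg_left h1 (by positivity)
  linarith

end density

/-! ### The advice of the probabilistic machine -/

/-- The greedy choice applied to the inputs of length `n`. All good strings survive, so the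
survivors make up at least the fraction `1 / X`, which caps `(4/3) ^ l.length` by `X`. -/
theorem exists_test_list {M : Machine} {e L X n : ℕ} {a : List Bool → Bool}
    (hX : 2 ^ 2 ^ L ≤ X * Nat.card {w : Fin (2 ^ L) → Bool // Good M e a n (List.ofFn w)}) :
    ∃ l : List (List Bool × Bool), (∀ p ∈ l, p.1.length = n) ∧ (4 / 3 : ℝ) ^ l.length ≤ X ∧
      2 ^ 2 ^ L ≤ X * Nat.card {w : Fin (2 ^ L) → Bool // ∀ p ∈ l,
        clocked M (List.ofFn w) ((n + 2) ^ e) (M.init p.1 []) = some p.2} ∧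
      ∀ x : List Bool, x.length = n →
        3 / 4 * (Nat.card {w : Fin (2 ^ L) → Bool // ∀ p ∈ l,
          clocked M (List.ofFn w) ((n + 2) ^ e) (M.init p.1 []) = some p.2} : ℝ) ≤
        Nat.card {w : Fin (2 ^ L) → Bool // (∀ p ∈ l,
          clocked M (List.ofFn w) ((n + 2) ^ e) (M.init p.1 []) = some p.2) ∧
          clocked M (List.ofFn w) ((n + 2) ^ e) (M.init x []) = some (a x)} := by
  have hne : Nonempty {w : Fin (2 ^ L) → Bool // Good M e a n (List.ofFn w)} := by
    by_contra h
    rw [not_nonempty_iff] at h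
    rw [Nat.card_of_isEmpty, mul_zero] at hX
    exact absurd hX (Nat.not_le.2 (Nat.two_pow_pos _))
  obtain ⟨w₀, hw₀⟩ := hne
  obtain ⟨l, hl1, hl2⟩ := exists_list_of_forall
    (fun (x : {x : List Bool // x.length = n}) (w : Fin (2 ^ L) → Bool) =>
      clocked M (List.ofFn w) ((n + 2) ^ e) (M.init x []) = some (a x)) (w₀ := w₀)
    fun x => hw₀ x x.2
  have key : ∀ w : Fin (2 ^ L) → Bool,
      (∀ p ∈ l.map fun x : {x : List Bool // x.length = n} => ((x : List Bool), a x),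
        clocked M (List.ofFn w) ((n + 2) ^ e) (M.init p.1 []) = some p.2) ↔
      ∀ y ∈ l, clocked M (List.ofFn w) ((n + 2) ^ e) (M.init y []) = some (a y) := fun w =>
    List.forall_mem_map
  have hle : Nat.card {w : Fin (2 ^ L) → Bool // Good M e a n (List.ofFn w)} ≤
      Nat.card {w : Fin (2 ^ L) → Bool //
        ∀ y ∈ l, clocked M (List.ofFn w) ((n + 2) ^ e) (M.init y []) = some (a y)} :=
    Nat.card_le_card_of_injective (fun w => ⟨w.1, fun y _ => w.2 y y.2⟩)
      fun w w' h => Subtype.ext (congrArg Subtype.val h :)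
  have hX' := hX.trans (Nat.mul_le_mul_left X hle)
  refine ⟨l.map fun x : {x : List Bool // x.length = n} => ((x : List Bool), a x), ?_, ?_, ?_, fun x hx => ?_⟩
  · simp only [List.mem_map]
    rintro _ ⟨y, -, rfl⟩
    exact y.2
  · rw [List.length_map]
    rw [Nat.card_eq_fintype_card (α := Fin (2 ^ L) → Bool), Fintype.card_fun, Fintype.card_bool,
      Fintype.card_fin] at hl2
    have h1 := hl2.trans (Nat.cast_le.2 hX')
    rw [Nat.cast_mul] at h1
    rw [mul_comm] at h1
    refine le_of_mul_le_mul_right h1 ?_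
    refine lt_of_lt_of_le ?_ (Nat.cast_le.2 hle)
    have : Nonempty {w : Fin (2 ^ L) → Bool // Good M e a n (List.ofFn w)} := ⟨⟨w₀, hw₀⟩⟩
    exact_mod_cast Nat.card_pos
  · simpa only [key] using hX'
  · simpa only [key] using hl1 ⟨x, hx⟩

/-- Because `(4/3) ^ 3 = 64/27 ≥ 2`. -/
theorem two_pow_le_of_pow_le {k n E : ℕ} (h : (4 / 3 : ℝ) ^ k ≤ ((n + 2) ^ E : ℕ)) :
    2 ^ k ≤ (n + 2) ^ (3 * E) := by
  have h1 : (2 : ℝ) ^ k ≤ ((4 / 3 : ℝ) ^ k) ^ 3 := by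
    rw [← pow_mul, mul_comm, pow_mul]
    exact pow_le_pow_left₀ (by norm_num) (by norm_num) k
  have h2 := h1.trans (pow_le_pow_left₀ (by positivity) h 3)
  rw [mul_comm, pow_mul]
  exact_mod_cast h2

theorem isBigO_mul_logb {k : ℕ → ℕ} {E : ℕ} (h : ∀ n, 2 ^ k n ≤ (n + 2) ^ E) :
    (fun n => ((k n * (n + 1) : ℕ) : ℝ)) =O[Filter.atTop]
      fun n : ℕ => (n : ℝ) * Real.logb 2 n := by
  -- For `n ≥ 2` there are two losses of a factor 2: `n + 2 ≤ n ^ 2` inside the logarithm, and `n +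
  -- 1 ≤ 2 * n`.
  refine Asymptotics.IsBigO.of_bound (4 * E) (Filter.eventually_atTop.2 ⟨2, fun n hn => ?_⟩)
  have hn' : (2 : ℝ) ≤ n := by exact_mod_cast hn
  have h0 : 0 ≤ Real.logb 2 n := Real.logb_nonneg one_lt_two (by linarith)
  have h1 : (2 : ℝ) ^ k n ≤ (n + 2) ^ E := by exact_mod_cast h n
  have h2 := Real.logb_le_logb_of_le one_lt_two (by positivity) h1
  rw [Real.logb_pow, Real.logb_pow, Real.logb_self_eq_one one_lt_two, mul_one] at h2
  have h3 : Real.logb 2 (n + 2) ≤ 2 * Real.logb 2 n := by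
    have : Real.logb 2 ((n : ℝ) ^ 2) = 2 * Real.logb 2 n := by simp [Real.logb_pow]
    rw [← this]
    exact Real.logb_le_logb_of_le one_lt_two (by positivity) (by nlinarith)
  have h4 : (k n : ℝ) ≤ E * (2 * Real.logb 2 n) :=
    h2.trans (mul_le_mul_of_nonneg_left h3 (by positivity))
  rw [Real.norm_of_nonneg (by positivity), Real.norm_of_nonneg (by positivity)]
  push_cast
  calc (k n : ℝ) * (n + 1) ≤ E * (2 * Real.logb 2 n) * (2 * n) := by
        gcongr
        linarith
    _ = 4 * E * (n * Real.logb 2 n) := by ring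

theorem mem_bppAdviceBigO
    (α : ℕ → List Bool) (hlen : ∀ n, (α n).length = n)
    (c : ℝ) (hc : 0 < c)
    (hhard : α ∉ InfinitelyOften (UnaryFunEXPAdvice
      (fun n => ⌊(n : ℝ) - c * Real.logb 2 (Real.logb 2 n)⌋₊)))
    (A : Language Bool) (hA : A ∈ EXP)
    (d : ℕ) (hd : 0 < d)
    (hAα : A ∈ PAdvice (fun n => α (2 ^ n ^ d))) :
    A ∈ BPPAdviceBigO (fun n => (n : ℝ) * Real.logb 2 n) := by
  classical
  obtain ⟨M', pA, hM'⟩ := hA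
  obtain ⟨M, p, hM⟩ := hAα
  obtain ⟨eA, heA⟩ := exists_eval_lt_pow pA
  obtain ⟨e, he⟩ := exists_eval_lt_pow p
  have ha : ∀ {b : Bool} {x : List Bool}, (b = true ↔ x ∈ A) ↔ b = decide (x ∈ A) := by
    intro b x
    cases b <;> simp
  set a : List Bool → Bool := fun x => decide (x ∈ A) with hadef
  have hM₁ : ∀ x : List Bool, M'.HaltsWith x [] [] (2 ^ (x.length + 2) ^ eA) (a x) := fun x => by
    obtain ⟨b, hb, hbA⟩ := hM' x
    rw [ha] at hbA
    rw [← show b = a x from hbA]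
    exact hb.mono (Nat.pow_le_pow_right two_pos (heA _).le)
  have hα : ∀ n, Good M e a n (α (2 ^ n ^ d)) := by
    rintro n x rfl
    obtain ⟨b, hb, hbA⟩ := hM x
    rw [ha] at hbA
    rw [← show b = a x from hbA]
    exact clocked_of_halt M (he _) hb
  obtain ⟨E, hE⟩ := exists_pow_mul_card_good hlen hc hhard hd hM₁ hα
  choose l hln hlX hl hlx using fun n => exists_test_list (hE n)
  have hk : ∀ n, 2 ^ (l n).length ≤ (n + 2) ^ (3 * E) := fun n => two_pow_le_of_pow_le (hlX n)
  have hk' : ∀ n, (l n).length ≤ (n + 2) ^ (3 * E) := fun n => Nat.lt_two_pow_self.le.trans (hk n)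
  -- The three extra factors `n + 2` supply the constant 8 of `two_thirds_le`.
  obtain ⟨M₂, hM₂⟩ := exists_machine_trials M d e (E + 3)
  have hpoly : ∀ E, PolyBdd fun n => (n + 2) ^ E := fun E => (PolyBdd.id.add (.const 2)).pow E
  obtain ⟨P, hP⟩ := polyBdd_bppTime (Fintype.card M.K) d e (E + 3) (hpoly (3 * E))
  -- Number of trials, times simulations per trial, times steps per simulation, with at most one
  -- toss per step.
  obtain ⟨q, hq⟩ := (hpoly (E + 3)).mul (((hpoly (3 * E)).add (.const 1)).mul (hpoly e))
  have hM₃ : ∀ x r : List Bool, M₂.HaltsWith x (encList (l x.length)).reverse r (P.eval x.length)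
      ((trials M (x.length ^ d) ((x.length + 2) ^ e) x (l x.length)
        ((x.length + 2) ^ (E + 3))).run r).1 := fun x r =>
    (hM₂ x (l x.length) r (hln _)).mono ((bppTime_mono (hk' _)).trans (hP _))
  refine ⟨fun n => (encList (l n)).reverse, ?_, M₂, P, q, fun x => ⟨fun r => ⟨_, hM₃ x _⟩, ?_⟩⟩
  · simpa only [List.length_reverse, length_encList (hln _)] using isBigO_mul_logb hk
  · refine (two_thirds_le_card_trials M ((x.length + 2) ^ e) x (l x.length) (a x) (hl _)
      (hlx _ x rfl) (T := (x.length + 2) ^ (E + 3)) (q := q.eval x.length) ?_ ?_).trans ?_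
    · rw [pow_add, mul_comm]
      exact Nat.mul_le_mul_left _ (Nat.pow_le_pow_left (show 2 ≤ x.length + 2 by omega) 3)
    · refine le_trans ?_ (hq _)
      have := hk' x.length
      dsimp only
      gcongr
    · refine div_le_div_of_nonneg_right (Nat.cast_le.2 ?_) (by positivity)
      refine Nat.card_le_card_of_injective (fun r => ⟨r.1, _, hM₃ x _, ha.2 r.2⟩)
        fun r r' h => Subtype.ext (congrArg Subtype.val h :)

end Advice

theorem mainTheorem6
    (α : ℕ → List Bool) (hlen : ∀ n, (α n).length = n)
    (c : ℝ) (hc : 0 < c)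
    (hhard : α ∉ Advice.InfinitelyOften (Advice.UnaryFunEXPAdvice
      (fun n => ⌊(n : ℝ) - c * Real.logb 2 (Real.logb 2 n)⌋₊)))
    (A : Language Bool) (hA : A ∈ Advice.EXP)
    (d : ℕ) (hd : 0 < d)
    (hAα : A ∈ Advice.PAdvice (fun n => α (2 ^ n ^ d))) :
    A ∈ Advice.BPPAdviceBigO (fun n => (n : ℝ) * Real.logb 2 n) :=
  Advice.mem_bppAdviceBigO α hlen c hc hhard A hA d hd hAα
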